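/- **Theorem 1.** Adiabatic quantum computation in which every Hamiltonian is a nearest-neighbour Hamiltonian on a line of $9$-state particles is universal for quantum computation. In detail: *The chain.* Let $n\ge 1$, and let $Q$ be a circuit on $n$ qubits in *round form*: $R\ge 1$ rounds, each of which applies arbitrary two-qubit unitaries to the neighbouring qubits $(1,2),(2,3),\dots,(n-1,n)$, in this order. The associated chain has $N=nR$ particles, divided into $R$ consecutive blocks of $n$ particles. A particle has the $9$ basis states $q_b, g_b, r_b$ ($b\in\{0,1\}$; idle qubit, gate marker, right-moving flag), $l$ (left-moving flag), $\tau$ (turning flag) and $u$ (blank). The transition rules on neighbouring particles, with "$|$" denoting a block boundary, are, for all bits $a,b$: - inside a block: $g_a q_b\to\sum_{c,d}U_{cd,ab}\,q_c g_d$, where $U$ is the gate of that round (block) and that pair of qubits; $\tau u\to l u$; $q_a l\to l q_a$; $u l\to u\tau$; $\tau q_a\to u r_a$; $r_a q_b\to q_a r_b$; $r_a u\to q_a\tau$; - across a boundary: $g_a|u\to q_a|\tau$; $\tau|u\to l|u$; $q_a|l\to l|q_a$; $u|l\to u|\tau$; $r_a|q_b\to q_a|r_b$; $\tau|q_a\to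 u|g_a$; - on the first particle of the chain $l\to\tau$; on the last particle $\tau\to l$. Let $A$ be the sum of the corresponding operators, let $|\gamma(0)\rangle$ be the basis state with $g_0$ on the first particle, $q_0$ on the other particles of the first block and $u$ elsewhere, and let $|\gamma(t+1)\rangle=A|\gamma(t)\rangle$. Put $K=n(2n+3)(R-1)+n-1$. Let $H_{\rm prop}$ be the sum, over all places where a rule applies and over the data bits, of the terms $\frac12(|\alpha\rangle\langle\alpha|+|\beta\rangle\langle\beta|-|\alpha\rangle\langle\beta|-|\beta\rangle\langle\alpha|)$ for the rule $|\alpha\rangle\to|\beta\rangle$; let $H_0=I-|g_0\rangle\langle g_0|_1$ (acting on the first particle), and $H(s)=(1-s)H_0+sH_{\rm prop}$. Let $\mathcal K_0$ be the span of $|\gamma(0)\rangle,\dots,|\gamma(K)\rangle$ and $|\eta\rangle=\frac1{\sqrt{K+1}}\sum_{t=0}^K|\gamma(t)\rangle$ the history state. There are absolute constants $c,d\in\mathbb N$ such that for every $n\ge1$ the following hold. 1. For every $Q$ as above: - for all $s\in[0,1]$, $H(s)$ is a sum of at most $3N+1$ positive semidefinite terms of norm at most $1$, each acting only on a particle or on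 two neighbouring particles; - $|\gamma(0)\rangle,\dots,|\gamma(K)\rangle$ are orthonormal, $A|\gamma(K)\rangle=0$, and $|\gamma(K)\rangle$ is the final state of $Q$ on input $|0^n\rangle$, encoded in the last block: it is $\sum_x\phi_x|u\cdots u\,q_{x_1}\cdots q_{x_{n-1}}g_{x_n}\rangle$, where $\sum_x\phi_x|x\rangle$ is the final state of $Q$; - $|\gamma(0)\rangle$ is a ground state of $H_0$, and $|\eta\rangle$ is a ground state of $H_{\rm prop}$; - for all $s\in[0,1]$, $\mathcal K_0$ is invariant under $H(s)$; the lowest eigenvalue of $H(s)|_{\mathcal K_0}$ is simple, and the spectral gap of $H(s)|_{\mathcal K_0}$ is at least $\frac{1}{2(K+1)^2}$; - if $0<\varepsilon\le1$ and $T\ge c\,((K+1)/\varepsilon)^d$, then Schrödinger's equation with the Hamiltonian $H(t/T)$, $0\le t\le T$, and the initial state $|\gamma(0)\rangle$ has a solution; every solution stays in $\mathcal K_0$ and at time $T$ is within distance $\varepsilon$ of $z|\eta\rangle$ for some $z\in\mathbb C$ with $|z|=1$. 2. Every circuit $C$ on $n$ qubits with $L$ two-qubit gates (arbitrary unitaries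 on arbitrary pairs of qubits) is converted, for every $M\in\mathbb N$, by an explicit procedure (swap the two qubits of a gate together, apply the gate, swap back; one identity round at the beginning and $M+1$ identity rounds at the end) into a circuit $Q_{C,M}$ in round form with $nL+M+2$ rounds that computes the same unitary. Each gate of $Q_{C,M}$ is the identity, the swap gate, a gate of $C$, or a gate of $C$ with its two qubits exchanged. 3. If $0<\varepsilon\le 1$ and $M=\lceil 2(nL+1)/\varepsilon\rceil$, then the chain of $Q_{C,M}$ has at most $c\,((n+L)/\varepsilon)^d$ particles. For every $T\ge c\,((n+L)/\varepsilon)^d$ the adiabatic evolution of duration $T$ from $|\gamma(0)\rangle$ with the Hamiltonians $H(t/T)$ of this chain exists, and measuring its final state in the standard basis and reading the data bits from left to right gives a distribution on $\{0,1\}^n$ within total variation distance $\varepsilon$ of the output distribution of $C$ on input $|0^n\rangle$. -/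

import Mathlib

open Matrix
open scoped BigOperators ComplexOrder

noncomputable section

namespace AdiabaticLine

/-! ### Quantum circuits on `n` qubits -/

/-- Unitary two-qubit gates; the pair `(a, b)` lists the bits of the first and second qubit. -/
abbrev TwoQubitUnitary : Type := Matrix.unitaryGroup (Bool × Bool) ℂ

/-- The gate exchanging two qubits. -/
def swapGate : TwoQubitUnitary :=
  ⟨Equiv.Perm.permMatrix ℂ (Equiv.prodComm Bool Bool), by
    rw [Matrix.mem_unitaryGroup_iff, Matrix.star_eq_conjTranspose,
      Matrix.conjTranspose_permMatrix, ← Matrix.permMatrix_mul]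
    simp⟩

/-- A gate of a circuit: a two-qubit unitary applied to an ordered pair of distinct qubits. -/
structure CircuitGate (n : ℕ) where
  fst : Fin n
  snd : Fin n
  ne : fst ≠ snd
  unitary : TwoQubitUnitary

/-- A circuit is a list of gates; the head of the list is applied first. -/
abbrev Circuit (n : ℕ) : Type := List (CircuitGate n)

/-- The operator on `n` qubits given by a gate (identity on the qubits it does not touch). -/
def CircuitGate.matrix {n : ℕ} (g : CircuitGate n) : Matrix (Fin n → Bool) (Fin n → Bool) ℂ :=
  Matrix.of fun y x =>
    if ∀ k, k ≠ g.fst → k ≠ g.snd → y k = x k then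
      g.unitary.val (y g.fst, y g.snd) (x g.fst, x g.snd)
    else 0

/-- The operator on `n` qubits computed by a circuit. -/
def circuitMatrix {n : ℕ} : Circuit n → Matrix (Fin n → Bool) (Fin n → Bool) ℂ
  | [] => 1
  | g :: C => circuitMatrix C * g.matrix

/-- Amplitude of the basis state `x` in the state computed by `C` from the all-zero input. -/
def outputAmplitude {n : ℕ} (C : Circuit n) (x : Fin n → Bool) : ℂ :=
  circuitMatrix C x (fun _ => false)

/-- The distribution of the measured output of a circuit. -/
def circuitDistribution {n : ℕ} (C : Circuit n) (x : Fin n → Bool) : ℝ :=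
  ‖outputAmplitude C x‖ ^ 2

/-- A circuit in round form: `rounds` rounds, each of which applies a gate to the neighbouring
qubits `(0, 1)`, then to `(1, 2)`, and so on up to `(n - 2, n - 1)`. The gate of round `r` on the
qubits `(i, i + 1)` is `gate r i`; values with `rounds ≤ r` or `n ≤ i + 1` are never used. -/
structure RoundCircuit (n : ℕ) where
  rounds : ℕ
  gate : ℕ → ℕ → TwoQubitUnitary

/-- The gates of one round, in the order in which they are applied. -/
def RoundCircuit.round {n : ℕ} (Q : RoundCircuit n) (r : ℕ) : Circuit n :=
  List.ofFn fun i : Fin (n - 1) =>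
    { fst := ⟨i.val, by omega⟩
      snd := ⟨i.val + 1, by omega⟩
      ne := by simp
      unitary := Q.gate r i.val }

/-- A round circuit as a circuit. -/
def RoundCircuit.toCircuit {n : ℕ} (Q : RoundCircuit n) : Circuit n :=
  (List.range Q.rounds).flatMap Q.round

/-- Round form of a single gate, using `n` rounds. Let `p < q` be the two qubits. Round `0` swaps
the qubit at `p` rightwards to position `q - 1` and then applies the gate to the positions
`(q - 1, q)`; round `t > 0` swaps the positions `(q - 1 - t, q - t)` as long as `p ≤ q - 1 - t`,
so that the displaced qubit returns to `p`. -/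
def routeGate {n : ℕ} (g : CircuitGate n) (t i : ℕ) : TwoQubitUnitary :=
  let p : ℕ := min g.fst.val g.snd.val
  let q : ℕ := max g.fst.val g.snd.val
  if t = 0 then
    if p ≤ i ∧ i + 1 < q then swapGate
    else if i + 1 = q then
      if g.fst < g.snd then g.unitary else swapGate * g.unitary * swapGate
    else 1
  else if p ≤ i ∧ i + 1 + t = q then swapGate
  else 1

/-- Round form of a circuit: one round of identity gates, then `n` rounds for every gate, then
`M + 1` rounds of identity gates. -/
def compile {n : ℕ} (C : Circuit n) (M : ℕ) : RoundCircuit n where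
  rounds := n * C.length + M + 2
  gate r i :=
    if r = 0 then 1
    else
      match C[(r - 1) / n]? with
      | some g => routeGate g ((r - 1) % n) i
      | none => 1

/-! ### Chains of nine-state particles -/

/-- The states of a particle. `qubit`, `gate` and `right` are two-dimensional subspaces carrying a
qubit (idle qubit, gate marker, right-moving flag); the left-moving flag `left`, the turning flag
`turn` and `blank` are one-dimensional. -/
inductive Site : Type
  | qubit (b : Bool)
  | gate (b : Bool)
  | right (b : Bool)
  | left
  | turn
  | blank
  deriving DecidableEq, Fintype

/-- Standard basis states of a chain of `N` particles. -/
abbrev Config (N : ℕ) : Type := Fin N → Site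

/-- The Hilbert space of a chain of `N` particles. -/
abbrev Chain (N : ℕ) : Type := EuclideanSpace ℂ (Config N)

/-- Operators on a chain, as matrices in the standard basis. -/
abbrev Op (N : ℕ) : Type := Matrix (Config N) (Config N) ℂ

/-- `A` acts only on the particles in `S`: it is the tensor product of an operator on these
particles and the identity on all others. -/
def ActsOn {N : ℕ} (S : Set (Fin N)) (A : Op N) : Prop :=
  ∃ B : Matrix (S → Site) (S → Site) ℂ, ∀ v w : Config N,
    ((∀ l, l ∉ S → v l = w l) → A v w = B (fun l => v l) (fun l => w l)) ∧
    ((∃ l, l ∉ S ∧ v l ≠ w l) → A v w = 0)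

/-- `H` is a nearest-neighbour Hamiltonian with `m` terms: a sum of `m` positive semidefinite terms
of operator norm at most one, each acting only on two neighbouring particles (or on one). -/
def IsNearestNeighbour {N : ℕ} (m : ℕ) (H : Op N) : Prop :=
  ∃ h : Fin m → Op N, H = ∑ j, h j ∧ ∀ j,
    (h j).PosSemidef ∧ ‖Matrix.toEuclideanCLM (𝕜 := ℂ) (h j)‖ ≤ 1 ∧
    ∃ k : ℕ, ActsOn {l : Fin N | l.val = k ∨ l.val = k + 1} (h j)

/-- Operator on one particle, extended to the chain. -/
def onSite {N : ℕ} (k : Fin N) (A : Matrix Site Site ℂ) : Op N :=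
  Matrix.of fun v w => if ∀ l, l ≠ k → v l = w l then A (v k) (w k) else 0

/-- Operator on two particles, extended to the chain. -/
def onPair {N : ℕ} (k l : Fin N) (A : Matrix (Site × Site) (Site × Site) ℂ) : Op N :=
  Matrix.of fun v w =>
    if ∀ j, j ≠ k → j ≠ l → v j = w j then A (v k, v l) (w k, w l) else 0

/-! ### The transition rules

The chain is divided into consecutive blocks of `n` particles, one block for each round. -/

/-- The transition rules, other than the gate rule, on two neighbouring particles of the same block
(`boundary = false`) or on the two sides of a block boundary (`boundary = true`). -/
def hop (boundary : Bool) : Site × Site → Option (Site × Site)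
  | (.turn, .blank) => some (.left, .blank)
  | (.qubit a, .left) => some (.left, .qubit a)
  | (.blank, .left) => some (.blank, .turn)
  | (.right a, .qubit b) => some (.qubit a, .right b)
  | (.turn, .qubit a) => some (.blank, if boundary then .gate a else .right a)
  | (.right a, .blank) => if boundary then none else some (.qubit a, .turn)
  | (.gate a, .blank) => if boundary then some (.qubit a, .turn) else none
  | _ => none

/-- The gate rule: the marker moves one step to the right while `U` is applied to the two qubits.
The arguments are the final and the initial state of the pair. -/
def gateAmplitude (U : TwoQubitUnitary) : Site × Site → Site × Site → ℂ
  | (.qubit c, .gate d), (.gate a, .qubit b) => U.val (c, d) (a, b)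
  | _, _ => 0

/-- The operator carrying out the transition rules on a pair of neighbours. -/
def pairTransition (boundary : Bool) (U : TwoQubitUnitary) :
    Matrix (Site × Site) (Site × Site) ℂ :=
  Matrix.of fun y x =>
    (if hop boundary x = some y then 1 else 0) + (if boundary then 0 else gateAmplitude U y x)

variable {n : ℕ}

/-- The number of particles. -/
abbrev RoundCircuit.size (Q : RoundCircuit n) : ℕ := n * Q.rounds

/-- Transition rules on the particles `k` and `k + 1` (none if `k` is the last particle). The bond
crosses a block boundary if `n` divides `k + 1`; otherwise its gate is the one of the round
`k / n` on the qubits `k % n` and `k % n + 1`. -/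
def bondTransition (Q : RoundCircuit n) (k : Fin Q.size) : Op Q.size :=
  if h : k.val + 1 < Q.size then
    onPair k ⟨k.val + 1, h⟩
      (pairTransition (decide ((k.val + 1) % n = 0)) (Q.gate (k.val / n) (k.val % n)))
  else 0

/-- Rule at the left end of the chain: on the first particle, `left` becomes `turn`. -/
def leftEndTransition (Q : RoundCircuit n) (k : Fin Q.size) : Op Q.size :=
  if k.val = 0 then onSite k (Matrix.single Site.turn Site.left 1) else 0

/-- Rule at the right end of the chain: on the last particle, `turn` becomes `left`. -/
def rightEndTransition (Q : RoundCircuit n) (k : Fin Q.size) : Op Q.size :=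
  if k.val + 1 = Q.size then onSite k (Matrix.single Site.left Site.turn 1) else 0

/-- One step forward: the sum of all transition rules. -/
def forward (Q : RoundCircuit n) : Op Q.size :=
  ∑ k, (bondTransition Q k + leftEndTransition Q k + rightEndTransition Q k)

/-! ### The adiabatic evolution -/

/-- The energy penalty of a transition rule: if `V` maps an orthonormal family of states `α` to
an orthonormal family `β` and the rest to zero, this is the sum of
`(|α⟩⟨α| + |β⟩⟨β| - |α⟩⟨β| - |β⟩⟨α|) / 2`. -/
def penalty {N : ℕ} (V : Op N) : Op N :=
  (1 / 2 : ℂ) • (Vᴴ * V + V * Vᴴ - V - Vᴴ)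

/-- The propagation Hamiltonian. -/
def Hprop (Q : RoundCircuit n) : Op Q.size :=
  ∑ k, (penalty (bondTransition Q k) + penalty (leftEndTransition Q k) +
    penalty (rightEndTransition Q k))

/-- The initial Hamiltonian: the projector onto the states in which the first particle is not a
gate marker carrying the bit zero. -/
def Hinit (Q : RoundCircuit n) : Op Q.size :=
  Matrix.diagonal fun v => if ∃ k, k.val = 0 ∧ v k = Site.gate false then 0 else 1

/-- The interpolating Hamiltonian. -/
def Hadiabatic (Q : RoundCircuit n) (s : ℝ) : Op Q.size :=
  ((1 - s : ℝ) : ℂ) • Hinit Q + (s : ℂ) • Hprop Q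

/-- The initial configuration: the first block holds `n` qubits in the state zero, the first of
them marked as active, and all other particles are blank. -/
def initialConfig (Q : RoundCircuit n) : Config Q.size := fun k =>
  if k.val = 0 then .gate false else if k.val < n then .qubit false else .blank

/-- The final configuration with data `x`: the last block holds the qubits, the last one marked as
active, and all other particles are blank. -/
def finalConfig (Q : RoundCircuit n) (x : Fin n → Bool) : Config Q.size := fun k =>
  if k.val < n * (Q.rounds - 1) then .blank
  else if h : k.val - n * (Q.rounds - 1) < n then
    if k.val + 1 = Q.size then .gate (x ⟨_, h⟩) else .qubit (x ⟨_, h⟩)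
  else .blank

/-- The state of the chain after `t` forward steps from the initial configuration. -/
def gammaState (Q : RoundCircuit n) : ℕ → Chain Q.size
  | 0 => EuclideanSpace.single (initialConfig Q) 1
  | t + 1 => Matrix.toEuclideanLin (forward Q) (gammaState Q t)

/-- The number `K` of steps from the initial to the final configuration. -/
def RoundCircuit.steps (Q : RoundCircuit n) : ℕ :=
  n * (2 * n + 3) * (Q.rounds - 1) + n - 1

/-- The space spanned by the states `gammaState Q t`, `t = 0, …, K`. -/
def historySpace (Q : RoundCircuit n) : Submodule ℂ (Chain Q.size) :=
  Submodule.span ℂ (Set.range fun t : Fin (Q.steps + 1) => gammaState Q t)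

/-- The history state. -/
def historyState (Q : RoundCircuit n) : Chain Q.size :=
  ((1 / Real.sqrt ((Q.steps : ℝ) + 1) : ℝ) : ℂ) • ∑ t : Fin (Q.steps + 1), gammaState Q t

/-- `E` is an eigenvalue of `H` on the subspace `S`. -/
def IsEnergyOn {N : ℕ} (H : Op N) (S : Submodule ℂ (Chain N)) (E : ℝ) : Prop :=
  ∃ v ∈ S, v ≠ 0 ∧ Matrix.toEuclideanLin H v = (E : ℂ) • v

/-- `ψ` is a ground state of `H`. -/
def IsGroundState {N : ℕ} (H : Op N) (ψ : Chain N) : Prop :=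
  ψ ≠ 0 ∧ ∃ E : ℝ, Matrix.toEuclideanLin H ψ = (E : ℂ) • ψ ∧ ∀ E', IsEnergyOn H ⊤ E' → E ≤ E'

/-- The spectral gap of `H` on the subspace `S` is at least `δ`: the restriction has a simple
eigenvalue, and all its other eigenvalues are larger by at least `δ`. -/
def HasGapOn {N : ℕ} (H : Op N) (S : Submodule ℂ (Chain N)) (δ : ℝ) : Prop :=
  ∃ E₀ : ℝ,
    Module.finrank ℂ ↥(Module.End.eigenspace (Matrix.toEuclideanLin H) (E₀ : ℂ) ⊓ S) = 1 ∧
    ∀ E, IsEnergyOn H S E → E = E₀ ∨ E₀ + δ ≤ E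

/-- `ψ` solves Schrödinger's equation on `[0, T]` with the Hamiltonian `H (t / T)` at time `t` and
the initial state `ψ₀`. -/
def IsEvolution {N : ℕ} (H : ℝ → Op N) (T : ℝ) (ψ₀ : Chain N) (ψ : ℝ → Chain N) : Prop :=
  ψ 0 = ψ₀ ∧ ∀ t ∈ Set.Icc 0 T,
    HasDerivWithinAt ψ (-Complex.I • Matrix.toEuclideanLin (H (t / T)) (ψ t)) (Set.Icc 0 T) t

/-- The bit carried by a particle, if any. -/
def Site.bit : Site → Option Bool
  | .qubit b => some b
  | .gate b => some b
  | .right b => some b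
  | _ => none

/-- The bits carried by the particles of a chain, read from left to right. -/
def readBits {N : ℕ} (v : Config N) : List Bool :=
  (List.ofFn v).filterMap Site.bit

/-- The probability of reading the bits `x` when all particles are measured in the standard
basis. -/
def measuredDistribution {N : ℕ} (ψ : Chain N) (x : Fin n → Bool) : ℝ :=
  ∑ v : Config N, if readBits v = List.ofFn x then ‖ψ v‖ ^ 2 else 0

/-- Total variation distance. -/
def totalVariation {α : Type} [Fintype α] (P P' : α → ℝ) : ℝ :=
  (1 / 2) * ∑ x, |P x - P' x|

end AdiabaticLine

end

/-!
Every transition rule is a partial isometry `V` on one or two particles with `V * V = 0`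
(`isHop_pairTransition`), so
its penalty is half of `W * Wᴴ` with `W = Vᴴ * V - V`, and a projector; this gives the
nearest-neighbour terms. A configuration of the evolution contains exactly one active particle (gate
marker or flag), which looks to one side. Hence at most one rule can be applied to it, and at
most one can be undone (`placeOp_ne_zero`, `site_forward`, `site_backward`). The configurations
are listed explicitly by `config`, and superposing them with the amplitudes of the partially
executed circuit gives states that form a path (`isHopPath_timeState`): the adjoint of the step
operator maps each of them back to its predecessor and annihilates the first one, whence
orthonormality, and on the path the propagation Hamiltonian is half of the Laplacian of a line with
`K + 1` vertices (`IsHopPath.penalty_apply`).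

So on the history space the Hamiltonian `H s` is that of a clock with `K + 1` positions
(`historyEmbedding_clockH`), independently of the circuit. On the kernel of a suitable linear
functional its energy is bounded below by a discrete Poincaré inequality, which gives a gapped
ground state for every `s` (`clock_gapped`). For the evolution an adiabatic theorem with explicit
constants is proved for affine families with a gap: the spectral projector is differentiable along
the family, with derivatives given by the reduced resolvent, and integration by parts bounds the
population lost from the ground state by a polynomial in the inverse gap divided by the duration
(`IsGappedGround`, `ground_population_ge`). It yields `clock_adiabatic`, which the embedding
transports to the chain (`adiabatic_evolution`); uniqueness of solutions shows that no evolution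
leaves the history space.

An arbitrary circuit is brought into round form by permutations of qubits: the swaps of the first
round conjugate the gate to its original position as they are undone in the following rounds
(`routeOp_succ`, `routeOp_all`). In the history state of the compiled circuit all but the fraction
`(n * L + 1) / (n * L + M + 1)` of the times show the output of the circuit, and the data can be
read off from the configuration at any time (`readBits_config`, `totalVariation_historyState`).
Since distributions measured in close states are close, the polynomial bounds finish the argument
(`simulation`).
-/

namespace AdiabaticLine

/-! ### The reduced resolvent along a gapped family -/

section Calculus

open Set

theorem hasDerivWithinAt_of_quadratic {F : Type*} [NormedAddCommGroup F] [NormedSpace ℝ F]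
    {f : ℝ → F} {f' : F} {s : Set ℝ} {a C : ℝ}
    (h : ∀ b ∈ s, ‖f b - f a - (b - a) • f'‖ ≤ C * (b - a) ^ 2) : HasDerivWithinAt f f' s a := by
  rw [hasDerivWithinAt_iff_isLittleO]
  have h1 : (fun b => f b - f a - (b - a) • f') =O[nhdsWithin a s] fun b => (b - a) ^ 2 := by
    refine Asymptotics.IsBigO.of_bound C ?_
    filter_upwards [self_mem_nhdsWithin] with b hb
    simpa using h b hb
  refine h1.trans_isLittleO ?_
  have h2 : (fun b : ℝ => b - a) =o[nhdsWithin a s] fun _ => (1 : ℝ) := by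
    rw [Asymptotics.isLittleO_one_iff]
    have : ContinuousAt (fun b : ℝ => b - a) a := by fun_prop
    simpa [ContinuousAt] using this.tendsto.mono_left (nhdsWithin_le_nhds (s := s))
  simpa [pow_two] using
    (Asymptotics.isBigO_refl (fun b : ℝ => b - a) (nhdsWithin a s)).mul_isLittleO h2

variable {𝒜 : Type*} [NormedRing 𝒜] [NormedAlgebra ℝ 𝒜]

/-- The spectral data of `H` at an isolated eigenvalue `e` that the calculus below uses: the
projector `P` on the eigenspace, and the inverse `S` of `H - e + δ P`, which off the range of `P`
is the resolvent of `H` at `e`. The derivative of `e` in the direction `V` is `w`. -/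
structure SpectralData (H V P S : 𝒜) (e w δ : ℝ) : Prop where
  proj : P * P = P
  norm_proj : ‖P‖ = 1
  norm_compl : ‖1 - P‖ ≤ 1
  mul_proj : H * P = e • P
  proj_mul : P * H = e • P
  inv_left : S * (H - e • 1 + δ • P) = 1
  inv_right : (H - e • 1 + δ • P) * S = 1
  norm_inv : ‖S‖ ≤ 1 / δ
  slope : P * V * P = w • P

/-- The reduced resolvent: the inverse of `H - e` on the complement of the range of `P`. -/
def reducedResolvent (P S : 𝒜) : 𝒜 := S * (1 - P)

/-- The derivative of the spectral projector of `H` when `H` moves in the direction `V`. -/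
def projDeriv (V P S : 𝒜) : 𝒜 :=
  -(reducedResolvent P S * V * P + P * V * reducedResolvent P S)

/-- A solution `X` of `H X - X H = projDeriv V P S`. -/
def transport (V P S : 𝒜) : 𝒜 :=
  P * V * (reducedResolvent P S * reducedResolvent P S) -
    reducedResolvent P S * reducedResolvent P S * V * P

namespace SpectralData

variable {H V P S : 𝒜} {e w δ : ℝ}

theorem proj_mul_compl (h : SpectralData H V P S e w δ) : P * (1 - P) = 0 := by
  rw [mul_sub, mul_one, h.proj, sub_self]

theorem compl_mul_proj (h : SpectralData H V P S e w δ) : (1 - P) * P = 0 := by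
  rw [sub_mul, one_mul, h.proj, sub_self]

theorem compl_mul_compl (h : SpectralData H V P S e w δ) : (1 - P) * (1 - P) = 1 - P := by
  rw [mul_sub, h.compl_mul_proj]; simp

theorem inv_compl_comm (h : SpectralData H V P S e w δ) :
    S * (1 - P) = (1 - P) * S := by
  have h1 : (1 - P) * (H - e • 1 + δ • P) = (H - e • 1 + δ • P) * (1 - P) := by
    simp only [mul_sub, sub_mul, mul_add, add_mul, h.mul_proj, h.proj_mul, one_mul, mul_one,
      mul_smul_comm, smul_mul_assoc, smul_sub]
    abel
  calc S * (1 - P) = S * ((1 - P) * (H - e • 1 + δ • P)) * S := by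
        rw [mul_assoc S, mul_assoc (1 - P), h.inv_right, mul_one]
    _ = (S * (H - e • 1 + δ • P)) * ((1 - P) * S) := by rw [h1]; simp only [mul_assoc]
    _ = _ := by rw [h.inv_left, one_mul]

theorem resolvent_mul (h : SpectralData H V P S e w δ) :
    reducedResolvent P S * (H - e • 1) = 1 - P := by
  have h1 : S * (1 - P) * (H - e • 1 + δ • P) = 1 - P := by
    rw [h.inv_compl_comm, mul_assoc, h.inv_left, mul_one]
  rw [mul_add, mul_smul_comm, mul_assoc S (1 - P) P, h.compl_mul_proj] at h1
  simpa [reducedResolvent] using h1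

theorem mul_resolvent (h : SpectralData H V P S e w δ) :
    (H - e • 1) * reducedResolvent P S = 1 - P := by
  have h1 : (H - e • 1 + δ • P) * (S * (1 - P)) = 1 - P := by
    rw [← mul_assoc, h.inv_right, one_mul]
  rw [h.inv_compl_comm, add_mul, smul_mul_assoc, ← mul_assoc P, h.proj_mul_compl,
    ← h.inv_compl_comm] at h1
  simpa [reducedResolvent] using h1

theorem resolvent_mul_compl (h : SpectralData H V P S e w δ) :
    reducedResolvent P S * (1 - P) = reducedResolvent P S := by
  rw [reducedResolvent, mul_assoc, h.compl_mul_compl]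

theorem compl_mul_resolvent (h : SpectralData H V P S e w δ) :
    (1 - P) * reducedResolvent P S = reducedResolvent P S := by
  rw [reducedResolvent, h.inv_compl_comm, ← mul_assoc, h.compl_mul_compl]

theorem commutator_transport (h : SpectralData H V P S e w δ) :
    H * transport V P S - transport V P S * H = projDeriv V P S := by
  have b1 : (H - e • 1) * P = 0 := by rw [sub_mul, h.mul_proj]; simp
  have b2 : P * (H - e • 1) = 0 := by rw [mul_sub, h.proj_mul]; simp
  have h1 := h.mul_resolvent
  have h2 := h.resolvent_mul
  have h3 := h.resolvent_mul_compl
  have h4 := h.compl_mul_resolvent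
  have : H * transport V P S - transport V P S * H
      = (H - e • 1) * transport V P S - transport V P S * (H - e • 1) := by
    simp [sub_mul, mul_sub]
  rw [this]
  simp only [transport, projDeriv]
  generalize reducedResolvent P S = R at *
  generalize H - e • 1 = B at *
  have a1 : B * (R * R * V * P) = R * V * P := by
    simp only [← mul_assoc]; rw [h1, h4]
  have a2 : P * V * (R * R) * B = P * V * R := by
    rw [mul_assoc, mul_assoc R, h2, h3]
  have a3 : R * R * V * P * B = 0 := by rw [mul_assoc _ P, b2, mul_zero]
  have a4 : B * (P * V * (R * R)) = 0 := by simp only [← mul_assoc]; rw [b1]; simp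
  rw [mul_sub, sub_mul, a1, a2, a3, a4]
  abel

theorem norm_resolvent (h : SpectralData H V P S e w δ) :
    ‖reducedResolvent P S‖ ≤ 1 / δ := by
  have := norm_mul_le_of_le h.norm_inv h.norm_compl
  simpa [reducedResolvent] using this

theorem norm_projDeriv (h : SpectralData H V P S e w δ) {v : ℝ} (hv : ‖V‖ ≤ v) :
    ‖projDeriv V P S‖ ≤ 2 * v / δ := by
  have hR := h.norm_resolvent
  have h1 := norm_mul_le_of_le (norm_mul_le_of_le hR hv) h.norm_proj.le
  have h2 := norm_mul_le_of_le (norm_mul_le_of_le h.norm_proj.le hv) hR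
  rw [projDeriv, norm_neg]
  refine (norm_add_le_of_le h1 h2).trans (le_of_eq ?_)
  ring

theorem norm_transport (h : SpectralData H V P S e w δ) {v : ℝ} (hv : ‖V‖ ≤ v) :
    ‖transport V P S‖ ≤ 2 * v / δ ^ 2 := by
  have hR := norm_mul_le_of_le (h.norm_resolvent) (h.norm_resolvent)
  have h1 := norm_mul_le_of_le (norm_mul_le_of_le hR hv) h.norm_proj.le
  have h2 := norm_mul_le_of_le (norm_mul_le_of_le h.norm_proj.le hv) hR
  refine (norm_sub_le_of_le h2 h1).trans (le_of_eq ?_)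
  ring

end SpectralData

/-! ### Differentiability of the spectral data -/

/-- Spectral data along the segment `H₀ + s V`, `s ∈ [0, 1]`, with an eigenvalue that is Lipschitz
in `s`. -/
structure SpectralFamily (H₀ V : 𝒜) (P S : ℝ → 𝒜) (e w : ℝ → ℝ) (δ v : ℝ) : Prop where
  data : ∀ s ∈ Icc (0 : ℝ) 1, SpectralData (H₀ + s • V) V (P s) (S s) (e s) (w s) δ
  pos : 0 < δ
  norm_dir : ‖V‖ ≤ v
  slope_le : ∀ s ∈ Icc (0 : ℝ) 1, |w s| ≤ v
  lipschitz : ∀ a ∈ Icc (0 : ℝ) 1, ∀ b ∈ Icc (0 : ℝ) 1, |e b - e a| ≤ v * |b - a|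

namespace SpectralFamily

variable {H₀ V : 𝒜} {P S : ℝ → 𝒜} {e w : ℝ → ℝ} {δ v : ℝ}

theorem dir_nonneg (h : SpectralFamily H₀ V P S e w δ v) : 0 ≤ v :=
  (norm_nonneg _).trans h.norm_dir

/-- The part of the projector at `b` that leaves the eigenspace at `a`. -/
theorem compl_mul_proj_eq (h : SpectralFamily H₀ V P S e w δ v) {a b : ℝ}
    (ha : a ∈ Icc (0 : ℝ) 1) (hb : b ∈ Icc (0 : ℝ) 1) :
    (1 - P a) * P b = reducedResolvent (P a) (S a) * ((a - b) • V + (e b - e a) • 1) * P b := by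
  have h1 : (H₀ + a • V - e a • 1) * P b = ((a - b) • V + (e b - e a) • 1) * P b := by
    have := (h.data b hb).mul_proj
    rw [add_mul] at this
    have h0 : H₀ * P b = e b • P b - (b • V) * P b := by rw [← this]; abel
    rw [sub_mul, add_mul, h0]
    simp only [sub_mul, add_mul, smul_mul_assoc, one_mul, sub_smul]
    abel
  rw [mul_assoc, ← h1, ← mul_assoc, (h.data a ha).resolvent_mul]

theorem norm_compl_mul_proj (h : SpectralFamily H₀ V P S e w δ v) {a b : ℝ}
    (ha : a ∈ Icc (0 : ℝ) 1) (hb : b ∈ Icc (0 : ℝ) 1) :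
    ‖(1 - P a) * P b‖ ≤ 2 * v / δ * |b - a| := by
  have h1 : ‖((a - b) • V + (e b - e a) • 1) * P b‖ ≤ 2 * v * |b - a| := by
    rw [add_mul, smul_mul_assoc, smul_mul_assoc, one_mul]
    have h2 : ‖(a - b) • (V * P b)‖ ≤ |b - a| * (v * 1) := by
      rw [norm_smul, Real.norm_eq_abs, abs_sub_comm]
      have := norm_mul_le_of_le h.norm_dir (h.data b hb).norm_proj.le
      gcongr
    have h3 : ‖(e b - e a) • P b‖ ≤ v * |b - a| := by
      rw [norm_smul, Real.norm_eq_abs, (h.data b hb).norm_proj, mul_one]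
      exact h.lipschitz a ha b hb
    refine (norm_add_le_of_le h2 h3).trans (le_of_eq (by ring))
  rw [h.compl_mul_proj_eq ha hb, mul_assoc]
  refine (norm_mul_le_of_le ((h.data a ha).norm_resolvent) h1).trans (le_of_eq (by ring))

theorem proj_mul_compl_eq (h : SpectralFamily H₀ V P S e w δ v) {a b : ℝ}
    (ha : a ∈ Icc (0 : ℝ) 1) (hb : b ∈ Icc (0 : ℝ) 1) :
    P b * (1 - P a) = P b * ((a - b) • V + (e b - e a) • 1) * reducedResolvent (P a) (S a) := by
  have h1 : P b * (H₀ + a • V - e a • 1) = P b * ((a - b) • V + (e b - e a) • 1) := by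
    have := (h.data b hb).proj_mul
    rw [mul_add] at this
    have h0 : P b * H₀ = e b • P b - P b * (b • V) := by rw [← this]; abel
    rw [mul_sub, mul_add, h0]
    simp only [mul_sub, mul_add, mul_smul_comm, mul_one, sub_smul]
    abel
  rw [← h1, mul_assoc, (h.data a ha).mul_resolvent]

theorem norm_proj_mul_compl (h : SpectralFamily H₀ V P S e w δ v) {a b : ℝ}
    (ha : a ∈ Icc (0 : ℝ) 1) (hb : b ∈ Icc (0 : ℝ) 1) :
    ‖P b * (1 - P a)‖ ≤ 2 * v / δ * |b - a| := by
  have h1 : ‖P b * ((a - b) • V + (e b - e a) • 1)‖ ≤ 2 * v * |b - a| := by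
    rw [mul_add, mul_smul_comm, mul_smul_comm, mul_one]
    have h2 : ‖(a - b) • (P b * V)‖ ≤ |b - a| * (1 * v) := by
      rw [norm_smul, Real.norm_eq_abs, abs_sub_comm]
      have := norm_mul_le_of_le (h.data b hb).norm_proj.le h.norm_dir
      gcongr
    have h3 : ‖(e b - e a) • P b‖ ≤ v * |b - a| := by
      rw [norm_smul, Real.norm_eq_abs, (h.data b hb).norm_proj, mul_one]
      exact h.lipschitz a ha b hb
    refine (norm_add_le_of_le h2 h3).trans (le_of_eq (by ring))
  rw [h.proj_mul_compl_eq ha hb]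
  refine (norm_mul_le_of_le h1 (h.data a ha).norm_resolvent).trans (le_of_eq (by ring))

theorem norm_proj_sub (h : SpectralFamily H₀ V P S e w δ v) {a b : ℝ}
    (ha : a ∈ Icc (0 : ℝ) 1) (hb : b ∈ Icc (0 : ℝ) 1) :
    ‖P b - P a‖ ≤ 4 * v / δ * |b - a| := by
  have : P b - P a = (1 - P a) * P b - P a * (1 - P b) := by noncomm_ring
  rw [this]
  have h1 := h.norm_proj_mul_compl hb ha
  rw [abs_sub_comm] at h1
  refine (norm_sub_le_of_le (h.norm_compl_mul_proj ha hb) h1).trans (le_of_eq (by ring))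

theorem hasDerivWithinAt_eigenvalue (h : SpectralFamily H₀ V P S e w δ v)
    {a : ℝ} (ha : a ∈ Icc (0 : ℝ) 1) : HasDerivWithinAt e (w a) (Icc 0 1) a := by
  refine hasDerivWithinAt_of_quadratic (C := v * (4 * v / δ) + v * (4 * v / δ)) fun b hb => ?_
  have hv := h.dir_nonneg
  have hA := h.data a ha
  have h1 : (e b - e a) • (P a * P b) = (b - a) • (P a * V * P b) := by
    have e1 : P a * (H₀ + b • V) * P b = e b • (P a * P b) := by
      rw [mul_assoc, (h.data b hb).mul_proj, mul_smul_comm]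
    have e2 : P a * (H₀ + a • V) * P b = e a • (P a * P b) := by
      rw [hA.proj_mul, smul_mul_assoc]
    rw [sub_smul, ← e1, ← e2, sub_smul]
    simp only [mul_add, add_mul, mul_smul_comm, smul_mul_assoc]
    abel
  have h2 : (e b - e a - (b - a) * w a) • P a =
      (e b - e a) • (P a * (P a - P b)) + (b - a) • (P a * V * (P b - P a)) := by
    rw [mul_sub, mul_sub, hA.proj, hA.slope, smul_sub, smul_sub, h1, sub_smul, mul_smul]
    abel
  have h3 : ‖e b - e a - (b - a) • w a‖ = ‖(e b - e a - (b - a) * w a) • P a‖ := by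
    rw [norm_smul, hA.norm_proj, mul_one, smul_eq_mul]
  rw [h3, h2]
  have hd := h.norm_proj_sub ha hb
  have hd' : ‖P a - P b‖ ≤ 4 * v / δ * |b - a| := by rwa [norm_sub_rev]
  have h4 : ‖(e b - e a) • (P a * (P a - P b))‖ ≤
      (v * |b - a|) * (1 * (4 * v / δ * |b - a|)) := by
    rw [norm_smul]
    exact mul_le_mul (h.lipschitz a ha b hb) (norm_mul_le_of_le hA.norm_proj.le hd')
      (norm_nonneg _) (by positivity)
  have h5 : ‖(b - a) • (P a * V * (P b - P a))‖ ≤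
      |b - a| * ((1 * v) * (4 * v / δ * |b - a|)) := by
    rw [norm_smul]
    exact mul_le_mul le_rfl
      (norm_mul_le_of_le (norm_mul_le_of_le hA.norm_proj.le h.norm_dir) hd)
      (norm_nonneg _) (by positivity)
  refine (norm_add_le_of_le h4 h5).trans (le_of_eq ?_)
  rw [← sq_abs (b - a)]; ring

theorem hasDerivWithinAt_proj (h : SpectralFamily H₀ V P S e w δ v)
    {a : ℝ} (ha : a ∈ Icc (0 : ℝ) 1) :
    HasDerivWithinAt P (projDeriv V (P a) (S a)) (Icc 0 1) a := by
  have hv := h.dir_nonneg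
  have hδ := h.pos
  set L := 4 * v / δ with hL
  refine hasDerivWithinAt_of_quadratic (C := 2 * (2 * v / δ) ^ 2 + 2 * (2 * (1 / δ * v * L)))
    fun b hb => ?_
  have hA := h.data a ha
  have hB := h.data b hb
  set R := reducedResolvent (P a) (S a) with hR
  have hRn : ‖R‖ ≤ 1 / δ := hA.norm_resolvent
  have hd : ‖P b - P a‖ ≤ L * |b - a| := h.norm_proj_sub ha hb
  -- the diagonal blocks of `P b - P a` are quadratic in `b - a`
  have dec : P b - P a - (b - a) • projDeriv V (P a) (S a) =
      ((1 - P a) * P b) * (P b * (1 - P a)) - (P a * (1 - P b)) * ((1 - P b) * P a) +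
      (((1 - P a) * P b) * P a + (b - a) • (R * V * P a)) +
      (P a * (P b * (1 - P a)) + (b - a) • (P a * V * R)) := by
    have e1 : ((1 - P a) * P b) * (P b * (1 - P a)) = (1 - P a) * P b * (1 - P a) := by
      rw [mul_assoc, ← mul_assoc (P b), hB.proj, ← mul_assoc]
    have e2 : (P a * (1 - P b)) * ((1 - P b) * P a) = P a * (1 - P b) * P a := by
      rw [mul_assoc, ← mul_assoc (1 - P b), hB.compl_mul_compl, ← mul_assoc]
    have e3 : P a * (1 - P b) * P a = P a - P a * P b * P a := by
      rw [mul_sub, sub_mul, mul_one, hA.proj]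
    rw [e1, e2, e3, projDeriv, ← hR, smul_neg, smul_add]
    have : P b = (1 - P a) * P b * (1 - P a) + P a * P b * P a + (1 - P a) * P b * P a +
      P a * (P b * (1 - P a)) := by noncomm_ring
    nth_rewrite 1 [this]
    abel
  have d1 : ‖((1 - P a) * P b) * P a + (b - a) • (R * V * P a)‖ ≤
      2 * (1 / δ * v * L) * |b - a| ^ 2 := by
    have e1 : ((1 - P a) * P b) * P a + (b - a) • (R * V * P a) =
        (a - b) • (R * V * ((P b - P a) * P a)) +
        (e b - e a) • (R * ((P b - P a) * P a)) := by
      have z : R * P a = 0 := by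
        rw [hR, reducedResolvent, mul_assoc, hA.compl_mul_proj, mul_zero]
      rw [h.compl_mul_proj_eq ha hb, ← hR, sub_mul, hA.proj, mul_sub, mul_sub, z, sub_zero]
      simp only [mul_add, add_mul, mul_sub, sub_mul, mul_smul_comm, smul_mul_assoc, mul_one,
        smul_sub, mul_assoc, sub_smul]
      abel
    rw [e1]
    have f0 : ‖(P b - P a) * P a‖ ≤ L * |b - a| * 1 := norm_mul_le_of_le hd hA.norm_proj.le
    have f1 : ‖(a - b) • (R * V * ((P b - P a) * P a))‖ ≤
        |b - a| * ((1 / δ * v) * (L * |b - a| * 1)) := by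
      rw [norm_smul, Real.norm_eq_abs, abs_sub_comm]
      exact mul_le_mul le_rfl (norm_mul_le_of_le (norm_mul_le_of_le hRn h.norm_dir) f0)
        (norm_nonneg _) (by positivity)
    have f2 : ‖(e b - e a) • (R * ((P b - P a) * P a))‖ ≤
        (v * |b - a|) * (1 / δ * (L * |b - a| * 1)) := by
      rw [norm_smul]
      exact mul_le_mul (h.lipschitz a ha b hb) (norm_mul_le_of_le hRn f0)
        (norm_nonneg _) (by positivity)
    refine (norm_add_le_of_le f1 f2).trans (le_of_eq (by ring))
  have d2 : ‖P a * (P b * (1 - P a)) + (b - a) • (P a * V * R)‖ ≤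
      2 * (1 / δ * v * L) * |b - a| ^ 2 := by
    have e1 : P a * (P b * (1 - P a)) + (b - a) • (P a * V * R) =
        (a - b) • (P a * (P b - P a) * (V * R)) +
        (e b - e a) • (P a * (P b - P a) * R) := by
      have z : P a * R = 0 := by
        rw [hR, reducedResolvent, hA.inv_compl_comm, ← mul_assoc, hA.proj_mul_compl, zero_mul]
      rw [h.proj_mul_compl_eq ha hb, ← hR, mul_sub, hA.proj, sub_mul, sub_mul, z, sub_zero]
      simp only [mul_add, add_mul, mul_sub, sub_mul, mul_smul_comm, smul_mul_assoc, mul_one,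
        smul_sub, mul_assoc, sub_smul]
      abel
    rw [e1]
    have f0 : ‖P a * (P b - P a)‖ ≤ 1 * (L * |b - a|) := norm_mul_le_of_le hA.norm_proj.le hd
    have f1 : ‖(a - b) • (P a * (P b - P a) * (V * R))‖ ≤
        |b - a| * ((1 * (L * |b - a|)) * (v * (1 / δ))) := by
      rw [norm_smul, Real.norm_eq_abs, abs_sub_comm]
      exact mul_le_mul le_rfl (norm_mul_le_of_le f0 (norm_mul_le_of_le h.norm_dir hRn))
        (norm_nonneg _) (by positivity)
    have f2 : ‖(e b - e a) • (P a * (P b - P a) * R)‖ ≤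
        (v * |b - a|) * ((1 * (L * |b - a|)) * (1 / δ)) := by
      rw [norm_smul]
      exact mul_le_mul (h.lipschitz a ha b hb) (norm_mul_le_of_le f0 hRn)
        (norm_nonneg _) (by positivity)
    refine (norm_add_le_of_le f1 f2).trans (le_of_eq (by ring))
  have c1 := h.norm_compl_mul_proj ha hb
  have c3 := h.norm_proj_mul_compl ha hb
  have c2 : ‖P a * (1 - P b)‖ ≤ 2 * v / δ * |b - a| := by
    rw [abs_sub_comm]; exact h.norm_proj_mul_compl hb ha
  have c4 : ‖(1 - P b) * P a‖ ≤ 2 * v / δ * |b - a| := by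
    rw [abs_sub_comm]; exact h.norm_compl_mul_proj hb ha
  rw [dec]
  refine (norm_add_le_of_le (norm_add_le_of_le (norm_sub_le_of_le (norm_mul_le_of_le c1 c3)
    (norm_mul_le_of_le c2 c4)) d1) d2).trans (le_of_eq ?_)
  rw [← sq_abs (b - a)]; ring

theorem exists_hasDerivWithinAt_inv [CompleteSpace 𝒜] [NormOneClass 𝒜]
    (h : SpectralFamily H₀ V P S e w δ v)
    {a : ℝ} (ha : a ∈ Icc (0 : ℝ) 1) :
    ∃ S', HasDerivWithinAt S S' (Icc 0 1) a ∧ ‖S'‖ ≤ 4 * v / δ ^ 2 := by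
  have hA := h.data a ha
  have hδ := h.pos
  have hv := h.dir_nonneg
  have hinv : ∀ s ∈ Icc (0 : ℝ) 1, Ring.inverse (H₀ + s • V - e s • 1 + δ • P s) = S s := by
    intro s hs
    exact Ring.inverse_unit (⟨_, _, (h.data s hs).inv_right, (h.data s hs).inv_left⟩ : 𝒜ˣ)
  let u : 𝒜ˣ := ⟨_, _, hA.inv_right, hA.inv_left⟩
  have h1 : HasDerivWithinAt (fun s => H₀ + s • V - e s • (1 : 𝒜) + δ • P s)
      ((1 : ℝ) • V - w a • (1 : 𝒜) + δ • projDeriv V (P a) (S a)) (Icc 0 1) a :=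
    ((((hasDerivAt_id a).smul_const V).hasDerivWithinAt.const_add H₀).sub
      ((h.hasDerivWithinAt_eigenvalue ha).smul_const (1 : 𝒜))).add
      ((h.hasDerivWithinAt_proj ha).const_smul δ)
  have h2 := (hasFDerivAt_ringInverse (𝕜 := ℝ) u).comp_hasDerivWithinAt_of_eq a h1 rfl
  refine ⟨_, h2.congr_of_mem (fun s hs => (hinv s hs).symm) ha, ?_⟩
  have n1 : ‖(1 : ℝ) • V - w a • (1 : 𝒜) + δ • projDeriv V (P a) (S a)‖ ≤
      v + v * 1 + δ * (2 * v / δ) := by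
    refine norm_add_le_of_le (norm_sub_le_of_le (by rw [one_smul]; exact h.norm_dir) ?_) ?_
    · rw [norm_smul, Real.norm_eq_abs]
      exact mul_le_mul (h.slope_le a ha) norm_one.le (norm_nonneg _) hv
    · rw [norm_smul, Real.norm_eq_abs, abs_of_pos hδ]
      exact mul_le_mul_of_nonneg_left (hA.norm_projDeriv h.norm_dir) hδ.le
  have n2 : ‖S a * ((1 : ℝ) • V - w a • (1 : 𝒜) + δ • projDeriv V (P a) (S a)) * S a‖ ≤
      1 / δ * (v + v * 1 + δ * (2 * v / δ)) * (1 / δ) :=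
    norm_mul_le_of_le (norm_mul_le_of_le hA.norm_inv n1) hA.norm_inv
  have n3 : 1 / δ * (v + v * 1 + δ * (2 * v / δ)) * (1 / δ) = 4 * v / δ ^ 2 := by
    field_simp; ring
  rw [← n3]
  simpa [u] using n2

/-- The solution `X` of the commutator equation moves at a speed of order `v ^ 2 / δ ^ 3`. -/
theorem exists_hasDerivWithinAt_transport [CompleteSpace 𝒜] [NormOneClass 𝒜]
    (h : SpectralFamily H₀ V P S e w δ v) {a : ℝ} (ha : a ∈ Icc (0 : ℝ) 1) :
    ∃ X', HasDerivWithinAt (fun s => transport V (P s) (S s)) X' (Icc 0 1) a ∧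
      ‖X'‖ ≤ 28 * v ^ 2 / δ ^ 3 := by
  have hA := h.data a ha
  have hδ := h.pos
  have hv := h.dir_nonneg
  obtain ⟨S', hS, hS'⟩ := h.exists_hasDerivWithinAt_inv ha
  have hP := h.hasDerivWithinAt_proj ha
  have nP := hA.norm_proj.le
  have nQ := hA.norm_compl
  have nS := hA.norm_inv
  have nR := hA.norm_resolvent
  have nV := h.norm_dir
  have nD := hA.norm_projDeriv nV
  generalize projDeriv V (P a) (S a) = D at *
  have hR : HasDerivWithinAt (fun s => reducedResolvent (P s) (S s))
      (S' * (1 - P a) + S a * (-D)) (Icc 0 1) a := hS.mul (hP.const_sub 1)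
  have nR' : ‖S' * (1 - P a) + S a * (-D)‖ ≤ 6 * v / δ ^ 2 := by
    refine (norm_add_le_of_le (norm_mul_le_of_le hS' nQ)
      (norm_mul_le_of_le nS (by rwa [norm_neg] : ‖-D‖ ≤ 2 * v / δ))).trans (le_of_eq ?_)
    field_simp; ring
  generalize S' * (1 - P a) + S a * (-D) = R' at *
  refine ⟨_, ((hP.mul_const V).mul (hR.mul hR)).sub (((hR.mul hR).mul_const V).mul hP), ?_⟩
  set R := reducedResolvent (P a) (S a)
  have nRR := norm_mul_le_of_le nR nR
  have nRR' := norm_add_le_of_le (norm_mul_le_of_le nR' nR) (norm_mul_le_of_le nR nR')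
  refine (norm_sub_le_of_le (norm_add_le_of_le
    (norm_mul_le_of_le (norm_mul_le_of_le nD nV) nRR)
    (norm_mul_le_of_le (norm_mul_le_of_le nP nV) nRR'))
    (norm_add_le_of_le (norm_mul_le_of_le (norm_mul_le_of_le nRR' nV) nP)
    (norm_mul_le_of_le (norm_mul_le_of_le nRR nV) nD))).trans (le_of_eq ?_)
  field_simp
  ring

end SpectralFamily

end Calculus

/-! ### Gapped ground states -/

section Adiabatic

open Set InnerProductSpace

variable {E : Type*} [NormedAddCommGroup E] [InnerProductSpace ℂ E]

/-- `φ` is a unit eigenvector of `H` of energy `e`, and on its orthogonal complement the energy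
is at least `e + δ`. -/
structure IsGappedGround (H : E →L[ℂ] E) (δ : ℝ) (φ : E) (e : ℝ) : Prop where
  norm_eq : ‖φ‖ = 1
  eigen : H φ = (e : ℂ) • φ
  gap : ∀ v, inner ℂ φ v = 0 → (e + δ) * ‖v‖ ^ 2 ≤ (inner ℂ v (H v)).re

theorem inner_self_of_norm_one {φ : E} (h : ‖φ‖ = 1) : inner ℂ φ φ = 1 := by
  rw [inner_self_eq_norm_sq_to_K, h]; simp

theorem inner_sub_inner_smul {φ : E} (h : ‖φ‖ = 1) (v : E) :
    inner ℂ φ (v - inner ℂ φ v • φ) = 0 := by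
  rw [inner_sub_right, inner_smul_right, inner_self_of_norm_one h, mul_one, sub_self]

theorem norm_sq_eq_inner_add {φ : E} (h : ‖φ‖ = 1) (v : E) :
    ‖v‖ ^ 2 = ‖inner ℂ φ v‖ ^ 2 + ‖v - inner ℂ φ v • φ‖ ^ 2 := by
  have h1 : inner ℂ (inner ℂ φ v • φ) (v - inner ℂ φ v • φ) = 0 := by
    rw [inner_smul_left, inner_sub_inner_smul h, mul_zero]
  have h2 := norm_add_sq_eq_norm_sq_add_norm_sq_of_inner_eq_zero _ _ h1
  rw [add_sub_cancel, norm_smul, h, mul_one] at h2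
  simpa [pow_two] using h2

namespace IsGappedGround

variable {H : E →L[ℂ] E} {δ e : ℝ} {φ : E}

theorem energy_eq (h : IsGappedGround H δ φ e) (hH : (H : E →ₗ[ℂ] E).IsSymmetric) (v : E) :
    (inner ℂ v (H v)).re = e * ‖inner ℂ φ v‖ ^ 2 +
      (inner ℂ (v - inner ℂ φ v • φ) (H (v - inner ℂ φ v • φ))).re := by
  set c := inner ℂ φ v
  set w := v - c • φ with hw
  have hv : v = c • φ + w := by rw [hw]; abel
  have h0 : inner ℂ φ w = 0 := inner_sub_inner_smul h.norm_eq v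
  have h0' : inner ℂ w φ = 0 := by rw [← inner_conj_symm, h0, map_zero]
  have h1 : inner ℂ φ (H w) = 0 := by
    have := hH φ w
    simp only [ContinuousLinearMap.coe_coe] at this
    rw [← this, h.eigen, inner_smul_left, h0, mul_zero]
  have h2 : inner ℂ w (H φ) = 0 := by rw [h.eigen, inner_smul_right, h0', mul_zero]
  have h3 : inner ℂ φ (H φ) = (e : ℂ) := by
    rw [h.eigen, inner_smul_right, inner_self_of_norm_one h.norm_eq, mul_one]
  have h4 : (starRingEnd ℂ) c * (c * (e : ℂ)) = ((e * ‖c‖ ^ 2 : ℝ) : ℂ) := by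
    rw [← mul_assoc, Complex.conj_mul']; push_cast; ring
  have h5 : inner ℂ v (H v) = ((e * ‖c‖ ^ 2 : ℝ) : ℂ) + inner ℂ w (H w) := by
    conv_lhs => rw [hv]
    rw [map_add, map_smul, inner_add_left, inner_add_right, inner_add_right, inner_smul_left,
      inner_smul_right, inner_smul_left, inner_smul_right, h1, h2, h3, h4]
    ring
  rw [h5, Complex.add_re, Complex.ofReal_re]

theorem le_energy (h : IsGappedGround H δ φ e) (hH : (H : E →ₗ[ℂ] E).IsSymmetric) (hδ : 0 ≤ δ)
    (v : E) : e * ‖v‖ ^ 2 ≤ (inner ℂ v (H v)).re := by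
  rw [h.energy_eq hH, norm_sq_eq_inner_add h.norm_eq v]
  have := h.gap _ (inner_sub_inner_smul h.norm_eq v)
  nlinarith [sq_nonneg ‖v - inner ℂ φ v • φ‖]

/-- The spectral data of a gapped ground state. -/
theorem exists_spectralData [CompleteSpace E] (h : IsGappedGround H δ φ e)
    (hH : (H : E →ₗ[ℂ] E).IsSymmetric) (hδ : 0 < δ) (V : E →L[ℂ] E)
    (hV : (V : E →ₗ[ℂ] E).IsSymmetric) :
    ∃ S, SpectralData H V (rankOne ℂ φ φ) S e (inner ℂ φ (V φ)).re δ := by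
  set P : E →L[ℂ] E := rankOne ℂ φ φ with hP
  set A : E →L[ℂ] E := H - e • 1 + δ • P with hA
  have hAv : ∀ v, δ * ‖v‖ ^ 2 ≤ (inner ℂ v (A v)).re := by
    intro v
    have h1 : (inner ℂ v (A v)).re =
        (inner ℂ v (H v)).re - e * ‖v‖ ^ 2 + δ * ‖inner ℂ φ v‖ ^ 2 := by
      have e1 : A v = H v - (e : ℂ) • v + (δ : ℂ) • (inner ℂ φ v • φ) := by
        simp [hA, hP]
      have e2 : inner ℂ φ v * inner ℂ v φ = ((‖inner ℂ φ v‖ ^ 2 : ℝ) : ℂ) := by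
        rw [← inner_conj_symm v φ, Complex.mul_conj']; push_cast; rfl
      rw [e1, inner_add_right, inner_sub_right, inner_smul_right, inner_smul_right,
        inner_smul_right, e2, inner_self_eq_norm_sq_to_K, ← Complex.ofReal_mul]
      simp [← Complex.ofReal_pow, ← Complex.ofReal_mul]
    rw [h1, h.energy_eq hH, norm_sq_eq_inner_add h.norm_eq v]
    have := h.gap _ (inner_sub_inner_smul h.norm_eq v)
    nlinarith
  have hAn : ∀ v, δ * ‖v‖ ≤ ‖A v‖ := by
    intro v
    rcases eq_or_ne v 0 with rfl | hv
    · simp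
    · have h1 := (hAv v).trans ((Complex.re_le_norm _).trans (norm_inner_le_norm v (A v)))
      have hv' : 0 < ‖v‖ := norm_pos_iff.2 hv
      nlinarith
  have hu : IsUnit A := by
    refine ContinuousLinearMap.isUnit_of_forall_le_norm_inner_map A (c := ⟨δ, hδ.le⟩) hδ fun v => ?_
    rw [norm_inner_symm]
    calc ‖v‖ ^ 2 * δ = δ * ‖v‖ ^ 2 := mul_comm _ _
      _ ≤ _ := (hAv v).trans (Complex.re_le_norm _)
  obtain ⟨u, hu⟩ := hu
  have hmp : H * P = e • P := by
    rw [hP, ContinuousLinearMap.mul_def, comp_rankOne, h.eigen]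
    ext v
    simp only [rankOne_apply, _root_.smul_apply]
    rw [smul_comm, Complex.coe_smul]
  refine ⟨↑u⁻¹, ⟨?_, ?_, ?_, hmp, ?_, ?_, ?_, ?_, ?_⟩⟩
  · exact isIdempotentElem_rankOne_self h.norm_eq
  · rw [hP, norm_rankOne, h.norm_eq, mul_one]
  · refine ContinuousLinearMap.opNorm_le_bound _ zero_le_one fun v => ?_
    have h1 := norm_sq_eq_inner_add h.norm_eq v
    have : (1 - P) v = v - inner ℂ φ v • φ := by simp [hP]
    rw [this, one_mul]
    exact le_of_sq_le_sq (by nlinarith [sq_nonneg ‖inner ℂ φ v‖]) (norm_nonneg _)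
  · ext v
    have := hH φ v
    simp only [ContinuousLinearMap.coe_coe] at this
    simp only [hP, mul_apply_eq_comp, rankOne_apply, _root_.smul_apply]
    rw [← this, h.eigen, inner_smul_left, Complex.conj_ofReal, mul_smul]
    simp
  · rw [← hA, ← hu]; exact u.inv_mul
  · rw [← hA, ← hu]; exact u.mul_inv
  · refine ContinuousLinearMap.opNorm_le_bound _ (by positivity) fun v => ?_
    have h1 := hAn ((↑u⁻¹ : E →L[ℂ] E) v)
    have h2 : A ((↑u⁻¹ : E →L[ℂ] E) v) = v := by
      rw [← hu, ← mul_apply_eq_comp, u.mul_inv]; rfl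
    rw [h2] at h1
    rw [one_div, inv_mul_eq_div, le_div_iff₀ hδ, mul_comm]
    exact h1
  · ext v
    have hre : inner ℂ φ (V φ) = (((inner ℂ φ (V φ)).re : ℝ) : ℂ) := by
      have := hV.im_inner_self_apply φ
      simp only [ContinuousLinearMap.coe_coe] at this
      apply Complex.ext
      · simp
      · rw [← inner_conj_symm]
        simpa using this
    simp only [hP, mul_apply_eq_comp, rankOne_apply, map_smul, _root_.smul_apply]
    rw [hre, smul_comm, Complex.coe_smul, Complex.ofReal_re]

end IsGappedGround

theorem inner_projector {φ : E} (v : E) :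
    (inner ℂ v (rankOne ℂ φ φ v)) = ((‖inner ℂ φ v‖ ^ 2 : ℝ) : ℂ) := by
  rw [rankOne_apply, inner_smul_right, ← inner_conj_symm v φ, Complex.mul_conj']; push_cast; rfl

theorem isSymmetric_segment {H₀ V : E →L[ℂ] E} (hH : (H₀ : E →ₗ[ℂ] E).IsSymmetric)
    (hV : (V : E →ₗ[ℂ] E).IsSymmetric)
    (s : ℝ) : ((H₀ + s • V : E →L[ℂ] E) : E →ₗ[ℂ] E).IsSymmetric := by
  intro x y
  have h1 := hH x y
  have h2 := hV x y
  simp only [ContinuousLinearMap.coe_coe] at h1 h2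
  have e1 : ∀ z, (H₀ + s • V) z = H₀ z + (s : ℂ) • V z := fun z => by simp
  simp only [ContinuousLinearMap.coe_coe, e1, inner_add_left, inner_add_right, inner_smul_left,
    inner_smul_right, h1, h2, Complex.conj_ofReal]

/-- The ground states along a segment of gapped Hamiltonians have a spectral family. -/
theorem exists_spectralFamily [CompleteSpace E] {H₀ V : E →L[ℂ] E}
    (hH : (H₀ : E →ₗ[ℂ] E).IsSymmetric) (hV : (V : E →ₗ[ℂ] E).IsSymmetric)
    {δ v : ℝ} (hδ : 0 < δ) (hv : ‖V‖ ≤ v) {φ : ℝ → E} {e : ℝ → ℝ}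
    (hφ : ∀ s ∈ Icc (0 : ℝ) 1, IsGappedGround (H₀ + s • V) δ (φ s) (e s)) :
    ∃ (S : ℝ → E →L[ℂ] E) (w : ℝ → ℝ),
      SpectralFamily H₀ V (fun s => rankOne ℂ (φ s) (φ s)) S e w δ v := by
  have hs := isSymmetric_segment hH hV
  have ex : ∀ s, ∃ S, s ∈ Icc (0 : ℝ) 1 →
      SpectralData (H₀ + s • V) V (rankOne ℂ (φ s) (φ s)) S (e s)
        (inner ℂ (φ s) (V (φ s))).re δ := by
    intro s
    by_cases h : s ∈ Icc (0 : ℝ) 1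
    · obtain ⟨S, hS⟩ := (hφ s h).exists_spectralData (hs s) hδ V hV
      exact ⟨S, fun _ => hS⟩
    · exact ⟨0, fun h' => absurd h' h⟩
  choose S hS using ex
  have hVb : ∀ s ∈ Icc (0 : ℝ) 1, |(inner ℂ (φ s) (V (φ s))).re| ≤ v := by
    intro s hs'
    refine (Complex.abs_re_le_norm _).trans ((norm_inner_le_norm _ _).trans ?_)
    have := V.le_of_opNorm_le hv (φ s)
    rw [(hφ s hs').norm_eq] at *
    linarith
  -- the variational principle, applied with the ground state at the other end
  have hle : ∀ a ∈ Icc (0 : ℝ) 1, ∀ b ∈ Icc (0 : ℝ) 1, e a - e b ≤ v * |b - a| := by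
    intro a ha b hb
    have h1 := (hφ a ha).le_energy (hs a) hδ.le (φ b)
    have h2 : (H₀ + a • V) (φ b) = (e b : ℂ) • φ b + ((a - b : ℝ) : ℂ) • V (φ b) := by
      rw [← (hφ b hb).eigen]
      simp only [_root_.add_apply, _root_.smul_apply, sub_smul,
        Complex.coe_smul]
      abel
    rw [h2, inner_add_right, inner_smul_right, inner_smul_right,
      inner_self_of_norm_one (hφ b hb).norm_eq, (hφ b hb).norm_eq, Complex.add_re,
      Complex.re_ofReal_mul, Complex.re_ofReal_mul] at h1
    simp only [one_pow, mul_one, Complex.one_re] at h1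
    have h3 : (a - b) * (inner ℂ (φ b) (V (φ b))).re ≤ |b - a| * v := by
      refine (le_abs_self _).trans ?_
      rw [abs_mul, abs_sub_comm]
      exact mul_le_mul_of_nonneg_left (hVb b hb) (abs_nonneg _)
    linarith
  refine ⟨S, fun s => (inner ℂ (φ s) (V (φ s))).re, fun s h => hS s h, hδ, hv, hVb,
    fun a ha b hb => abs_le.2 ⟨?_, ?_⟩⟩
  · linarith [hle a ha b hb]
  · have := hle b hb a ha
    rw [abs_sub_comm] at this
    linarith

/-! ### The adiabatic theorem -/

theorem hasDerivWithinAt_expectation {χ : ℝ → E} {χ' : E} {B : ℝ → E →L[ℂ] E} {B' : E →L[ℂ] E}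
    {s : Set ℝ} {a : ℝ} (hχ : HasDerivWithinAt χ χ' s a) (hB : HasDerivWithinAt B B' s a) :
    HasDerivWithinAt (fun t => inner ℂ (χ t) (B t (χ t)))
      (inner ℂ (χ a) (B' (χ a)) + (inner ℂ (χ a) (B a χ') + inner ℂ χ' (B a (χ a)))) s a := by
  let r := ContinuousLinearMap.restrictScalarsL ℂ E E ℝ ℝ
  have h1 : HasDerivWithinAt (fun t => r (B t)) (r B') s a :=
    r.hasFDerivAt.comp_hasDerivWithinAt a hB
  have h2 := h1.clm_apply hχ
  have h3 := hχ.inner (𝕜 := ℂ) h2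
  have h4 : inner ℂ (χ a) ((r B') (χ a) + (r (B a)) χ') + inner ℂ χ' ((r (B a)) (χ a)) =
      inner ℂ (χ a) (B' (χ a)) + (inner ℂ (χ a) (B a χ') + inner ℂ χ' (B a (χ a))) := by
    rw [inner_add_right]
    simp only [r, ContinuousLinearMap.coe_restrict_scalarsL',
      ContinuousLinearMap.coe_restrictScalars']
    ring
  rw [h4] at h3
  exact h3

variable {H₀ V : E →L[ℂ] E}

/-- Along a solution of Schrödinger's equation in the rescaled time, an expectation changes by the
commutator with the Hamiltonian. -/
theorem expectation_schrodinger {H : E →L[ℂ] E} (hH : (H : E →ₗ[ℂ] E).IsSymmetric)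
    (B : E →L[ℂ] E) (T : ℝ) (x : E) :
    inner ℂ x (B (T • (-Complex.I • H x))) + inner ℂ (T • (-Complex.I • H x)) (B x) =
      Complex.I * T * inner ℂ x ((H * B - B * H) x) := by
  have h1 := hH x (B x)
  simp only [ContinuousLinearMap.coe_coe] at h1
  have e1 : T • (-Complex.I • H x) = (-(Complex.I * T)) • H x := by
    rw [← Complex.coe_smul, smul_smul]; congr 1; ring
  rw [e1, map_smul, inner_smul_right, inner_smul_left, h1, _root_.sub_apply,
    inner_sub_right, mul_apply_eq_comp, mul_apply_eq_comp]
  simp only [map_neg, map_mul, Complex.conj_I, Complex.conj_ofReal]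
  ring

theorem norm_schrodinger (hH : (H₀ : E →ₗ[ℂ] E).IsSymmetric)
    (hV : (V : E →ₗ[ℂ] E).IsSymmetric) {T : ℝ} {χ : ℝ → E}
    (hχ : ∀ s ∈ Icc (0 : ℝ) 1,
      HasDerivWithinAt χ (T • (-Complex.I • (H₀ + s • V) (χ s))) (Icc 0 1) s)
    {s : ℝ} (hs : s ∈ Icc (0 : ℝ) 1) : ‖χ s‖ = ‖χ 0‖ := by
  have h1 : ∀ a ∈ Icc (0 : ℝ) 1,
      HasDerivWithinAt (fun t => inner ℂ (χ t) ((1 : E →L[ℂ] E) (χ t))) 0 (Icc 0 1) a := by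
    intro a ha
    have := hasDerivWithinAt_expectation (hχ a ha)
      (hasDerivWithinAt_const a (Icc 0 1) (1 : E →L[ℂ] E))
    rw [expectation_schrodinger (isSymmetric_segment hH hV a)] at this
    simpa using this
  have h2 := (convex_Icc (0 : ℝ) 1).norm_image_sub_le_of_norm_hasDerivWithin_le (C := 0) h1
    (fun _ _ => by simp) (left_mem_Icc.2 zero_le_one) hs
  rw [zero_mul, norm_le_zero_iff, sub_eq_zero] at h2
  simp only [one_apply_eq_self, inner_self_eq_norm_sq_to_K] at h2
  have h3 : ‖χ s‖ ^ 2 = ‖χ 0‖ ^ 2 := by exact_mod_cast h2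
  exact (pow_left_inj₀ (norm_nonneg _) (norm_nonneg _) two_ne_zero).1 h3

/-- **Adiabatic theorem**, for a linear interpolation: the population of the ground state at the
end of the evolution, in the rescaled time. With `P` the projector on the ground state and `X` a
solution of `[H, X] = P'`, the derivative of `⟪χ, P χ⟫ + (i / T) ⟪χ, X χ⟫` is
`(i / T) ⟪χ, X' χ⟫`. -/
theorem ground_population_ge [CompleteSpace E] (hH : (H₀ : E →ₗ[ℂ] E).IsSymmetric)
    (hV : (V : E →ₗ[ℂ] E).IsSymmetric) {δ v : ℝ} (hδ : 0 < δ) (hv : ‖V‖ ≤ v) {φ : ℝ → E}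
    {e : ℝ → ℝ} (hφ : ∀ s ∈ Icc (0 : ℝ) 1, IsGappedGround (H₀ + s • V) δ (φ s) (e s))
    {T : ℝ} (hT : 0 < T) {χ : ℝ → E}
    (hχ : ∀ s ∈ Icc (0 : ℝ) 1,
      HasDerivWithinAt χ (T • (-Complex.I • (H₀ + s • V) (χ s))) (Icc 0 1) s)
    (h0 : χ 0 = φ 0) :
    1 - (4 * v / δ ^ 2 + 28 * v ^ 2 / δ ^ 3) / T ≤ ‖inner ℂ (φ 1) (χ 1)‖ ^ 2 := by
  obtain ⟨S, w, hS⟩ := exists_spectralFamily hH hV hδ hv hφ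
  have m0 : (0 : ℝ) ∈ Icc (0 : ℝ) 1 := left_mem_Icc.2 zero_le_one
  have m1 : (1 : ℝ) ∈ Icc (0 : ℝ) 1 := right_mem_Icc.2 zero_le_one
  have : Nontrivial E := ⟨φ 0, 0, by
    rw [← norm_pos_iff, (hφ 0 m0).norm_eq]; exact one_pos⟩
  have hn : ∀ s ∈ Icc (0 : ℝ) 1, ‖χ s‖ = 1 := fun s hs => by
    rw [norm_schrodinger hH hV hχ hs, h0, (hφ 0 m0).norm_eq]
  have hexp : ∀ s ∈ Icc (0 : ℝ) 1, ∀ (B : E →L[ℂ] E) (b : ℝ), ‖B‖ ≤ b →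
      ‖inner ℂ (χ s) (B (χ s))‖ ≤ b := by
    intro s hs B b hb
    refine (norm_inner_le_norm _ _).trans ?_
    have := B.le_of_opNorm_le hb (χ s)
    rw [hn s hs] at *
    linarith
  set P : ℝ → E →L[ℂ] E := fun s => rankOne ℂ (φ s) (φ s) with hP
  set X : ℝ → E →L[ℂ] E := fun s => transport V (P s) (S s) with hX
  set F : ℝ → ℂ := fun s =>
    inner ℂ (χ s) (P s (χ s)) + Complex.I / T * inner ℂ (χ s) (X s (χ s)) with hF
  have hTC : (T : ℂ) ≠ 0 := by exact_mod_cast hT.ne'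
  have hex : ∀ s, ∃ F', s ∈ Icc (0 : ℝ) 1 →
      HasDerivWithinAt F F' (Icc 0 1) s ∧ ‖F'‖ ≤ 28 * v ^ 2 / δ ^ 3 / T := by
    intro s
    by_cases hs : s ∈ Icc (0 : ℝ) 1
    swap
    · exact ⟨0, fun h => absurd h hs⟩
    obtain ⟨X', hX', hXb⟩ := hS.exists_hasDerivWithinAt_transport hs
    have d1 := hasDerivWithinAt_expectation (hχ s hs) (hS.hasDerivWithinAt_proj hs)
    have d2 := hasDerivWithinAt_expectation (hχ s hs) hX'
    rw [expectation_schrodinger (isSymmetric_segment hH hV s), (hS.data s hs).mul_proj,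
      (hS.data s hs).proj_mul, sub_self] at d1
    rw [expectation_schrodinger (isSymmetric_segment hH hV s),
      (hS.data s hs).commutator_transport] at d2
    refine ⟨Complex.I / T * inner ℂ (χ s) (X' (χ s)), fun _ => ⟨?_, ?_⟩⟩
    · have d3 := d1.add (d2.const_mul (Complex.I / T))
      have : Complex.I / T * inner ℂ (χ s) (X' (χ s)) =
          inner ℂ (χ s) ((projDeriv V (P s) (S s)) (χ s)) +
            Complex.I * T * inner ℂ (χ s) ((0 : E →L[ℂ] E) (χ s)) +
          Complex.I / T * (inner ℂ (χ s) (X' (χ s)) +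
            Complex.I * T * inner ℂ (χ s) ((projDeriv V (P s) (S s)) (χ s))) := by
        rw [_root_.zero_apply, inner_zero_right, mul_add]
        have : Complex.I / T * (Complex.I * T * inner ℂ (χ s) ((projDeriv V (P s) (S s)) (χ s))) =
            - inner ℂ (χ s) ((projDeriv V (P s) (S s)) (χ s)) := by
          field_simp
          rw [Complex.I_sq]; ring
        rw [this]; ring
      rw [this]
      exact d3
    · rw [norm_mul, norm_div, Complex.norm_I, Complex.norm_real, Real.norm_of_nonneg hT.le]
      have := hexp s hs X' _ hXb
      rw [one_div, inv_mul_eq_div]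
      gcongr
  choose F' hF' using hex
  have key := (convex_Icc (0 : ℝ) 1).norm_image_sub_le_of_norm_hasDerivWithin_le
    (fun s hs => (hF' s hs).1) (fun s hs => (hF' s hs).2) m0 m1
  rw [sub_zero, norm_one, mul_one] at key
  have x0 := hexp 0 m0 (X 0) _ ((hS.data 0 m0).norm_transport hv)
  have x1 := hexp 1 m1 (X 1) _ ((hS.data 1 m1).norm_transport hv)
  have p0 : inner ℂ (χ 0) (P 0 (χ 0)) = 1 := by
    rw [hP, inner_projector, h0, inner_self_of_norm_one (hφ 0 m0).norm_eq]; simp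
  have p1 : inner ℂ (χ 1) (P 1 (χ 1)) = ((‖inner ℂ (φ 1) (χ 1)‖ ^ 2 : ℝ) : ℂ) := by
    rw [hP, inner_projector]
  have e1 : (1 : ℂ) - ((‖inner ℂ (φ 1) (χ 1)‖ ^ 2 : ℝ) : ℂ) =
      -(F 1 - F 0) + (Complex.I / T * inner ℂ (χ 1) (X 1 (χ 1)) -
        Complex.I / T * inner ℂ (χ 0) (X 0 (χ 0))) := by
    simp only [hF]; rw [p0, p1]; ring
  have nI : ‖Complex.I / (T : ℂ)‖ = 1 / T := by
    rw [norm_div, Complex.norm_I, Complex.norm_real, Real.norm_of_nonneg hT.le]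
  have e2 : 1 - ‖inner ℂ (φ 1) (χ 1)‖ ^ 2 ≤
      28 * v ^ 2 / δ ^ 3 / T + (1 / T * (2 * v / δ ^ 2) + 1 / T * (2 * v / δ ^ 2)) := by
    calc 1 - ‖inner ℂ (φ 1) (χ 1)‖ ^ 2
        = ((1 : ℂ) - ((‖inner ℂ (φ 1) (χ 1)‖ ^ 2 : ℝ) : ℂ)).re := by
          rw [← Complex.ofReal_one, ← Complex.ofReal_sub, Complex.ofReal_re]
      _ ≤ ‖(1 : ℂ) - ((‖inner ℂ (φ 1) (χ 1)‖ ^ 2 : ℝ) : ℂ)‖ := Complex.re_le_norm _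
      _ ≤ _ := by
        rw [e1]
        refine norm_add_le_of_le (by rwa [norm_neg]) (norm_sub_le_of_le ?_ ?_)
        · rw [norm_mul, nI]; gcongr
        · rw [norm_mul, nI]; gcongr
  have e3 : 28 * v ^ 2 / δ ^ 3 / T + (1 / T * (2 * v / δ ^ 2) + 1 / T * (2 * v / δ ^ 2)) =
      (4 * v / δ ^ 2 + 28 * v ^ 2 / δ ^ 3) / T := by ring
  rw [e3] at e2
  linarith

/-- A unit vector with a large overlap with another one is close to a phase multiple of it. -/
theorem exists_phase_norm_sub_le {φ χ : E} (hφ : ‖φ‖ = 1) (hχ : ‖χ‖ = 1) :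
    ∃ z : ℂ, ‖z‖ = 1 ∧ ‖χ - z • φ‖ ^ 2 ≤ 2 * (1 - ‖inner ℂ φ χ‖ ^ 2) := by
  set c := inner ℂ φ χ with hc
  have hc1 : ‖c‖ ≤ 1 := by
    have := norm_inner_le_norm (𝕜 := ℂ) φ χ
    rwa [hφ, hχ, mul_one] at this
  obtain ⟨z, hz, hzc⟩ : ∃ z : ℂ, ‖z‖ = 1 ∧ (starRingEnd ℂ) c * z = (‖c‖ : ℂ) := by
    rcases eq_or_ne c 0 with h | h
    · exact ⟨1, by simp, by simp [h]⟩
    · have hn : (‖c‖ : ℂ) ≠ 0 := by simpa using h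
      refine ⟨c / ‖c‖, ?_, ?_⟩
      · rw [norm_div]; simp [h]
      · rw [mul_div_assoc', Complex.conj_mul', pow_two, mul_div_cancel_right₀ _ hn]
  refine ⟨z, hz, ?_⟩
  have h1 : inner ℂ χ (z • φ) = (‖c‖ : ℂ) := by
    rw [inner_smul_right, ← inner_conj_symm, ← hc, ← hzc, mul_comm]
  rw [norm_sub_sq (𝕜 := ℂ), h1, hχ, norm_smul, hz, hφ]
  have h2 : RCLike.re ((‖c‖ : ℂ)) = ‖c‖ := by simp
  rw [h2]
  nlinarith [norm_nonneg c]

end Adiabatic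

/-! ### The spectral gap of the clock Hamiltonian -/

section Gap

open Set InnerProductSpace

/-- A symmetric operator whose energy is at least `lam` on the kernel of a linear functional has at
most one eigenvalue below `lam`. If a trial state `u` lies below `lam` by `δ`, there is a ground
state with gap `δ`. -/
theorem exists_isGappedGround {E : Type*} [NormedAddCommGroup E] [InnerProductSpace ℂ E]
    [FiniteDimensional ℂ E] {H : E →L[ℂ] E} (hH : (H : E →ₗ[ℂ] E).IsSymmetric) (l : E →ₗ[ℂ] ℂ)
    {lam δ : ℝ} (hδ : 0 < δ) (hl : ∀ v, l v = 0 → lam * ‖v‖ ^ 2 ≤ (inner ℂ v (H v)).re)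
    {u : E} (hu : ‖u‖ = 1) (hu' : (inner ℂ u (H u)).re + δ ≤ lam) :
    ∃ φ e, IsGappedGround H δ φ e := by
  have hu0 : u ≠ 0 := by rw [← norm_pos_iff, hu]; exact one_pos
  have : Nontrivial E := ⟨u, 0, hu0⟩
  set e := ⨅ x : { x : E // x ≠ 0 }, RCLike.re (inner ℂ ((H : E →ₗ[ℂ] E) x) x) / ‖(x : E)‖ ^ 2
    with he
  have hev : Module.End.HasEigenvalue (H : E →ₗ[ℂ] E) (e : ℂ) :=
    hH.hasEigenvalue_iInf_of_finiteDimensional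
  have hbdd : BddBelow (Set.range fun x : { x : E // x ≠ 0 } =>
      RCLike.re (inner ℂ ((H : E →ₗ[ℂ] E) x) x) / ‖(x : E)‖ ^ 2) := by
    refine ⟨-‖H‖, ?_⟩
    rintro _ ⟨x, rfl⟩
    exact (abs_le.1 (H.rayleighQuotient_le_norm x)).1
  have heu : e ≤ (inner ℂ u (H u)).re := by
    have := ciInf_le hbdd ⟨u, hu0⟩
    rw [← he] at this
    simp only [hu, one_pow, div_one] at this
    have h2 := hH u u
    rw [h2] at this
    exact this
  obtain ⟨x, hx⟩ := hev.exists_hasEigenvector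
  have hx0 : (‖x‖ : ℂ) ≠ 0 := by simpa using hx.2
  set φ : E := (‖x‖ : ℂ)⁻¹ • x with hφ
  have hφn : ‖φ‖ = 1 := by
    rw [hφ, norm_smul, norm_inv, Complex.norm_real, norm_norm,
      inv_mul_cancel₀ (norm_ne_zero_iff.2 hx.2)]
  have hφe : H φ = (e : ℂ) • φ := by
    have : H x = (e : ℂ) • x := hx.apply_eq_smul
    rw [hφ, map_smul, this, smul_comm]
  clear_value φ
  have hφφ : (inner ℂ φ (H φ)).re = e := by
    rw [hφe, inner_smul_right, inner_self_of_norm_one hφn, mul_one, Complex.ofReal_re]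
  have hlφ : l φ ≠ 0 := by
    intro h0
    have := hl φ h0
    rw [hφφ, hφn] at this
    linarith
  refine ⟨φ, e, hφn, hφe, fun v hv => ?_⟩
  -- `v + b φ` lies in the kernel of the functional, and `v`, `φ` are orthogonal for both forms
  set b := -(l v / l φ) with hb
  have h1 : l (v + b • φ) = 0 := by
    rw [map_add, map_smul, smul_eq_mul, hb, neg_mul, div_mul_cancel₀ _ hlφ, add_neg_cancel]
  have h2 := hl _ h1
  clear_value b
  have hv' : inner ℂ v φ = 0 := by rw [← inner_conj_symm, hv, map_zero]
  have hvH : inner ℂ φ (H v) = 0 := by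
    have := hH φ v
    simp only [ContinuousLinearMap.coe_coe] at this
    rw [← this, hφe, inner_smul_left, hv, mul_zero]
  have e1 : (inner ℂ (v + b • φ) (H (v + b • φ))).re = (inner ℂ v (H v)).re + ‖b‖ ^ 2 * e := by
    have hb' : (starRingEnd ℂ) b * (b * (e : ℂ)) = ((‖b‖ ^ 2 * e : ℝ) : ℂ) := by
      rw [← mul_assoc, Complex.conj_mul']; push_cast; ring
    have h3 : inner ℂ φ (H φ) = (e : ℂ) := by
      rw [hφe, inner_smul_right, inner_self_of_norm_one hφn, mul_one]
    have h4 : inner ℂ v (H φ) = 0 := by rw [hφe, inner_smul_right, hv', mul_zero]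
    rw [map_add, map_smul, inner_add_left, inner_add_right, inner_add_right, inner_smul_left,
      inner_smul_right, inner_smul_left, inner_smul_right, h3, h4, hvH, hb', Complex.add_re,
      Complex.add_re, Complex.add_re, Complex.ofReal_re]
    simp
  have e2 : ‖v + b • φ‖ ^ 2 = ‖v‖ ^ 2 + ‖b‖ ^ 2 := by
    have := norm_add_sq_eq_norm_sq_add_norm_sq_of_inner_eq_zero v (b • φ)
      (by rw [inner_smul_right, hv', mul_zero])
    rw [norm_smul, hφn, mul_one] at this
    simpa [pow_two] using this
  rw [e1, e2] at h2
  have h5 : e + δ ≤ lam := by linarith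
  have h6 : 0 ≤ ‖b‖ ^ 2 * (lam - e) := by
    have : 0 ≤ lam - e := by linarith
    positivity
  nlinarith [sq_nonneg ‖v‖]

/-! ### A discrete Poincaré inequality -/

theorem sum_abs_sub_le {K a : ℕ} (h : a ≤ K) :
    2 * ∑ b ∈ Finset.range (K + 1), |(a : ℝ) - b| ≤ K * (K + 1) := by
  induction K, h using Nat.le_induction with
  | base =>
    have : ∀ n : ℕ, n ≤ a → 2 * ∑ b ∈ Finset.range (n + 1), |(a : ℝ) - b| =
        (n + 1) * (2 * a - n) := by
      intro n
      induction n with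
      | zero => intro _; simp
      | succ n ih =>
        intro hn
        rw [Finset.sum_range_succ, mul_add, ih (by omega)]
        have : ((n + 1 : ℕ) : ℝ) ≤ a := by exact_mod_cast hn
        rw [abs_of_nonneg (by linarith)]
        push_cast; ring
    rw [this a le_rfl]
    exact le_of_eq (by ring)
  | succ K hK ih =>
    rw [Finset.sum_range_succ, mul_add]
    have h1 : |(a : ℝ) - (K + 1 : ℕ)| ≤ K + 1 := by
      have : (a : ℝ) ≤ K := by exact_mod_cast hK
      have : (0 : ℝ) ≤ a := by positivity
      rw [abs_le]; push_cast; constructor <;> linarith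
    push_cast at *
    nlinarith

theorem norm_sq_sum_le {ι : Type*} (s : Finset ι) (f : ι → ℂ) :
    ‖∑ i ∈ s, f i‖ ^ 2 ≤ s.card * ∑ i ∈ s, ‖f i‖ ^ 2 :=
  (pow_le_pow_left₀ (norm_nonneg _) (norm_sum_le _ _) 2).trans sq_sum_le_card_mul_sum_sq

theorem norm_sub_sq_le_of_le (f : ℕ → ℂ) {K a b : ℕ} (hab : a ≤ b) (hb : b ≤ K) :
    ‖f b - f a‖ ^ 2 ≤ ((b : ℝ) - a) * ∑ i ∈ Finset.range K, ‖f i - f (i + 1)‖ ^ 2 := by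
  have h1 : f b - f a = ∑ i ∈ Finset.Ico a b, (f (i + 1) - f i) := (Finset.sum_Ico_sub f hab).symm
  rw [h1]
  refine (norm_sq_sum_le _ _).trans ?_
  rw [Nat.card_Ico, Nat.cast_sub hab]
  have : (0 : ℝ) ≤ (b : ℝ) - a := by
    have : (a : ℝ) ≤ b := by exact_mod_cast hab
    linarith
  refine mul_le_mul_of_nonneg_left ?_ this
  simp_rw [norm_sub_rev (f (_ + 1))]
  refine Finset.sum_le_sum_of_subset_of_nonneg (fun i hi => ?_) fun _ _ _ => sq_nonneg _
  rw [Finset.mem_Ico] at hi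
  exact Finset.mem_range.2 (by omega)

theorem norm_sub_sq_le (f : ℕ → ℂ) {K a b : ℕ} (ha : a ≤ K) (hb : b ≤ K) :
    ‖f a - f b‖ ^ 2 ≤ |(a : ℝ) - b| * ∑ i ∈ Finset.range K, ‖f i - f (i + 1)‖ ^ 2 := by
  rcases le_total a b with h | h
  · rw [norm_sub_rev, abs_sub_comm, abs_of_nonneg (sub_nonneg.2 (by exact_mod_cast h))]
    exact norm_sub_sq_le_of_le f h hb
  · rw [abs_of_nonneg (sub_nonneg.2 (by exact_mod_cast h))]
    exact norm_sub_sq_le_of_le f h ha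

/-- Pointwise Poincaré inequality on a path, for functions of mean zero. -/
theorem norm_sq_le_of_sum_eq_zero (f : ℕ → ℂ) {K a : ℕ} (ha : a ≤ K)
    (h0 : ∑ b ∈ Finset.range (K + 1), f b = 0) :
    ‖f a‖ ^ 2 ≤ K / 2 * ∑ i ∈ Finset.range K, ‖f i - f (i + 1)‖ ^ 2 := by
  set D := ∑ i ∈ Finset.range K, ‖f i - f (i + 1)‖ ^ 2 with hD
  have hD0 : 0 ≤ D := Finset.sum_nonneg fun _ _ => sq_nonneg _
  have h1 : ((K : ℂ) + 1) * f a = ∑ b ∈ Finset.range (K + 1), (f a - f b) := by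
    rw [Finset.sum_sub_distrib, h0]; simp
  have h2 : ((K : ℝ) + 1) ^ 2 * ‖f a‖ ^ 2 ≤
      (K + 1) * ∑ b ∈ Finset.range (K + 1), ‖f a - f b‖ ^ 2 := by
    have h3 := norm_sq_sum_le (Finset.range (K + 1)) fun b => f a - f b
    rw [← h1, norm_mul, mul_pow, Finset.card_range] at h3
    have h4 : ‖(K : ℂ) + 1‖ = (K : ℝ) + 1 := by
      have : (K : ℂ) + 1 = ((K + 1 : ℕ) : ℂ) := by push_cast; rfl
      rw [this, Complex.norm_natCast]; push_cast; rfl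
    rw [h4] at h3
    push_cast at h3
    exact h3
  have h5 : ∑ b ∈ Finset.range (K + 1), ‖f a - f b‖ ^ 2 ≤
      (∑ b ∈ Finset.range (K + 1), |(a : ℝ) - b|) * D := by
    rw [Finset.sum_mul]
    refine Finset.sum_le_sum fun b hb => norm_sub_sq_le f ha ?_
    have := Finset.mem_range.1 hb
    omega
  have h6 := sum_abs_sub_le ha
  have hK : (0 : ℝ) < (K : ℝ) + 1 := by positivity
  have h7 : ∑ b ∈ Finset.range (K + 1), ‖f a - f b‖ ^ 2 ≤ (K * (K + 1) / 2) * D :=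
    h5.trans (mul_le_mul_of_nonneg_right (by linarith) hD0)
  have h8 : ((K : ℝ) + 1) ^ 2 * ‖f a‖ ^ 2 ≤ ((K : ℝ) + 1) ^ 2 * (K / 2 * D) := by
    refine h2.trans ((mul_le_mul_of_nonneg_left h7 hK.le).trans (le_of_eq (by ring)))
  exact le_of_mul_le_mul_left h8 (by positivity)

/-! ### The Hamiltonian of the clock -/

/-- The states of a clock with times `0, …, K`; the history space is an isometric copy of it. -/
abbrev Clock (K : ℕ) : Type := EuclideanSpace ℂ (Fin (K + 1))

variable {K : ℕ}

/-- The clock at time `t`. -/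
noncomputable def tick (t : Fin (K + 1)) : Clock K := EuclideanSpace.single t 1

/-- The difference of two consecutive clock states. -/
noncomputable def edge (i : Fin K) : Clock K := tick i.castSucc - tick i.succ

/-- The initial Hamiltonian of the clock. -/
noncomputable def clockInit (K : ℕ) : Clock K →L[ℂ] Clock K := 1 - rankOne ℂ (tick 0) (tick 0)

/-- The propagation Hamiltonian of the clock: half the Laplacian of a path. -/
noncomputable def clockProp (K : ℕ) : Clock K →L[ℂ] Clock K :=
  (1 / 2 : ℂ) • ∑ i, rankOne ℂ (edge i) (edge i)

/-- The interpolation between the two clock Hamiltonians. -/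
noncomputable def clockH (K : ℕ) (s : ℝ) : Clock K →L[ℂ] Clock K :=
  clockInit K + s • (clockProp K - clockInit K)

theorem inner_tick (t : Fin (K + 1)) (v : Clock K) : inner ℂ (tick t) v = v t := by
  simp [tick, EuclideanSpace.inner_single_left]

theorem inner_edge (i : Fin K) (v : Clock K) :
    inner ℂ (edge i) v = v i.castSucc - v i.succ := by
  rw [edge, inner_sub_left, inner_tick, inner_tick]

theorem norm_tick (t : Fin (K + 1)) : ‖(tick t : Clock K)‖ = 1 := by simp [tick]

theorem clockInit_apply (v : Clock K) : clockInit K v = v - v 0 • tick 0 := by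
  simp [clockInit, inner_tick]

theorem clockProp_apply (v : Clock K) :
    clockProp K v = (1 / 2 : ℂ) • ∑ i : Fin K, (v i.castSucc - v i.succ) • edge i := by
  simp only [clockProp, _root_.smul_apply, _root_.sum_apply, rankOne_apply, inner_edge]

theorem isSymmetric_clockInit : (clockInit K : Clock K →ₗ[ℂ] Clock K).IsSymmetric := by
  intro x y
  simp only [ContinuousLinearMap.coe_coe, clockInit_apply, inner_sub_left, inner_sub_right,
    inner_smul_left, inner_smul_right, inner_tick]
  rw [← inner_conj_symm x (tick 0), inner_tick]
  ring

theorem isSymmetric_clockProp : (clockProp K : Clock K →ₗ[ℂ] Clock K).IsSymmetric := by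
  intro x y
  simp only [ContinuousLinearMap.coe_coe, clockProp_apply, inner_smul_left, inner_smul_right,
    sum_inner, inner_sum]
  congr 1
  · simp [Complex.conj_ofNat]
  · refine Finset.sum_congr rfl fun i _ => ?_
    rw [← inner_conj_symm x (edge i), inner_edge, inner_edge]
    ring

theorem isSymmetric_clockDir :
    ((clockProp K - clockInit K : Clock K →L[ℂ] Clock K) : Clock K →ₗ[ℂ] Clock K).IsSymmetric := by
  intro x y
  have h1 := isSymmetric_clockProp (K := K) x y
  have h2 := isSymmetric_clockInit (K := K) x y
  simp only [ContinuousLinearMap.coe_coe] at h1 h2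
  simp only [ContinuousLinearMap.coe_coe, _root_.sub_apply, inner_sub_left, inner_sub_right, h1, h2]

theorem isSymmetric_clockH (s : ℝ) : (clockH K s : Clock K →ₗ[ℂ] Clock K).IsSymmetric :=
  isSymmetric_segment isSymmetric_clockInit isSymmetric_clockDir s

theorem norm_clockDir_le : ‖clockProp K - clockInit K‖ ≤ (K : ℝ) + 1 := by
  have h1 : ‖clockInit K‖ ≤ 1 := by
    refine ContinuousLinearMap.opNorm_le_bound _ zero_le_one fun v => ?_
    have h1 := norm_sq_eq_inner_add (norm_tick 0) v
    rw [inner_tick] at h1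
    rw [clockInit_apply, one_mul]
    exact le_of_sq_le_sq (by nlinarith [sq_nonneg ‖v 0‖]) (norm_nonneg _)
  have h2 : ∀ i : Fin K, ‖(rankOne ℂ (edge i) (edge i) : Clock K →L[ℂ] Clock K)‖ ≤ 2 := by
    intro i
    have h3 : ‖(edge i : Clock K)‖ ^ 2 = 2 := by
      have h4 : inner ℂ (tick i.castSucc) (-tick i.succ : Clock K) = 0 := by
        rw [inner_neg_right, inner_tick, tick]
        simp [Fin.castSucc_lt_succ.ne]
      have h5 := norm_add_sq_eq_norm_sq_add_norm_sq_of_inner_eq_zero _ _ h4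
      rw [norm_neg, norm_tick, norm_tick, ← sub_eq_add_neg] at h5
      rw [edge, pow_two, h5]; norm_num
    rw [norm_rankOne, ← pow_two, h3]
  have h3 : ‖clockProp K‖ ≤ K := by
    rw [clockProp, norm_smul]
    have h4 : ‖∑ i : Fin K, (rankOne ℂ (edge i) (edge i) : Clock K →L[ℂ] Clock K)‖ ≤ K * 2 := by
      refine (norm_sum_le_of_le _ fun i _ => h2 i).trans (le_of_eq ?_)
      simp
    have h5 : ‖(1 / 2 : ℂ)‖ = 1 / 2 := by simp
    rw [h5]; linarith
  exact norm_sub_le_of_le h3 h1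

theorem energy_clockInit (v : Clock K) :
    (inner ℂ v (clockInit K v)).re = ‖v‖ ^ 2 - ‖v 0‖ ^ 2 := by
  rw [clockInit_apply, inner_sub_right, inner_smul_right, ← inner_conj_symm v (tick 0), inner_tick,
    Complex.mul_conj', inner_self_eq_norm_sq_to_K]
  simp [← Complex.ofReal_pow]

theorem energy_clockProp (v : Clock K) :
    (inner ℂ v (clockProp K v)).re = 1 / 2 * ∑ i : Fin K, ‖v i.castSucc - v i.succ‖ ^ 2 := by
  rw [clockProp_apply, inner_smul_right, inner_sum]
  have : ∀ i : Fin K, inner ℂ v ((v i.castSucc - v i.succ) • edge i) =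
      ((‖v i.castSucc - v i.succ‖ ^ 2 : ℝ) : ℂ) := by
    intro i
    rw [inner_smul_right, ← inner_conj_symm v (edge i), inner_edge, Complex.mul_conj']
    push_cast; rfl
  simp_rw [this]
  rw [← Complex.ofReal_sum]
  have h2 : (1 / 2 : ℂ) = ((1 / 2 : ℝ) : ℂ) := by push_cast; rfl
  rw [h2, Complex.re_ofReal_mul, Complex.ofReal_re]

theorem energy_clockH (s : ℝ) (v : Clock K) :
    (inner ℂ v (clockH K s v)).re = (1 - s) * (‖v‖ ^ 2 - ‖v 0‖ ^ 2) +
      s / 2 * ∑ i : Fin K, ‖v i.castSucc - v i.succ‖ ^ 2 := by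
  have h1 : clockH K s v = ((1 - s : ℝ) : ℂ) • clockInit K v + (s : ℂ) • clockProp K v := by
    simp only [clockH, _root_.add_apply, _root_.smul_apply, _root_.sub_apply, smul_sub,
      Complex.coe_smul, sub_smul, one_smul]
    abel
  rw [h1, inner_add_right, inner_smul_right, inner_smul_right, Complex.add_re,
    Complex.re_ofReal_mul, Complex.re_ofReal_mul, energy_clockInit, energy_clockProp]
  ring

theorem clock_poincare (v : Clock K) (h0 : ∑ t, v t = 0) (a : Fin (K + 1)) :
    ‖v a‖ ^ 2 ≤ K / 2 * ∑ i : Fin K, ‖v i.castSucc - v i.succ‖ ^ 2 := by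
  let f : ℕ → ℂ := fun t => if h : t < K + 1 then v ⟨t, h⟩ else 0
  have hf : ∀ t : Fin (K + 1), f t = v t := fun t => dif_pos t.2
  have h1 : ∑ b ∈ Finset.range (K + 1), f b = 0 := by
    rw [← Fin.sum_univ_eq_sum_range, ← h0]
    exact Finset.sum_congr rfl fun t _ => hf t
  have h2 := norm_sq_le_of_sum_eq_zero f (Nat.lt_succ_iff.1 a.2) h1
  rw [hf, ← Fin.sum_univ_eq_sum_range (fun i => ‖f i - f (i + 1)‖ ^ 2)] at h2
  refine h2.trans (le_of_eq ?_)
  congr 1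
  refine Finset.sum_congr rfl fun i _ => ?_
  rw [← hf i.castSucc, ← hf i.succ]; rfl

/-- The spectral gap of the clock, along the whole interpolation. Far from the end, states that
vanish at time `0` already have energy at least `1 - s`; near the end, the Poincaré inequality
controls the states of mean zero. In both cases the uniform state is a good trial state. -/
theorem clock_gapped (K : ℕ) {s : ℝ} (hs : s ∈ Icc (0 : ℝ) 1) :
    ∃ φ e, IsGappedGround (clockH K s) (1 / (2 * ((K : ℝ) + 1) ^ 2)) φ e := by
  have hK : (0 : ℝ) < (K : ℝ) + 1 := by positivity
  have hδ : (0 : ℝ) < 1 / (2 * ((K : ℝ) + 1) ^ 2) := by positivity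
  set δ := 1 / (2 * ((K : ℝ) + 1) ^ 2) with hδd
  obtain ⟨hs0, hs1⟩ := hs
  -- the uniform state
  set r : ℝ := 1 / Real.sqrt ((K : ℝ) + 1) with hr
  have hr2 : r ^ 2 = 1 / ((K : ℝ) + 1) := by rw [hr, div_pow, Real.sq_sqrt hK.le, one_pow]
  set u : Clock K := WithLp.toLp 2 fun _ => (r : ℂ) with hu
  have hut : ∀ t, u t = (r : ℂ) := fun _ => rfl
  have hrn : ‖(r : ℂ)‖ ^ 2 = 1 / ((K : ℝ) + 1) := by
    rw [Complex.norm_real, Real.norm_eq_abs, sq_abs, hr2]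
  have hun2 : ‖u‖ ^ 2 = 1 := by
    rw [EuclideanSpace.norm_sq_eq]
    simp only [hut, hrn, Finset.sum_const, Finset.card_univ, Fintype.card_fin, nsmul_eq_mul]
    push_cast; field_simp
  have hun : ‖u‖ = 1 := by
    rw [← Real.sqrt_sq (norm_nonneg u), hun2]; simp
  have hue : (inner ℂ u (clockH K s u)).re = (1 - s) * (1 - 1 / ((K : ℝ) + 1)) := by
    rw [energy_clockH, hun2]
    simp only [hut, hrn, sub_self, norm_zero]
    simp
  by_cases hx : 1 / (2 * ((K : ℝ) + 1)) ≤ 1 - s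
  · refine exists_isGappedGround (isSymmetric_clockH s) (EuclideanSpace.projₗ 0) (lam := 1 - s)
      hδ (fun v hv => ?_) hun ?_
    · have hv0 : v 0 = 0 := hv
      rw [energy_clockH, hv0]
      have : 0 ≤ ∑ i : Fin K, ‖v i.castSucc - v i.succ‖ ^ 2 :=
        Finset.sum_nonneg fun _ _ => sq_nonneg _
      have := mul_nonneg hs0 this
      simp only [norm_zero]
      nlinarith
    · rw [hue]
      have : δ = 1 / (2 * ((K : ℝ) + 1)) * (1 / ((K : ℝ) + 1)) := by rw [hδd]; field_simp
      have h2 : 1 / (2 * ((K : ℝ) + 1)) * (1 / ((K : ℝ) + 1)) ≤ (1 - s) * (1 / ((K : ℝ) + 1)) :=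
        mul_le_mul_of_nonneg_right hx (by positivity)
      rw [← this] at h2
      linarith
  · push Not at hx
    refine exists_isGappedGround (isSymmetric_clockH s)
      (∑ t, EuclideanSpace.projₗ t : Clock K →ₗ[ℂ] ℂ) (lam := 1 - s + δ)
      hδ (fun v hv => ?_) hun ?_
    · have hv0 : ∑ t, v t = 0 := by
        rw [← hv, LinearMap.sum_apply]; rfl
      have hp := clock_poincare v hv0
      rw [energy_clockH]
      set D := ∑ i : Fin K, ‖v i.castSucc - v i.succ‖ ^ 2
      have hD : 0 ≤ D := Finset.sum_nonneg fun _ _ => sq_nonneg _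
      have hvn : ‖v‖ ^ 2 ≤ (K + 1) * (K / 2 * D) := by
        rw [EuclideanSpace.norm_sq_eq]
        refine (Finset.sum_le_sum fun t _ => hp t).trans (le_of_eq ?_)
        simp
      -- the loss at time `0` costs at most half of the gradient energy
      have h1 : (1 - s) * ((K : ℝ) + 1) ≤ 1 / 2 := by
        rw [lt_div_iff₀ (by positivity)] at hx
        linarith
      have h2 : (1 - s) * ‖v 0‖ ^ 2 ≤ (1 - s) * (K / 2 * D) :=
        mul_le_mul_of_nonneg_left (hp 0) (by linarith)
      have h3 : δ * ‖v‖ ^ 2 ≤ 1 / 4 * D := by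
        have : δ * ‖v‖ ^ 2 ≤ δ * ((K + 1) * (K / 2 * D)) := mul_le_mul_of_nonneg_left hvn hδ.le
        refine this.trans ?_
        have e1 : δ * ((K + 1) * (K / 2 * D)) = 1 / 4 * D * (K / ((K : ℝ) + 1)) := by
          rw [hδd]; field_simp; ring
        rw [e1]
        have : (K : ℝ) / ((K : ℝ) + 1) ≤ 1 := by rw [div_le_one hK]; linarith
        exact mul_le_of_le_one_right (by positivity) this
      nlinarith [mul_le_mul_of_nonneg_right h1 hD]
    · rw [hue]
      have : 0 ≤ (1 - s) * (1 / ((K : ℝ) + 1)) := mul_nonneg (by linarith) (by positivity)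
      linarith

end Gap

/-! ### Linear differential equations -/

section LinearODE

open Set

variable {F : Type*} [NormedAddCommGroup F] [NormedSpace ℝ F]

theorem lipschitzWith_of_opNorm_le {A : F →L[ℝ] F} {C : NNReal} (h : ‖A‖ ≤ C) :
    LipschitzWith C A := A.lipschitz.weaken h

/-- A solution on `[0, a]` extends to `[0, b]` if `b - a` is small. -/
theorem extend_linear_ode [CompleteSpace F] {A : ℝ → F →L[ℝ] F} (hA : Continuous A) {C : NNReal}
    {a b : ℝ} (h0a : 0 ≤ a) (hab : a ≤ b) (hba : (b - a) * (2 * C) ≤ 1)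
    (hC : ∀ t ∈ Icc 0 b, ‖A t‖ ≤ C) {ψ : ℝ → F}
    (hψ : ∀ t ∈ Icc 0 a, HasDerivWithinAt ψ (A t (ψ t)) (Icc 0 a) t) :
    ∃ ψ' : ℝ → F, ψ' 0 = ψ 0 ∧
      ∀ t ∈ Icc 0 b, HasDerivWithinAt ψ' (A t (ψ' t)) (Icc 0 b) t := by
  have hC' : ∀ t ∈ Icc a b, ‖A t‖ ≤ C := fun t ht => hC t ⟨h0a.trans ht.1, ht.2⟩
  have hPL : IsPicardLindelof (fun t x => A t x) (⟨a, left_mem_Icc.2 hab⟩ : Icc a b) (ψ a)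
      ‖ψ a‖₊ 0 (C * (2 * ‖ψ a‖₊)) C := by
    refine ⟨fun t ht => (lipschitzWith_of_opNorm_le (hC' t ht)).lipschitzOnWith, fun x _ => ?_,
      fun t ht x hx => ?_, ?_⟩
    · exact (hA.clm_apply continuous_const).continuousOn
    · have h1 : ‖x‖ ≤ 2 * ‖ψ a‖ := by
        have := norm_le_of_mem_closedBall hx
        rw [coe_nnnorm] at this
        linarith
      push_cast
      exact ((A t).le_of_opNorm_le (hC' t ht) x).trans (mul_le_mul_of_nonneg_left h1 C.2)
    · push_cast
      rw [sub_self, max_eq_left (sub_nonneg.2 hab), sub_zero]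
      nlinarith [norm_nonneg (ψ a)]
  obtain ⟨α, hα0, hα⟩ := hPL.exists_eq_forall_mem_Icc_hasDerivWithinAt₀
  simp only at hα0
  have hu : Icc (0 : ℝ) b = Icc 0 a ∪ Icc a b := (Icc_union_Icc_eq_Icc h0a hab).symm
  let ψ' : ℝ → F := fun t => if t ≤ a then ψ t else α t
  have e1 : ∀ t ∈ Icc (0 : ℝ) a, ψ' t = ψ t := fun t ht => if_pos ht.2
  have e2 : ∀ t ∈ Icc a b, ψ' t = α t := by
    intro t ht
    rcases eq_or_lt_of_le ht.1 with h | h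
    · simp only [ψ', ← h, le_refl, if_true, hα0]
    · exact if_neg (not_le.2 h)
  refine ⟨ψ', e1 0 (left_mem_Icc.2 h0a), fun t ht => ?_⟩
  have g1 : HasDerivWithinAt ψ' (A t (ψ' t)) (Icc 0 a) t := by
    by_cases h : t ∈ Icc 0 a
    · rw [e1 t h]; exact (hψ t h).congr_of_mem e1 h
    · exact HasFDerivWithinAt.of_notMem_closure (by rwa [closure_Icc])
  have g2 : HasDerivWithinAt ψ' (A t (ψ' t)) (Icc a b) t := by
    by_cases h : t ∈ Icc a b
    · rw [e2 t h]; exact (hα t h).congr_of_mem e2 h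
    · exact HasFDerivWithinAt.of_notMem_closure (by rwa [closure_Icc])
  rw [hu]
  exact g1.union g2

theorem exists_linear_ode [CompleteSpace F] {A : ℝ → F →L[ℝ] F} (hA : Continuous A) {T : ℝ}
    (hT : 0 ≤ T) (x₀ : F) :
    ∃ ψ : ℝ → F, ψ 0 = x₀ ∧ ∀ t ∈ Icc 0 T, HasDerivWithinAt ψ (A t (ψ t)) (Icc 0 T) t := by
  obtain ⟨C₀, hC₀⟩ := isCompact_Icc.exists_bound_of_continuousOn (hA.continuousOn (s := Icc 0 T))
  obtain ⟨C, hC1, hC⟩ : ∃ C : NNReal, 1 ≤ C ∧ C₀ ≤ C :=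
    ⟨max 1 C₀.toNNReal, le_max_left _ _, by
      rw [NNReal.coe_max]; exact (Real.le_coe_toNNReal C₀).trans (le_max_right _ _)⟩
  have hCp : (0 : ℝ) < C := lt_of_lt_of_le one_pos (by exact_mod_cast hC1)
  set τ : ℝ := 1 / (2 * C) with hτ
  have hτ0 : 0 < τ := by positivity
  have step : ∀ k : ℕ, ∀ b, 0 ≤ b → b ≤ T → b ≤ k * τ →
      ∃ ψ : ℝ → F, ψ 0 = x₀ ∧ ∀ t ∈ Icc 0 b, HasDerivWithinAt ψ (A t (ψ t)) (Icc 0 b) t := by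
    intro k
    induction k with
    | zero =>
      intro b hb _ hb'
      have : b = 0 := le_antisymm (by simpa using hb') hb
      subst this
      refine ⟨fun _ => x₀, rfl, fun t _ => ?_⟩
      rw [Icc_self]
      by_cases h : t = 0
      · subst h; exact HasFDerivWithinAt.singleton
      · exact HasFDerivWithinAt.of_notMem_closure (by simpa using h)
    | succ k ih =>
      intro b hb hbT hb'
      push_cast at hb'
      have hm : max 0 (b - τ) ≤ b := max_le hb (by linarith)
      obtain ⟨ψ, hψ0, hψ⟩ := ih (max 0 (b - τ)) (le_max_left _ _) (hm.trans hbT)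
        (max_le (by positivity) (by linarith))
      have h3 : b - max 0 (b - τ) ≤ τ := by linarith [le_max_right 0 (b - τ)]
      have h4 : (b - max 0 (b - τ)) * (2 * C) ≤ 1 :=
        calc (b - max 0 (b - τ)) * (2 * C) ≤ τ * (2 * C) :=
              mul_le_mul_of_nonneg_right h3 (by positivity)
          _ = 1 := by rw [hτ]; field_simp
      obtain ⟨ψ', h0, h1⟩ := extend_linear_ode hA (C := C) (le_max_left _ _) hm h4
        (fun t ht => (hC₀ t ⟨ht.1, ht.2.trans hbT⟩).trans hC) hψ
      exact ⟨ψ', h0.trans hψ0, h1⟩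
  obtain ⟨k, hk⟩ := exists_nat_ge (T / τ)
  exact step k T hT le_rfl (by rwa [div_le_iff₀ hτ0] at hk)

theorem linear_ode_unique {A : ℝ → F →L[ℝ] F} (hA : Continuous A) {T : ℝ} {ψ ψ' : ℝ → F}
    (h : ∀ t ∈ Icc 0 T, HasDerivWithinAt ψ (A t (ψ t)) (Icc 0 T) t)
    (h' : ∀ t ∈ Icc 0 T, HasDerivWithinAt ψ' (A t (ψ' t)) (Icc 0 T) t) (h0 : ψ 0 = ψ' 0) :
    EqOn ψ ψ' (Icc 0 T) := by
  obtain ⟨C₀, hC₀⟩ := isCompact_Icc.exists_bound_of_continuousOn (hA.continuousOn (s := Icc 0 T))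
  have right : ∀ {χ : ℝ → F}, (∀ t ∈ Icc 0 T, HasDerivWithinAt χ (A t (χ t)) (Icc 0 T) t) →
      ∀ t ∈ Ico 0 T, HasDerivWithinAt χ (A t (χ t)) (Ici t) t := fun hχ t ht =>
    ((hχ t ⟨ht.1, ht.2.le⟩).mono (Icc_subset_Icc_left ht.1)).mono_of_mem_nhdsWithin
      (Icc_mem_nhdsGE ht.2)
  exact ODE_solution_unique_of_mem_Icc_right (v := fun t x => A t x) (s := fun _ => univ)
    (K := C₀.toNNReal)
    (fun t ht => (lipschitzWith_of_opNorm_le ((hC₀ t ⟨ht.1, ht.2.le⟩).trans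
      (Real.le_coe_toNNReal C₀))).lipschitzOnWith)
    (fun t ht => (h t ht).continuousWithinAt) (right h) (fun _ _ => mem_univ _)
    (fun t ht => (h' t ht).continuousWithinAt) (right h') (fun _ _ => mem_univ _) h0

end LinearODE

/-! ### The adiabatic evolution of the clock -/

section ClockEvolution

open Set InnerProductSpace

namespace IsGappedGround

variable {E : Type*} [NormedAddCommGroup E] [InnerProductSpace ℂ E] {H : E →L[ℂ] E} {δ e : ℝ}
  {φ : E}

theorem eq_smul_of_eigen (h : IsGappedGround H δ φ e) (hδ : 0 < δ) {v : E}
    (hv : H v = (e : ℂ) • v) : v = inner ℂ φ v • φ := by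
  set w := v - inner ℂ φ v • φ with hw
  have h1 : H w = (e : ℂ) • w := by
    rw [hw, map_sub, map_smul, hv, h.eigen, smul_sub, smul_comm]
  have h2 := h.gap w (inner_sub_inner_smul h.norm_eq v)
  rw [h1, inner_smul_right, inner_self_eq_norm_sq_to_K, Complex.re_ofReal_mul] at h2
  have h3 : ((((‖w‖ : ℝ) : ℂ)) ^ 2).re = ‖w‖ ^ 2 := by
    rw [← Complex.ofReal_pow, Complex.ofReal_re]
  have h4 : (e + δ) * ‖w‖ ^ 2 ≤ e * ‖w‖ ^ 2 := h2.trans (le_of_eq (by rw [← h3]; rfl))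
  have h5 : ‖w‖ ^ 2 = 0 := by nlinarith [sq_nonneg ‖w‖]
  have h6 : w = 0 := by simpa using h5
  exact sub_eq_zero.1 h6

theorem gap_of_eigen (h : IsGappedGround H δ φ e) (hH : (H : E →ₗ[ℂ] E).IsSymmetric) {v : E}
    {e' : ℝ} (hv0 : v ≠ 0) (hv : H v = (e' : ℂ) • v) (hne : e' ≠ e) : e + δ ≤ e' := by
  have h0 : inner ℂ φ v = 0 := by
    have h1 := hH φ v
    simp only [ContinuousLinearMap.coe_coe] at h1
    rw [h.eigen, hv, inner_smul_left, inner_smul_right, Complex.conj_ofReal] at h1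
    by_contra h2
    exact hne (Complex.ofReal_injective (mul_right_cancel₀ h2 h1)).symm
  have h2 := h.gap v h0
  rw [hv, inner_smul_right, inner_self_eq_norm_sq_to_K, Complex.re_ofReal_mul] at h2
  have h3 : ((((‖v‖ : ℝ) : ℂ)) ^ 2).re = ‖v‖ ^ 2 := by
    rw [← Complex.ofReal_pow, Complex.ofReal_re]
  have h4 : (e + δ) * ‖v‖ ^ 2 ≤ e' * ‖v‖ ^ 2 := h2.trans (le_of_eq (by rw [← h3]; rfl))
  exact le_of_mul_le_mul_right h4 (by have := norm_pos_iff.2 hv0; positivity)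

/-- A gapped ground state may be replaced by any unit eigenvector of minimal energy. -/
theorem of_minimal (h : IsGappedGround H δ φ e) (hH : (H : E →ₗ[ℂ] E).IsSymmetric) (hδ : 0 < δ)
    {v : E} {e' : ℝ} (hv1 : ‖v‖ = 1) (hv : H v = (e' : ℂ) • v)
    (hmin : ∀ x, e' * ‖x‖ ^ 2 ≤ (inner ℂ x (H x)).re) : IsGappedGround H δ v e' := by
  have h1 := hmin φ
  rw [h.eigen, inner_smul_right, inner_self_of_norm_one h.norm_eq, h.norm_eq, mul_one,
    Complex.ofReal_re] at h1
  have hee : e' = e := by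
    by_contra hne
    have hv0 : v ≠ 0 := by rw [← norm_pos_iff, hv1]; exact one_pos
    have := h.gap_of_eigen hH hv0 hv hne
    linarith
  subst hee
  have h2 := h.eq_smul_of_eigen hδ hv
  set c := inner ℂ φ v
  have hc : c ≠ 0 := by
    intro hc
    rw [hc, zero_smul] at h2
    rw [h2, norm_zero] at hv1
    exact zero_ne_one hv1
  refine ⟨hv1, hv, fun x hx => h.gap x ?_⟩
  rw [h2, inner_smul_left] at hx
  exact (mul_eq_zero.1 hx).resolve_left (by simpa using hc)

end IsGappedGround

variable {K : ℕ}

/-- The uniform superposition of all clock states. -/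
noncomputable def uniformClock (K : ℕ) : Clock K :=
  ((1 / Real.sqrt ((K : ℝ) + 1) : ℝ) : ℂ) • ∑ t, tick t

theorem uniformClock_apply (t : Fin (K + 1)) :
    uniformClock K t = ((1 / Real.sqrt ((K : ℝ) + 1) : ℝ) : ℂ) := by
  rw [← inner_tick, uniformClock, inner_smul_right, inner_sum]
  simp only [inner_tick]
  simp [tick]

theorem norm_uniformClock : ‖uniformClock K‖ = 1 := by
  have h : ‖uniformClock K‖ ^ 2 = 1 := by
    rw [EuclideanSpace.norm_sq_eq]
    simp only [uniformClock_apply, Complex.norm_real, Real.norm_eq_abs, sq_abs, div_pow, one_pow]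
    rw [Real.sq_sqrt (by positivity)]
    simp only [Finset.sum_const, Finset.card_univ, Fintype.card_fin, nsmul_eq_mul]
    push_cast; field_simp
  rw [← Real.sqrt_sq (norm_nonneg (uniformClock K)), h, Real.sqrt_one]

theorem clockH_zero : clockH K 0 = clockInit K := by
  ext v : 1
  simp only [clockH, _root_.add_apply, _root_.smul_apply, zero_smul, add_zero]

theorem clockH_one : clockH K 1 = clockProp K := by rw [clockH, one_smul, add_sub_cancel]

theorem isGappedGround_tick_zero :
    IsGappedGround (clockH K 0) (1 / (2 * ((K : ℝ) + 1) ^ 2)) (tick 0) 0 := by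
  obtain ⟨φ, e, h⟩ := clock_gapped K (s := 0) (by simp)
  refine h.of_minimal (isSymmetric_clockH 0) (by positivity) (norm_tick 0) ?_ fun x => ?_
  · rw [clockH_zero, clockInit_apply]; simp [tick]
  · rw [clockH_zero, energy_clockInit, zero_mul, sub_nonneg]
    have := norm_sq_eq_inner_add (norm_tick 0) x
    rw [inner_tick] at this
    nlinarith [sq_nonneg ‖x - x 0 • tick 0‖]

theorem isGappedGround_uniformClock :
    IsGappedGround (clockH K 1) (1 / (2 * ((K : ℝ) + 1) ^ 2)) (uniformClock K) 0 := by
  obtain ⟨φ, e, h⟩ := clock_gapped K (s := 1) (by simp)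
  refine h.of_minimal (isSymmetric_clockH 1) (by positivity) norm_uniformClock ?_ fun x => ?_
  · rw [clockH_one, clockProp_apply]; simp [uniformClock_apply]
  · rw [clockH_one, energy_clockProp, zero_mul]
    positivity

/-- In polynomial time the evolution of the clock leads from time `0` to the uniform state. -/
theorem clock_adiabatic {ε T : ℝ} (hε : 0 < ε) (hε1 : ε ≤ 1)
    (hT : 480 * (((K : ℝ) + 1) / ε) ^ 8 ≤ T) {χ : ℝ → Clock K} (h0 : χ 0 = tick 0)
    (hχ : ∀ t ∈ Icc 0 T,
      HasDerivWithinAt χ (-Complex.I • clockH K (t / T) (χ t)) (Icc 0 T) t) :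
    ∃ z : ℂ, ‖z‖ = 1 ∧ ‖χ T - z • uniformClock K‖ ≤ ε := by
  have hk : (1 : ℝ) ≤ (K : ℝ) + 1 := by linarith [(Nat.cast_nonneg K : (0 : ℝ) ≤ K)]
  set k : ℝ := (K : ℝ) + 1 with hkd
  have hk0 : 0 < k := by linarith
  have hT0 : 0 < T := lt_of_lt_of_le (by positivity) hT
  have hδ : 0 < 1 / (2 * k ^ 2) := by positivity
  have m0 : (0 : ℝ) ∈ Icc (0 : ℝ) 1 := left_mem_Icc.2 zero_le_one
  have m1 : (1 : ℝ) ∈ Icc (0 : ℝ) 1 := right_mem_Icc.2 zero_le_one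
  have ex : ∀ s, ∃ φ e, (s ∈ Icc (0 : ℝ) 1 → IsGappedGround (clockH K s) (1 / (2 * k ^ 2)) φ e) ∧
      (s = 0 → φ = tick 0) ∧ (s = 1 → φ = uniformClock K) := by
    intro s
    by_cases hs0 : s = 0
    · subst hs0
      exact ⟨tick 0, 0, fun _ => isGappedGround_tick_zero, fun _ => rfl, fun h => by simp at h⟩
    by_cases hs1 : s = 1
    · subst hs1
      exact ⟨uniformClock K, 0, fun _ => isGappedGround_uniformClock, fun h => by simp at h,
        fun _ => rfl⟩
    by_cases hs : s ∈ Icc (0 : ℝ) 1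
    · obtain ⟨φ, e, h⟩ := clock_gapped K hs
      exact ⟨φ, e, fun _ => h, fun h => absurd h hs0, fun h => absurd h hs1⟩
    · exact ⟨0, 0, fun h => absurd h hs, fun h => absurd h hs0, fun h => absurd h hs1⟩
  choose φ e hφ hφ0 hφ1 using ex
  have hχ' : ∀ s ∈ Icc (0 : ℝ) 1, HasDerivWithinAt (fun s => χ (T * s))
      (T • (-Complex.I • (clockInit K + s • (clockProp K - clockInit K)) (χ (T * s))))
      (Icc 0 1) s := by
    intro s hs
    have hm : MapsTo (fun s => T * s) (Icc 0 1) (Icc 0 T) := fun x hx =>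
      ⟨mul_nonneg hT0.le hx.1, mul_le_of_le_one_right hT0.le hx.2⟩
    have h1 := hχ (T * s) (hm hs)
    rw [mul_div_cancel_left₀ _ hT0.ne'] at h1
    have h2 : HasDerivWithinAt (fun s => T * s) T (Icc 0 1) s := by
      simpa using ((hasDerivAt_id s).const_mul T).hasDerivWithinAt
    exact h1.scomp s h2 hm
  have hpop := ground_population_ge isSymmetric_clockInit isSymmetric_clockDir hδ norm_clockDir_le
    (fun s hs => hφ s hs) hT0 hχ' (by simp only [mul_zero]; rw [h0, hφ0 0 rfl])
  simp only [mul_one] at hpop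
  rw [hφ1 1 rfl] at hpop
  have hn := norm_schrodinger isSymmetric_clockInit isSymmetric_clockDir hχ' m1
  simp only [mul_one, mul_zero] at hn
  rw [h0, norm_tick] at hn
  obtain ⟨z, hz, hzb⟩ := exists_phase_norm_sub_le (norm_uniformClock (K := K)) hn
  refine ⟨z, hz, ?_⟩
  have hk58 : k ^ 5 ≤ k ^ 8 := pow_le_pow_right₀ hk (by norm_num)
  have h1 : 4 * k / (1 / (2 * k ^ 2)) ^ 2 + 28 * k ^ 2 / (1 / (2 * k ^ 2)) ^ 3 ≤ 240 * k ^ 8 := by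
    have : 4 * k / (1 / (2 * k ^ 2)) ^ 2 + 28 * k ^ 2 / (1 / (2 * k ^ 2)) ^ 3 =
        16 * k ^ 5 + 224 * k ^ 8 := by field_simp; ring
    rw [this]; linarith
  have h2 : 240 * k ^ 8 / T ≤ ε ^ 2 / 2 := by
    rw [div_le_iff₀ hT0]
    have h3 : ε ^ 8 ≤ ε ^ 2 := pow_le_pow_of_le_one hε.le hε1 (by norm_num)
    have h4 : 480 * (k / ε) ^ 8 * ε ^ 8 = 480 * k ^ 8 := by field_simp
    have h5 : 480 * k ^ 8 ≤ T * ε ^ 2 := by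
      rw [← h4]
      exact mul_le_mul hT h3 (by positivity) hT0.le
    linarith
  have h3 := (div_le_div_of_nonneg_right h1 hT0.le).trans h2
  exact le_of_sq_le_sq (by linarith) hε.le

end ClockEvolution

/-! ### Partial isometries and their penalties -/

section Penalty

variable {N : ℕ}

/-- A partial isometry whose range is orthogonal to its support, such as the operator of a
transition rule. -/
structure IsHop {ι : Type*} [Fintype ι] (V : Matrix ι ι ℂ) : Prop where
  isometry : V * Vᴴ * V = V
  nilpotent : V * V = 0

theorem IsHop.zero {ι : Type*} [Fintype ι] : IsHop (0 : Matrix ι ι ℂ) := ⟨by simp, by simp⟩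

variable {V : Op N}

theorem IsHop.isometry' (h : IsHop V) : Vᴴ * V * Vᴴ = Vᴴ := by
  have := congrArg conjTranspose h.isometry
  rwa [conjTranspose_mul, conjTranspose_mul, conjTranspose_conjTranspose, ← mul_assoc] at this

theorem IsHop.nilpotent' (h : IsHop V) : Vᴴ * Vᴴ = 0 := by
  have := congrArg conjTranspose h.nilpotent
  rwa [conjTranspose_mul, conjTranspose_zero] at this

theorem penalty_eq (h : IsHop V) : penalty V = (1 / 2 : ℂ) • ((Vᴴ * V - V) * (Vᴴ * V - V)ᴴ) := by
  have h1 : (Vᴴ * V - V) * (Vᴴ * V - V)ᴴ = Vᴴ * V + V * Vᴴ - V - Vᴴ := by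
    rw [conjTranspose_sub, conjTranspose_mul, conjTranspose_conjTranspose]
    have e1 : Vᴴ * V * (Vᴴ * V) = Vᴴ * V := by rw [← mul_assoc, h.isometry']
    have e2 : V * (Vᴴ * V) = V := by rw [← mul_assoc, h.isometry]
    rw [sub_mul, mul_sub, mul_sub, e1, e2, h.isometry']
    abel
  rw [h1, penalty]

theorem posSemidef_penalty (h : IsHop V) : (penalty V).PosSemidef := by
  rw [penalty_eq h]
  refine (posSemidef_self_mul_conjTranspose _).smul ?_
  rw [Complex.le_def]; simp

theorem penalty_mul_self (h : IsHop V) : penalty V * penalty V = penalty V := by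
  have e1 := h.isometry
  have e2 := h.isometry'
  have e3 := h.nilpotent
  have e4 := h.nilpotent'
  rw [penalty]
  generalize Vᴴ = b at *
  generalize V = a at *
  have key : (b * a + a * b - a - b) * (b * a + a * b - a - b) =
      (2 : ℂ) • (b * a + a * b - a - b) := by
    have f1 : b * a * (b * a) = b * a := by rw [← mul_assoc, e2]
    have f2 : b * a * (a * b) = 0 := by rw [mul_assoc, ← mul_assoc a, e3]; simp
    have f3 : b * a * a = 0 := by rw [mul_assoc, e3]; simp
    have f4 : a * b * (b * a) = 0 := by rw [mul_assoc, ← mul_assoc b, e4]; simp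
    have f5 : a * b * (a * b) = a * b := by rw [← mul_assoc, e1]
    have f6 : a * b * b = 0 := by rw [mul_assoc, e4]; simp
    have f7 : a * (b * a) = a := by rw [← mul_assoc, e1]
    have f8 : a * (a * b) = 0 := by rw [← mul_assoc, e3]; simp
    have f9 : b * (b * a) = 0 := by rw [← mul_assoc, e4]; simp
    have f10 : b * (a * b) = b := by rw [← mul_assoc, e2]
    simp only [mul_sub, sub_mul, mul_add, add_mul, f1, f2, f3, f4, f5, f6, f7, f8, f9, f10, e1, e2,
      e3, e4, two_smul]
    abel
  rw [smul_mul_smul_comm, key, smul_smul]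
  norm_num

theorem norm_penalty_le (h : IsHop V) : ‖Matrix.toEuclideanCLM (𝕜 := ℂ) (penalty V)‖ ≤ 1 := by
  set E := Matrix.toEuclideanCLM (𝕜 := ℂ) (penalty V) with hE
  have h1 : IsStarProjection E := by
    refine ⟨?_, ?_⟩
    · rw [IsIdempotentElem, hE, ← map_mul, penalty_mul_self h]
    · rw [IsSelfAdjoint, hE, ← map_star, star_eq_conjTranspose, (posSemidef_penalty h).isHermitian]
  exact h1.norm_le

end Penalty

/-! ### Operators on one and on two particles -/

section Local

variable {N : ℕ}

/-- The standard basis states of a chain. -/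
noncomputable def ket (c : Config N) : Chain N := EuclideanSpace.single c 1

theorem ket_apply (c v : Config N) : ket c v = if v = c then 1 else 0 := by
  simp [ket]

theorem toEuclideanLin_ket (A : Op N) (c v : Config N) : toEuclideanLin A (ket c) v = A v c := by
  rw [ket, toLpLin_apply]
  simp [EuclideanSpace.single]

/-- The configuration `w` with the states of the particles `k` and `l` replaced. -/
def setPair (w : Config N) (k l : Fin N) (y : Site × Site) : Config N :=
  Function.update (Function.update w k y.1) l y.2

theorem setPair_fst (w : Config N) {k l : Fin N} (h : k ≠ l) (y : Site × Site) :
    setPair w k l y k = y.1 := by simp [setPair, h]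

theorem setPair_snd (w : Config N) (k l : Fin N) (y : Site × Site) :
    setPair w k l y l = y.2 := by simp [setPair]

theorem setPair_of_ne (w : Config N) {k l j : Fin N} (y : Site × Site) (h : j ≠ k) (h' : j ≠ l) :
    setPair w k l y j = w j := by simp [setPair, h, h']

theorem setPair_injective (w : Config N) {k l : Fin N} (h : k ≠ l) :
    Function.Injective (setPair w k l) := by
  intro y z hyz
  have h1 := congrFun hyz k
  have h2 := congrFun hyz l
  rw [setPair_fst w h, setPair_fst w h] at h1
  rw [setPair_snd, setPair_snd] at h2
  exact Prod.ext h1 h2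

theorem onPair_mul {k l : Fin N} (h : k ≠ l) (A B : Matrix (Site × Site) (Site × Site) ℂ) :
    onPair k l (A * B) = onPair k l A * onPair k l B := by
  ext v w
  rw [mul_apply, ← Fintype.sum_of_injective (setPair w k l) (setPair_injective w h)
    (fun y => onPair k l A v (setPair w k l y) * onPair k l B (setPair w k l y) w)]
  · have e1 : ∀ y, onPair k l B (setPair w k l y) w = B y (w k, w l) := by
      intro y
      simp only [onPair, of_apply, setPair_fst w h, setPair_snd]
      exact if_pos fun j h1 h2 => setPair_of_ne w y h1 h2
    have e2 : ∀ y, onPair k l A v (setPair w k l y) =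
        if ∀ j, j ≠ k → j ≠ l → v j = w j then A (v k, v l) y else 0 := by
      intro y
      simp only [onPair, of_apply, setPair_fst w h, setPair_snd]
      refine if_congr (forall_congr' fun j => forall_congr' fun h1 => forall_congr' fun h2 => ?_)
        rfl rfl
      rw [setPair_of_ne w y h1 h2]
    simp only [e1, e2]
    simp only [onPair, of_apply, mul_apply]
    split_ifs <;> simp
  · intro u hu
    have : onPair k l B u w = 0 := by
      simp only [onPair, of_apply]
      refine if_neg fun hj => hu ⟨(u k, u l), ?_⟩
      funext j
      by_cases h1 : j = l
      · rw [h1, setPair_snd]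
      by_cases h2 : j = k
      · rw [h2, setPair_fst w h]
      rw [setPair_of_ne w _ h2 h1, hj j h2 h1]
    rw [this, mul_zero]
  · intro y; rfl

theorem onPair_conjTranspose (k l : Fin N) (A : Matrix (Site × Site) (Site × Site) ℂ) :
    (onPair k l A)ᴴ = onPair k l Aᴴ := by
  ext v w
  simp only [conjTranspose_apply, onPair, of_apply, apply_ite star, star_zero]
  exact if_congr (forall_congr' fun j => by simp only [eq_comm]) rfl rfl

theorem onPair_zero (k l : Fin N) : onPair k l 0 = 0 := by
  ext v w; simp [onPair]

theorem onSite_mul (k : Fin N) (A B : Matrix Site Site ℂ) :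
    onSite k (A * B) = onSite k A * onSite k B := by
  ext v w
  rw [mul_apply, ← Fintype.sum_of_injective (Function.update w k) (Function.update_injective w k)
    (fun y => onSite k A v (Function.update w k y) * onSite k B (Function.update w k y) w)]
  · have e1 : ∀ y, onSite k B (Function.update w k y) w = B y (w k) := by
      intro y
      simp only [onSite, of_apply, Function.update_self]
      exact if_pos fun j h1 => Function.update_of_ne h1 _ _
    have e2 : ∀ y, onSite k A v (Function.update w k y) =
        if ∀ j, j ≠ k → v j = w j then A (v k) y else 0 := by
      intro y
      simp only [onSite, of_apply, Function.update_self]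
      refine if_congr (forall_congr' fun j => forall_congr' fun h1 => ?_) rfl rfl
      rw [Function.update_of_ne h1]
    simp only [e1, e2]
    simp only [onSite, of_apply, mul_apply]
    split_ifs <;> simp
  · intro u hu
    have : onSite k B u w = 0 := by
      simp only [onSite, of_apply]
      refine if_neg fun hj => hu ⟨u k, ?_⟩
      funext j
      by_cases h2 : j = k
      · rw [h2, Function.update_self]
      rw [Function.update_of_ne h2, hj j h2]
    rw [this, mul_zero]
  · intro y; rfl

theorem onSite_conjTranspose (k : Fin N) (A : Matrix Site Site ℂ) :
    (onSite k A)ᴴ = onSite k Aᴴ := by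
  ext v w
  simp only [conjTranspose_apply, onSite, of_apply, apply_ite star, star_zero]
  exact if_congr (forall_congr' fun j => by simp only [eq_comm]) rfl rfl

theorem onSite_zero (k : Fin N) : onSite k 0 = 0 := by
  ext v w; simp [onSite]

theorem IsHop.onPair {k l : Fin N} (h : k ≠ l) {A : Matrix (Site × Site) (Site × Site) ℂ}
    (hA : IsHop A) : IsHop (onPair k l A) :=
  ⟨by rw [onPair_conjTranspose, ← onPair_mul h, ← onPair_mul h, hA.isometry],
    by rw [← onPair_mul h, hA.nilpotent, onPair_zero]⟩

theorem IsHop.onSite (k : Fin N) {A : Matrix Site Site ℂ} (hA : IsHop A) : IsHop (onSite k A) :=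
  ⟨by rw [onSite_conjTranspose, ← onSite_mul, ← onSite_mul, hA.isometry],
    by rw [← onSite_mul, hA.nilpotent, onSite_zero]⟩

theorem isHop_single {s t : Site} (h : s ≠ t) : IsHop (Matrix.single s t (1 : ℂ)) :=
  ⟨by simp [conjTranspose_single], by rw [single_mul_single_of_ne _ _ _ _ h.symm]⟩

end Local

/-! ### The transition rules -/

section Rules

/-- The pairs to which a transition rule applies. -/
def IsSource (boundary : Bool) (x : Site × Site) : Prop :=
  (hop boundary x).isSome ∨ (boundary = false ∧ ∃ a b, x = (.gate a, .qubit b))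

/-- The inverse of `hop`. -/
def unhop (boundary : Bool) : Site × Site → Site × Site
  | (.left, .blank) => (.turn, .blank)
  | (.left, .qubit a) => (.qubit a, .left)
  | (.blank, .turn) => (.blank, .left)
  | (.qubit a, .right b) => (.right a, .qubit b)
  | (.blank, .gate a) => (.turn, .qubit a)
  | (.blank, .right a) => (.turn, .qubit a)
  | (.qubit a, .turn) => if boundary then (.gate a, .blank) else (.right a, .blank)
  | x => x

theorem unhop_hop {b : Bool} {x y : Site × Site} (h : hop b x = some y) : unhop b y = x := by
  obtain ⟨x₁, x₂⟩ := x
  cases b <;> cases x₁ <;> cases x₂ <;> simp [hop] at h <;> subst h <;> rfl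

theorem hop_gate_qubit (b a c : Bool) : hop b (.gate a, .qubit c) = none := rfl

theorem not_isSource_of_hop {b : Bool} {x y : Site × Site} (h : hop b x = some y) :
    ¬ IsSource b y := by
  obtain ⟨x₁, x₂⟩ := x
  cases b <;> cases x₁ <;> cases x₂ <;> simp [hop] at h <;> subst h <;> simp [IsSource, hop]

theorem hop_ne_qubit_gate {x : Site × Site} {a c : Bool} :
    hop false x ≠ some (.qubit a, .gate c) := by
  intro h
  obtain ⟨x₁, x₂⟩ := x
  cases x₁ <;> cases x₂ <;> simp [hop] at h

theorem gateAmplitude_ne_zero {U : TwoQubitUnitary} {y x : Site × Site}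
    (h : gateAmplitude U y x ≠ 0) :
    (∃ c d, y = (.qubit c, .gate d)) ∧ ∃ a b, x = (.gate a, .qubit b) := by
  unfold gateAmplitude at h
  split at h
  · exact ⟨⟨_, _, rfl⟩, ⟨_, _, rfl⟩⟩
  · exact absurd rfl h

theorem pairTransition_of_hop {b : Bool} (U : TwoQubitUnitary) {x z : Site × Site}
    (h : hop b x = some z) (y : Site × Site) :
    pairTransition b U y x = if y = z then 1 else 0 := by
  have h1 : gateAmplitude U y x = 0 := by
    by_contra h1
    obtain ⟨-, a, c, rfl⟩ := gateAmplitude_ne_zero h1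
    rw [hop_gate_qubit] at h
    simp at h
  simp only [pairTransition, of_apply, h1, ite_self, add_zero, h, Option.some.injEq, eq_comm]

theorem pairTransition_gate (U : TwoQubitUnitary) (a b : Bool) (y : Site × Site) :
    pairTransition false U y (.gate a, .qubit b) = gateAmplitude U y (.gate a, .qubit b) := by
  simp [pairTransition, hop_gate_qubit]

theorem pairTransition_of_not_isSource {b : Bool} (U : TwoQubitUnitary) {x : Site × Site}
    (h : ¬ IsSource b x) (y : Site × Site) : pairTransition b U y x = 0 := by
  simp only [IsSource, not_or, not_and, Bool.not_eq_true, Option.isSome_eq_false_iff,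
    Option.isNone_iff_eq_none] at h
  have h2 : (if b = true then 0 else gateAmplitude U y x) = 0 := by
    cases b
    · by_contra h1
      simp only [Bool.false_eq_true, if_false] at h1
      exact h.2 rfl (gateAmplitude_ne_zero h1).2
    · rfl
  simp only [pairTransition, of_apply, h.1, h2]
  simp

theorem sum_gateAmplitude (U : TwoQubitUnitary) (a b : Bool) (f : Site × Site → ℂ) :
    ∑ y, f y * gateAmplitude U y (.gate a, .qubit b) =
      ∑ z : Bool × Bool, f (.qubit z.1, .gate z.2) * U.val z (a, b) := by
  symm
  refine Fintype.sum_of_injective (fun z : Bool × Bool => (Site.qubit z.1, Site.gate z.2))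
    (fun z z' h => ?_) _ _ (fun y hy => ?_) fun z => rfl
  · simp only [Prod.mk.injEq, Site.qubit.injEq, Site.gate.injEq] at h
    exact Prod.ext h.1 h.2
  · by_contra h1
    obtain ⟨c, d, rfl⟩ := (gateAmplitude_ne_zero (right_ne_zero_of_mul h1)).1
    exact hy ⟨(c, d), rfl⟩

open Classical in
/-- The transition rules on a pair map distinct sources to orthonormal states. -/
theorem pairTransition_conjTranspose_mul (b : Bool) (U : TwoQubitUnitary) :
    (pairTransition b U)ᴴ * pairTransition b U =
      diagonal fun x => if IsSource b x then 1 else 0 := by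
  have main : ∀ x x', IsSource b x → IsSource b x' →
      ∑ y, star (pairTransition b U y x) * pairTransition b U y x' = if x = x' then 1 else 0 := by
    intro x x' hx hx'
    have hh : ∀ {x x' z z'}, hop b x = some z → hop b x' = some z' → (z = z' ↔ x = x') := by
      intro x x' z z' h h'
      refine ⟨fun e => ?_, fun e => ?_⟩
      · rw [← unhop_hop h, ← unhop_hop h', e]
      · rw [e, h'] at h; exact (Option.some.inj h).symm
    rcases hx with hx | ⟨hb, a, c, rfl⟩ <;> rcases hx' with hx' | ⟨hb', a', c', rfl⟩
    · obtain ⟨z, hz⟩ := Option.isSome_iff_exists.1 hx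
      obtain ⟨z', hz'⟩ := Option.isSome_iff_exists.1 hx'
      simp only [pairTransition_of_hop U hz, pairTransition_of_hop U hz', apply_ite star, star_one,
        star_zero, ite_mul, one_mul, zero_mul, Finset.sum_ite_eq',
        Finset.mem_univ, if_true]
      exact if_congr (hh hz hz') rfl rfl
    · subst hb'
      obtain ⟨z, hz⟩ := Option.isSome_iff_exists.1 hx
      rw [if_neg]
      · simp only [pairTransition_gate]
        rw [sum_gateAmplitude]
        refine Finset.sum_eq_zero fun y _ => ?_
        rw [pairTransition_of_hop U hz, if_neg]
        · simp
        · rintro rfl; exact hop_ne_qubit_gate hz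
      · rintro rfl; rw [hop_gate_qubit] at hz; simp at hz
    · subst hb
      obtain ⟨z, hz⟩ := Option.isSome_iff_exists.1 hx'
      rw [if_neg]
      · simp only [pairTransition_of_hop U hz, mul_ite, mul_one, mul_zero, Finset.sum_ite_eq',
          Finset.mem_univ, if_true, pairTransition_gate]
        by_contra h1
        have h2 : gateAmplitude U z (.gate a, .qubit c) ≠ 0 := fun h => h1 (by rw [h, star_zero])
        obtain ⟨⟨c', d', rfl⟩, -⟩ := gateAmplitude_ne_zero h2
        exact hop_ne_qubit_gate hz
      · rintro rfl; rw [hop_gate_qubit] at hz; simp at hz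
    · subst hb
      simp only [pairTransition_gate]
      rw [sum_gateAmplitude]
      have h1 := congrFun (congrFun (mem_unitaryGroup_iff'.1 U.2) (a, c)) (a', c')
      rw [star_eq_conjTranspose, mul_apply, one_apply] at h1
      simp only [conjTranspose_apply] at h1
      refine Eq.trans ?_ (h1.trans (if_congr ?_ rfl rfl))
      · rfl
      · simp
  ext x x'
  rw [mul_apply]
  simp only [conjTranspose_apply]
  rw [diagonal_apply]
  by_cases hx : IsSource b x
  · by_cases hx' : IsSource b x'
    · rw [main x x' hx hx', if_pos hx]
    · rw [if_neg (by rintro rfl; exact hx' hx)]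
      simp [pairTransition_of_not_isSource U hx']
  · simp [pairTransition_of_not_isSource U hx, hx]

theorem isHop_pairTransition (b : Bool) (U : TwoQubitUnitary) : IsHop (pairTransition b U) := by
  classical
  refine ⟨?_, ?_⟩
  · rw [mul_assoc, pairTransition_conjTranspose_mul]
    ext y x
    rw [mul_diagonal]
    by_cases hx : IsSource b x
    · simp [hx]
    · simp [pairTransition_of_not_isSource U hx]
  · ext z x
    rw [mul_apply, Matrix.zero_apply]
    refine Finset.sum_eq_zero fun y _ => ?_
    by_cases hx : IsSource b x
    · rcases hx with hx | ⟨rfl, a, c, rfl⟩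
      · obtain ⟨w, hw⟩ := Option.isSome_iff_exists.1 hx
        rw [pairTransition_of_hop U hw]
        by_cases hy : y = w
        · rw [hy, pairTransition_of_not_isSource U (not_isSource_of_hop hw), zero_mul]
        · rw [if_neg hy, mul_zero]
      · rw [pairTransition_gate]
        by_contra h1
        obtain ⟨⟨c', d', rfl⟩, -⟩ := gateAmplitude_ne_zero (right_ne_zero_of_mul h1)
        refine left_ne_zero_of_mul h1 (pairTransition_of_not_isSource U ?_ _)
        simp [IsSource, hop]
    · rw [pairTransition_of_not_isSource U hx, mul_zero]

end Rules

/-! ### The Hamiltonians are nearest-neighbour -/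

section NearestNeighbour

variable {N n : ℕ}

theorem penalty_onPair {k l : Fin N} (h : k ≠ l) (A : Matrix (Site × Site) (Site × Site) ℂ) :
    penalty (onPair k l A) = onPair k l ((1 / 2 : ℂ) • (Aᴴ * A + A * Aᴴ - A - Aᴴ)) := by
  rw [penalty, onPair_conjTranspose, ← onPair_mul h, ← onPair_mul h]
  ext v w
  simp only [onPair, Matrix.smul_apply, Matrix.sub_apply, Matrix.add_apply, of_apply]
  split_ifs <;> simp

theorem penalty_onSite (k : Fin N) (A : Matrix Site Site ℂ) :
    penalty (onSite k A) = onSite k ((1 / 2 : ℂ) • (Aᴴ * A + A * Aᴴ - A - Aᴴ)) := by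
  rw [penalty, onSite_conjTranspose, ← onSite_mul, ← onSite_mul]
  ext v w
  simp only [onSite, Matrix.smul_apply, Matrix.sub_apply, Matrix.add_apply, of_apply]
  split_ifs <;> simp

theorem actsOn_onPair (k : Fin N) (h : k.val + 1 < N) (A : Matrix (Site × Site) (Site × Site) ℂ) :
    ActsOn {l : Fin N | l.val = k.val ∨ l.val = k.val + 1} (onPair k ⟨k.val + 1, h⟩ A) := by
  refine ⟨fun f g => A (f ⟨k, Or.inl rfl⟩, f ⟨⟨k.val + 1, h⟩, Or.inr rfl⟩)
    (g ⟨k, Or.inl rfl⟩, g ⟨⟨k.val + 1, h⟩, Or.inr rfl⟩), fun v w => ⟨fun hv => ?_, ?_⟩⟩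
  · refine if_pos fun j h1 h2 => hv j ?_
    rintro (h3 | h3)
    · exact h1 (Fin.ext h3)
    · exact h2 (Fin.ext h3)
  · rintro ⟨j, hj, hne⟩
    refine if_neg fun hv => hne (hv j ?_ ?_)
    · rintro rfl; exact hj (Or.inl rfl)
    · rintro rfl; exact hj (Or.inr rfl)

theorem actsOn_onSite (k : Fin N) (A : Matrix Site Site ℂ) :
    ActsOn {l : Fin N | l.val = k.val ∨ l.val = k.val + 1} (onSite k A) := by
  classical
  refine ⟨fun f g => if ∀ l, l.val ≠ k → f l = g l then A (f ⟨k, Or.inl rfl⟩) (g ⟨k, Or.inl rfl⟩)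
    else 0, fun v w => ⟨fun hv => ?_, ?_⟩⟩
  · refine if_congr ⟨fun h l hl => h l hl, fun h l hl => ?_⟩ rfl rfl
    by_cases hS : l ∈ {l : Fin N | l.val = k.val ∨ l.val = k.val + 1}
    · exact h ⟨l, hS⟩ hl
    · exact hv l hS
  · rintro ⟨j, hj, hne⟩
    refine if_neg fun hv => hne (hv j ?_)
    rintro rfl; exact hj (Or.inl rfl)

theorem ActsOn.zero (S : Set (Fin N)) : ActsOn S (0 : Op N) :=
  ⟨0, fun _ _ => ⟨fun _ => rfl, fun _ => rfl⟩⟩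

theorem ActsOn.smul {S : Set (Fin N)} {A : Op N} (h : ActsOn S A) (c : ℂ) : ActsOn S (c • A) := by
  obtain ⟨B, hB⟩ := h
  refine ⟨c • B, fun v w => ⟨fun hv => ?_, fun hv => ?_⟩⟩
  · rw [Matrix.smul_apply, Matrix.smul_apply, (hB v w).1 hv]
  · rw [Matrix.smul_apply, (hB v w).2 hv, smul_zero]

theorem penalty_zero : penalty (0 : Op N) = 0 := by simp [penalty]

variable (Q : RoundCircuit n) (k : Fin Q.size)

theorem isHop_bondTransition : IsHop (bondTransition Q k) := by
  unfold bondTransition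
  split_ifs with h
  · exact (isHop_pairTransition _ _).onPair (by simp [Fin.ext_iff])
  · exact IsHop.zero

theorem isHop_leftEndTransition : IsHop (leftEndTransition Q k) := by
  unfold leftEndTransition
  split_ifs with h
  · exact (isHop_single (by simp)).onSite k
  · exact IsHop.zero

theorem isHop_rightEndTransition : IsHop (rightEndTransition Q k) := by
  unfold rightEndTransition
  split_ifs with h
  · exact (isHop_single (by simp)).onSite k
  · exact IsHop.zero

theorem actsOn_penalty_bondTransition :
    ActsOn {l : Fin Q.size | l.val = k.val ∨ l.val = k.val + 1} (penalty (bondTransition Q k)) := by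
  unfold bondTransition
  split_ifs with h
  · rw [penalty_onPair (by simp [Fin.ext_iff])]; exact actsOn_onPair k h _
  · rw [penalty_zero]; exact ActsOn.zero _

theorem actsOn_penalty_leftEndTransition :
    ActsOn {l : Fin Q.size | l.val = k.val ∨ l.val = k.val + 1}
      (penalty (leftEndTransition Q k)) := by
  unfold leftEndTransition
  split_ifs with h
  · rw [penalty_onSite]; exact actsOn_onSite k _
  · rw [penalty_zero]; exact ActsOn.zero _

theorem actsOn_penalty_rightEndTransition :
    ActsOn {l : Fin Q.size | l.val = k.val ∨ l.val = k.val + 1}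
      (penalty (rightEndTransition Q k)) := by
  unfold rightEndTransition
  split_ifs with h
  · rw [penalty_onSite]; exact actsOn_onSite k _
  · rw [penalty_zero]; exact ActsOn.zero _

theorem actsOn_Hinit : ActsOn {l : Fin Q.size | l.val = 0 ∨ l.val = 0 + 1} (Hinit Q) := by
  classical
  refine ⟨diagonal fun f => if ∃ k, k.1.val = 0 ∧ f k = Site.gate false then 0 else 1,
    fun v w => ⟨fun hv => ?_, ?_⟩⟩
  · have e1 : v = w ↔ (fun l : {l : Fin Q.size | l.val = 0 ∨ l.val = 0 + 1} => v l) =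
        fun l : {l : Fin Q.size | l.val = 0 ∨ l.val = 0 + 1} => w l := by
      refine ⟨fun h => by rw [h], fun h => funext fun l => ?_⟩
      by_cases hS : l ∈ {l : Fin Q.size | l.val = 0 ∨ l.val = 0 + 1}
      · exact congrFun h ⟨l, hS⟩
      · exact hv l hS
    rw [Hinit, diagonal_apply, diagonal_apply]
    refine if_congr e1 (if_congr ⟨?_, ?_⟩ rfl rfl) rfl
    · rintro ⟨k, hk, h⟩; exact ⟨⟨k, Or.inl hk⟩, hk, h⟩
    · rintro ⟨k, hk, h⟩; exact ⟨k, hk, h⟩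
  · rintro ⟨j, hj, hne⟩
    rw [Hinit, diagonal_apply_ne]
    rintro rfl; exact hne rfl

theorem posSemidef_Hinit : (Hinit Q).PosSemidef := by
  rw [Hinit, posSemidef_diagonal_iff]
  intro v
  split_ifs
  · exact le_rfl
  · exact zero_le_one

theorem norm_Hinit_le : ‖Matrix.toEuclideanCLM (𝕜 := ℂ) (Hinit Q)‖ ≤ 1 := by
  have h1 : IsStarProjection (Matrix.toEuclideanCLM (𝕜 := ℂ) (Hinit Q)) := by
    refine ⟨?_, ?_⟩
    · rw [IsIdempotentElem, ← map_mul]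
      congr 1
      rw [Hinit, diagonal_mul_diagonal]
      congr 1
      funext v
      split_ifs <;> simp
    · rw [IsSelfAdjoint, ← map_star, star_eq_conjTranspose, (posSemidef_Hinit Q).isHermitian]
  exact h1.norm_le

theorem isNearestNeighbour_of_sum {ι : Type*} [Fintype ι] {m : ℕ} (hm : Fintype.card ι = m)
    (h : ι → Op N) (hh : ∀ j, (h j).PosSemidef ∧ ‖Matrix.toEuclideanCLM (𝕜 := ℂ) (h j)‖ ≤ 1 ∧
      ∃ k : ℕ, ActsOn {l : Fin N | l.val = k ∨ l.val = k + 1} (h j)) :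
    IsNearestNeighbour m (∑ j, h j) := by
  let e := Fintype.equivFinOfCardEq hm
  exact ⟨fun j => h (e.symm j), (Equiv.sum_comp e.symm h).symm, fun j => hh _⟩

theorem isNearestNeighbour_Hadiabatic {s : ℝ} (hs : s ∈ Set.Icc (0 : ℝ) 1) :
    IsNearestNeighbour (3 * Q.size + 1) (Hadiabatic Q s) := by
  let h : Option (Fin Q.size ⊕ Fin Q.size ⊕ Fin Q.size) → Op Q.size
    | none => ((1 - s : ℝ) : ℂ) • Hinit Q
    | some (.inl k) => (s : ℂ) • penalty (bondTransition Q k)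
    | some (.inr (.inl k)) => (s : ℂ) • penalty (leftEndTransition Q k)
    | some (.inr (.inr k)) => (s : ℂ) • penalty (rightEndTransition Q k)
  have hsum : Hadiabatic Q s = ∑ j, h j := by
    rw [Fintype.sum_option, Fintype.sum_sum_type, Fintype.sum_sum_type, Hadiabatic, Hprop]
    simp only [h, Finset.sum_add_distrib, smul_add, Finset.smul_sum, add_assoc]
  have scale : ∀ (A : Op Q.size) (k : ℕ) (c : ℝ), c ∈ Set.Icc (0 : ℝ) 1 → A.PosSemidef →
      ‖Matrix.toEuclideanCLM (𝕜 := ℂ) A‖ ≤ 1 →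
      ActsOn {l : Fin Q.size | l.val = k ∨ l.val = k + 1} A →
      ((c : ℂ) • A).PosSemidef ∧ ‖Matrix.toEuclideanCLM (𝕜 := ℂ) ((c : ℂ) • A)‖ ≤ 1 ∧
        ∃ k : ℕ, ActsOn {l : Fin Q.size | l.val = k ∨ l.val = k + 1} ((c : ℂ) • A) := by
    intro A k c hc h1 h2 h3
    refine ⟨h1.smul (by exact_mod_cast hc.1), ?_, k, h3.smul _⟩
    rw [map_smul, norm_smul, Complex.norm_real, Real.norm_of_nonneg hc.1]
    exact mul_le_one₀ hc.2 (norm_nonneg _) h2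
  rw [hsum]
  refine isNearestNeighbour_of_sum (by simp; ring) h fun j => ?_
  have hs' : 1 - s ∈ Set.Icc (0 : ℝ) 1 := ⟨by linarith [hs.2], by linarith [hs.1]⟩
  rcases j with _ | k | k | k
  · exact scale _ 0 _ hs' (posSemidef_Hinit Q) (norm_Hinit_le Q) (actsOn_Hinit Q)
  · exact scale _ k _ hs (posSemidef_penalty (isHop_bondTransition Q k))
      (norm_penalty_le (isHop_bondTransition Q k)) (actsOn_penalty_bondTransition Q k)
  · exact scale _ k _ hs (posSemidef_penalty (isHop_leftEndTransition Q k))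
      (norm_penalty_le (isHop_leftEndTransition Q k)) (actsOn_penalty_leftEndTransition Q k)
  · exact scale _ k _ hs (posSemidef_penalty (isHop_rightEndTransition Q k))
      (norm_penalty_le (isHop_rightEndTransition Q k)) (actsOn_penalty_rightEndTransition Q k)

end NearestNeighbour

/-! ### Places of the transition rules -/

section Places

variable {n : ℕ} (Q : RoundCircuit n)

/-- The transition rules at a place: place `0` is the left end of the chain, place `k + 1` is the
bond to the right of the particle `k`, or the right end if this is the last particle. -/
noncomputable def placeOp (j : ℕ) : Op Q.size :=
  if h : j - 1 < Q.size then
    if j = 0 then leftEndTransition Q ⟨j - 1, h⟩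
    else bondTransition Q ⟨j - 1, h⟩ + rightEndTransition Q ⟨j - 1, h⟩
  else 0

theorem placeOp_zero (h : 0 < Q.size) : placeOp Q 0 = leftEndTransition Q ⟨0, h⟩ := by
  simp [placeOp, h]

theorem placeOp_succ (k : Fin Q.size) :
    placeOp Q (k.val + 1) = bondTransition Q k + rightEndTransition Q k := by
  simp [placeOp]

theorem bondTransition_last (k : Fin Q.size) (h : k.val + 1 = Q.size) :
    bondTransition Q k = 0 := dif_neg (by omega)

theorem rightEndTransition_of_ne (k : Fin Q.size) (h : k.val + 1 ≠ Q.size) :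
    rightEndTransition Q k = 0 := if_neg h

/-- The sum over the particles of the rules at their right bond and at the ends of the chain is a
sum over places. -/
theorem sum_places {α : Type*} [AddCommMonoid α] (hN : 0 < Q.size) (f : Op Q.size → α)
    (f0 : f 0 = 0) :
    ∑ k, (f (bondTransition Q k) + f (leftEndTransition Q k) + f (rightEndTransition Q k)) =
      ∑ j ∈ Finset.range (Q.size + 1), f (placeOp Q j) := by
  have h1 : ∑ k, f (leftEndTransition Q k) = f (placeOp Q 0) := by
    rw [placeOp_zero Q hN]
    refine Finset.sum_eq_single _ (fun k _ hk => ?_) (fun h => absurd (Finset.mem_univ _) h)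
    rw [leftEndTransition, if_neg, f0]
    intro h; exact hk (Fin.ext h)
  have h2 : ∀ k, f (bondTransition Q k) + f (rightEndTransition Q k) =
      f (placeOp Q (k.val + 1)) := by
    intro k
    rw [placeOp_succ]
    by_cases h : k.val + 1 = Q.size
    · rw [bondTransition_last Q k h, f0, zero_add, zero_add]
    · rw [rightEndTransition_of_ne Q k h, f0, add_zero, add_zero]
  rw [Finset.sum_range_succ', ← Fin.sum_univ_eq_sum_range (fun j => f (placeOp Q (j + 1))), ← h1,
    ← Finset.sum_add_distrib]
  refine Finset.sum_congr rfl fun k _ => ?_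
  rw [← h2]
  exact add_right_comm _ _ _

theorem forward_eq (hN : 0 < Q.size) :
    forward Q = ∑ j ∈ Finset.range (Q.size + 1), placeOp Q j := sum_places Q hN id rfl

theorem Hprop_eq (hN : 0 < Q.size) :
    Hprop Q = ∑ j ∈ Finset.range (Q.size + 1), penalty (placeOp Q j) :=
  sum_places Q hN penalty penalty_zero

/-- The sites from which a rule on the right neighbour's side can start. -/
def Site.LooksRight : Site → Prop
  | .turn => True
  | .gate _ => True
  | .right _ => True
  | _ => False

theorem pairTransition_ne_zero {b : Bool} {U : TwoQubitUnitary} {y x : Site × Site}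
    (h : pairTransition b U y x ≠ 0) :
    (x.1.LooksRight ∨ x.2 = .left) ∧ (y.1 = .left ∨ y.2.LooksRight) := by
  by_cases hx : IsSource b x
  swap
  · exact absurd (pairTransition_of_not_isSource U hx y) h
  rcases hx with hx | ⟨rfl, a, c, rfl⟩
  · obtain ⟨z, hz⟩ := Option.isSome_iff_exists.1 hx
    rw [pairTransition_of_hop U hz] at h
    have : y = z := by by_contra h'; exact h (if_neg h')
    subst this
    obtain ⟨x₁, x₂⟩ := x
    cases b <;> cases x₁ <;> cases x₂ <;> simp [hop] at hz <;> subst hz <;> simp [Site.LooksRight]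
  · rw [pairTransition_gate] at h
    obtain ⟨⟨c', d', rfl⟩, -⟩ := gateAmplitude_ne_zero h
    exact ⟨Or.inl trivial, Or.inr trivial⟩

/-- A rule at place `j` starts from a particle next to this place that looks towards it, and ends
with one that looks away from it. -/
theorem placeOp_ne_zero {j : ℕ} {v c : Config Q.size} (h : placeOp Q j v c ≠ 0) :
    ((∃ k, k.val + 1 = j ∧ (c k).LooksRight) ∨ ∃ k, k.val = j ∧ c k = .left) ∧
    ((∃ k, k.val + 1 = j ∧ v k = .left) ∨ ∃ k, k.val = j ∧ (v k).LooksRight) := by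
  have hj : j - 1 < Q.size := by
    by_contra hj
    rw [placeOp, dif_neg hj] at h
    exact h rfl
  rcases Nat.eq_zero_or_pos j with rfl | hj0
  · rw [placeOp_zero Q hj, leftEndTransition, if_pos rfl, onSite, of_apply, ite_ne_right_iff,
      single_apply, ite_ne_right_iff] at h
    obtain ⟨-, ⟨h1, h2⟩, -⟩ := h
    refine ⟨Or.inr ⟨⟨0, hj⟩, rfl, h2.symm⟩, Or.inr ⟨⟨0, hj⟩, rfl, ?_⟩⟩
    rw [← h1]; trivial
  obtain ⟨k, hk⟩ : ∃ k : Fin Q.size, k.val + 1 = j := ⟨⟨j - 1, hj⟩, Nat.sub_add_cancel hj0⟩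
  subst hk
  rw [placeOp_succ] at h
  by_cases hl : k.val + 1 = Q.size
  · rw [bondTransition_last Q k hl, zero_add, rightEndTransition, if_pos hl, onSite, of_apply,
      ite_ne_right_iff, single_apply, ite_ne_right_iff] at h
    obtain ⟨-, ⟨h1, h2⟩, -⟩ := h
    refine ⟨Or.inl ⟨k, rfl, ?_⟩, Or.inl ⟨k, rfl, h1.symm⟩⟩
    rw [← h2]; trivial
  · have hk : k.val + 1 < Q.size := by omega
    rw [rightEndTransition_of_ne Q k hl, add_zero, bondTransition, dif_pos hk, onPair, of_apply,
      ite_ne_right_iff] at h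
    obtain ⟨h1, h2⟩ := pairTransition_ne_zero h.2
    exact ⟨h1.imp (fun h => ⟨k, rfl, h⟩) fun h => ⟨_, rfl, h⟩,
      h2.imp (fun h => ⟨k, rfl, h⟩) fun h => ⟨_, rfl, h⟩⟩

/-- The block boundary and the gate on the bond to the right of particle `k`. -/
theorem placeOp_bond {k : ℕ} (h : k + 1 < Q.size) :
    placeOp Q (k + 1) = onPair ⟨k, by omega⟩ ⟨k + 1, h⟩
      (pairTransition (decide ((k + 1) % n = 0)) (Q.gate (k / n) (k % n))) := by
  have := placeOp_succ Q ⟨k, by omega⟩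
  simp only at this
  rw [this, rightEndTransition_of_ne, add_zero, bondTransition, dif_pos]
  exact ne_of_lt h

theorem placeOp_rightEnd {k : ℕ} (h : k + 1 = Q.size) :
    placeOp Q (k + 1) = onSite ⟨k, by omega⟩ (Matrix.single Site.left Site.turn 1) := by
  have := placeOp_succ Q ⟨k, by omega⟩
  simp only at this
  rw [this, bondTransition_last _ _ h, zero_add, rightEndTransition, if_pos h]

theorem placeOp_leftEnd (h : 0 < Q.size) :
    placeOp Q 0 = onSite ⟨0, h⟩ (Matrix.single Site.turn Site.left 1) := by
  rw [placeOp_zero Q h, leftEndTransition, if_pos rfl]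

end Places

/-! ### Single steps -/

section Steps

variable {n : ℕ} (Q : RoundCircuit n)

theorem ext_ket {ψ : Chain Q.size} {c : Config Q.size} (h : ∀ v, ψ v = if v = c then 1 else 0) :
    ψ = ket c := by
  ext v; rw [h, ket_apply]

theorem onPair_diagonal_ket {N : ℕ} {k l : Fin N} (d : Site × Site → ℂ) (c : Config N)
    (hd : d (c k, c l) = 1) : toEuclideanLin (onPair k l (diagonal d)) (ket c) = ket c := by
  ext v
  rw [toEuclideanLin_ket, ket_apply, onPair, of_apply]
  by_cases h : v = c
  · subst h; simp [hd]
  · rw [if_neg h]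
    split_ifs with h1
    · rw [diagonal_apply_ne]
      intro h2
      refine h (funext fun j => ?_)
      by_cases hk : j = k
      · rw [hk]; exact congrArg Prod.fst h2
      by_cases hl : j = l
      · rw [hl]; exact congrArg Prod.snd h2
      exact h1 j hk hl
    · rfl

theorem onSite_single_ket {N : ℕ} (k : Fin N) (s t : Site) {c c' : Config N} (hc : c k = t)
    (hc' : c' k = s) (h : ∀ j, j ≠ k → c' j = c j) :
    toEuclideanLin (onSite k (Matrix.single s t 1)) (ket c) = ket c' := by
  ext v
  rw [toEuclideanLin_ket, ket_apply, onSite, of_apply, single_apply]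
  by_cases hv : v = c'
  · subst hv; rw [if_pos h, if_pos ⟨hc'.symm, hc.symm⟩, if_pos rfl]
  · rw [if_neg hv]
    split_ifs with h1 h2
    · exact absurd (funext fun j => by
        by_cases hk : j = k
        · rw [hk, hc', h2.1]
        · rw [h1 j hk, h j hk]) hv
    · rfl
    · rfl

/-- The rules at place `j` map `c` to `c'`. -/
structure StepTo (j : ℕ) (c c' : Config Q.size) : Prop where
  apply : toEuclideanLin (placeOp Q j) (ket c) = ket c'
  source : toEuclideanLin ((placeOp Q j)ᴴ * placeOp Q j) (ket c) = ket c

theorem StepTo.bond {k : ℕ} (h : k + 1 < Q.size) {c c' : Config Q.size}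
    (hh : hop (decide ((k + 1) % n = 0)) (c ⟨k, by omega⟩, c ⟨k + 1, h⟩) =
      some (c' ⟨k, by omega⟩, c' ⟨k + 1, h⟩))
    (off : ∀ j : Fin Q.size, j.val ≠ k → j.val ≠ k + 1 → c' j = c j) :
    StepTo Q (k + 1) c c' := by
  classical
  have off' : ∀ j : Fin Q.size, j ≠ ⟨k, by omega⟩ → j ≠ ⟨k + 1, h⟩ → c' j = c j := fun j h1 h2 =>
    off j (fun h3 => h1 (Fin.ext h3)) fun h3 => h2 (Fin.ext h3)
  refine ⟨?_, ?_⟩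
  · refine ext_ket Q fun v => ?_
    rw [toEuclideanLin_ket, placeOp_bond Q h, onPair, of_apply, pairTransition_of_hop _ hh]
    by_cases hv : v = c'
    · subst hv; rw [if_pos off', if_pos rfl, if_pos rfl]
    · rw [if_neg hv]
      split_ifs with h1 h2
      · refine absurd (funext fun j => ?_) hv
        by_cases hk : j = ⟨k, by omega⟩
        · rw [hk]; exact congrArg Prod.fst h2
        by_cases hl : j = ⟨k + 1, h⟩
        · rw [hl]; exact congrArg Prod.snd h2
        rw [h1 j hk hl, off' j hk hl]
      · rfl
      · rfl
  · rw [placeOp_bond Q h, onPair_conjTranspose, ← onPair_mul (by simp [Fin.ext_iff]),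
      pairTransition_conjTranspose_mul]
    refine onPair_diagonal_ket _ _ (if_pos (Or.inl ?_))
    rw [hh]; rfl

theorem isHop_single_source {N : ℕ} (k : Fin N) {s t : Site} {c : Config N} (hc : c k = t) :
    toEuclideanLin ((onSite k (Matrix.single s t 1))ᴴ * onSite k (Matrix.single s t 1)) (ket c) =
      ket c := by
  rw [onSite_conjTranspose, ← onSite_mul, conjTranspose_single, single_mul_single_same, star_one,
    mul_one]
  exact onSite_single_ket k t t hc hc fun _ _ => rfl

theorem StepTo.rightEnd {k : ℕ} (h : k + 1 = Q.size) {c c' : Config Q.size}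
    (hc : c ⟨k, by omega⟩ = .turn) (hc' : c' ⟨k, by omega⟩ = .left)
    (off : ∀ j : Fin Q.size, j.val ≠ k → c' j = c j) : StepTo Q (k + 1) c c' := by
  refine ⟨?_, ?_⟩ <;> rw [placeOp_rightEnd Q h]
  · exact onSite_single_ket _ _ _ hc hc' fun j hj => off j fun h3 => hj (Fin.ext h3)
  · exact isHop_single_source _ hc

theorem StepTo.leftEnd (h : 0 < Q.size) {c c' : Config Q.size}
    (hc : c ⟨0, h⟩ = .left) (hc' : c' ⟨0, h⟩ = .turn)
    (off : ∀ j : Fin Q.size, j.val ≠ 0 → c' j = c j) : StepTo Q 0 c c' := by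
  refine ⟨?_, ?_⟩ <;> rw [placeOp_leftEnd Q h]
  · exact onSite_single_ket _ _ _ hc hc' fun j hj => off j fun h3 => hj (Fin.ext h3)
  · exact isHop_single_source _ hc

end Steps

/-! ### The configurations passed by the chain -/

section Configurations

/-- State of particle `k` after `(2 * n + 3) * s + o` steps, with data `d`. In phase `s` the data
occupy the particles `s, …, s + n` with the exception of one of them. For `o < n` the active
particle moves rightwards through the data, carrying a bit; for `n ≤ o` a particle without data
(the hole) is turning at the right end of the data, moves leftwards through them, and turns
again at their left end, which shifts them by one particle. -/
def site (n s o : ℕ) (d : ℕ → Bool) (k : ℕ) : Site :=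
  if o < n then
    if k < s ∨ s + n ≤ k then .blank
    else if k = s + o then (if n ∣ s then .gate (d o) else .right (d o))
    else .qubit (d (k - s))
  else
    if k < s ∨ s + n < k then .blank
    else if k = s + min n (2 * n + 1 - o) then (if o = n ∨ o = 2 * n + 2 then .turn else .left)
    else .qubit (d (if k < s + min n (2 * n + 1 - o) then k - s else k - s - 1))

/-- The place at which the configuration of phase `s` and offset `o` admits a forward step. -/
def forwardPlace (n s o : ℕ) : ℕ :=
  if o ≤ n then s + o + 1 else if o ≤ 2 * n + 1 then s + (2 * n + 1 - o) else s + 1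

/-- The place at which the configuration of phase `s` and offset `o` admits a backward step. -/
def backwardPlace (n s o : ℕ) : ℕ :=
  if o ≤ n then s + o else if o ≤ 2 * n + 1 then s + (2 * n + 2 - o) else s

variable {n s o : ℕ} {d : ℕ → Bool}

theorem site_forward (ho : o ≤ 2 * n + 2) {j k : ℕ}
    (h : k + 1 = j ∧ (site n s o d k).LooksRight ∨ k = j ∧ site n s o d k = .left) :
    j = forwardPlace n s o := by
  unfold site at h
  unfold forwardPlace
  split_ifs at h ⊢ <;> simp [Site.LooksRight] at h <;> omega

theorem site_backward (ho : o ≤ 2 * n + 2) {j k : ℕ}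
    (h : k + 1 = j ∧ site n s o d k = .left ∨ k = j ∧ (site n s o d k).LooksRight) :
    j = backwardPlace n s o := by
  unfold site at h
  unfold backwardPlace
  split_ifs at h ⊢ <;> simp [Site.LooksRight] at h <;> omega

/-- Away from the place of the forward step, the next configuration is the same. -/
theorem site_succ_of_ne (ho : o ≤ 2 * n + 1) {k : ℕ} (h1 : k + 1 ≠ forwardPlace n s o)
    (h2 : k ≠ forwardPlace n s o) : site n s (o + 1) d k = site n s o d k := by
  unfold forwardPlace at h1 h2
  unfold site
  split_ifs at * <;> first | rfl | omega

theorem site_last_of_ne {k : ℕ} (h1 : k ≠ s) (h2 : k ≠ s + 1) (hn : 1 ≤ n) :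
    site n (s + 1) 0 d k = site n s (2 * n + 2) d k := by
  unfold site
  split_ifs at * <;> first | rfl | omega

theorem backwardPlace_succ (ho : o ≤ 2 * n + 1) :
    backwardPlace n s (o + 1) = forwardPlace n s o := by
  unfold backwardPlace forwardPlace; split_ifs <;> omega

theorem backwardPlace_zero : backwardPlace n (s + 1) 0 = forwardPlace n s (2 * n + 2) := by
  unfold backwardPlace forwardPlace; split_ifs <;> omega

theorem site_active (ho : o < n) :
    site n s o d (s + o) = if n ∣ s then .gate (d o) else .right (d o) := by
  unfold site; split_ifs <;> first | rfl | omega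

theorem site_qubit (ho : o < n) {i : ℕ} (hi : i < n) (hio : i ≠ o) :
    site n s o d (s + i) = .qubit (d i) := by
  unfold site; split_ifs <;> first | omega | (congr 2; omega)

theorem site_blank (ho : o < n) {k : ℕ} (hk : k < s ∨ s + n ≤ k) : site n s o d k = .blank := by
  rw [site, if_pos ho, if_pos hk]

theorem site_hole_turn (ho : o = n) : site n s o d (s + n) = .turn := by
  unfold site; split_ifs <;> first | rfl | omega

theorem site_hole_left {i : ℕ} (h1 : o + i = 2 * n + 1) (hi : i ≤ n) :
    site n s o d (s + i) = .left := by
  unfold site; split_ifs <;> first | rfl | omega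

theorem site_hole_turn_left : site n s (2 * n + 2) d s = .turn := by
  unfold site; split_ifs <;> first | rfl | omega

theorem site_qubit_left (ho : n ≤ o) {i : ℕ} (hi : i < min n (2 * n + 1 - o)) :
    site n s o d (s + i) = .qubit (d i) := by
  unfold site; split_ifs <;> first | rfl | omega | (congr 2; omega)

theorem site_qubit_right (ho : n ≤ o) {i : ℕ} (hi : min n (2 * n + 1 - o) ≤ i) (hi' : i < n) :
    site n s o d (s + i + 1) = .qubit (d i) := by
  unfold site; split_ifs <;> first | rfl | omega | (congr 2; omega)

theorem site_blank' (ho : n ≤ o) {k : ℕ} (hk : k < s ∨ s + n < k) : site n s o d k = .blank := by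
  unfold site; split_ifs <;> first | rfl | omega

end Configurations

/-! ### Steps between configurations -/

section ConfigSteps

variable {n : ℕ}

/-- The data bits as a sequence, extended by `false`. -/
def bits (x : Fin n → Bool) (i : ℕ) : Bool := if h : i < n then x ⟨i, h⟩ else false

theorem bits_val (x : Fin n → Bool) (i : Fin n) : bits x i = x i := by simp [bits]

/-- The configuration of the chain after `(2 * n + 3) * s + o` steps, with data `x`. -/
def config (Q : RoundCircuit n) (s o : ℕ) (x : Fin n → Bool) : Config Q.size :=
  fun k => site n s o (bits x) k

theorem boundary_iff {s : ℕ} : (s + n) % n = 0 ↔ n ∣ s := by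
  rw [Nat.add_mod_right]; exact (Nat.dvd_iff_mod_eq_zero).symm

/-- Within a phase, the configurations follow each other by the rules without a gate; the excluded
case is that of the marker passing through an aligned block. -/
theorem stepTo_config_succ (Q : RoundCircuit n) (hn : 1 ≤ n) {s o : ℕ} (hs : s + n < Q.size)
    (ho : o ≤ 2 * n + 1) (hg : ¬ (o + 1 < n ∧ n ∣ s)) (x : Fin n → Bool) :
    StepTo Q (forwardPlace n s o) (config Q s o x) (config Q s (o + 1) x) := by
  have off : ∀ k : Fin Q.size, k.val + 1 ≠ forwardPlace n s o → k.val ≠ forwardPlace n s o →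
      config Q s (o + 1) x k = config Q s o x k := fun k h1 h2 => site_succ_of_ne ho h1 h2
  have bond : ∀ k (h : k + 1 < Q.size), k + 1 = forwardPlace n s o →
      hop (decide ((k + 1) % n = 0)) (site n s o (bits x) k, site n s o (bits x) (k + 1)) =
        some (site n s (o + 1) (bits x) k, site n s (o + 1) (bits x) (k + 1)) →
      StepTo Q (forwardPlace n s o) (config Q s o x) (config Q s (o + 1) x) := by
    intro k h hk hh
    rw [← hk] at off ⊢
    exact StepTo.bond Q h hh fun j h1 h2 => off j (fun h3 => h1 (by omega)) h2
  rcases lt_or_ge (o + 1) n with h1 | h1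
  · -- the flag passes a qubit
    have hd : ¬ n ∣ s := fun h => hg ⟨h1, h⟩
    refine bond (s + o) (by omega) (by unfold forwardPlace; split_ifs <;> omega) ?_
    rw [site_active (by omega), add_assoc, site_qubit (by omega) h1 (by omega),
      site_qubit h1 (by omega) (by omega), site_active h1, if_neg hd, if_neg hd]
    rfl
  rcases Nat.eq_or_lt_of_le h1 with h1 | h1
  · -- the active particle leaves the data to the right
    refine bond (s + o) (by omega) (by unfold forwardPlace; split_ifs <;> omega) ?_
    rw [site_active (by omega), site_blank (by omega) (by omega),
      site_qubit_left (by omega) (by omega), add_assoc, ← h1, site_hole_turn rfl]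
    by_cases hd : n ∣ s
    · rw [if_pos hd, decide_eq_true (boundary_iff.2 hd)]; rfl
    · rw [if_neg hd, decide_eq_false (mt boundary_iff.1 hd)]; rfl
  rcases Nat.eq_or_lt_of_le (Nat.lt_succ_iff.1 h1) with h1 | h1
  · subst h1
    have hf : s + n + 1 = forwardPlace n s n := by unfold forwardPlace; split_ifs <;> omega
    rcases Nat.lt_or_ge (s + n + 1) Q.size with h2 | h2
    · -- turning inside the chain
      refine bond (s + n) h2 hf ?_
      rw [site_hole_turn rfl, site_blank' le_rfl (by omega), site_hole_left (by omega) le_rfl,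
        site_blank' (by omega) (by omega)]
      rfl
    · rw [← hf] at off ⊢
      refine StepTo.rightEnd Q (by omega) (site_hole_turn rfl)
        (site_hole_left (by omega) le_rfl) fun j hj => off j (fun h => hj (by omega)) ?_
      have := j.isLt
      omega
  rcases Nat.eq_or_lt_of_le ho with h2 | h2
  · -- the left-moving flag reaches the left end of the data
    subst h2
    have hl : ∀ d, site n s (2 * n + 1) d s = .left := fun d =>
      site_hole_left (i := 0) (by omega) (by omega)
    rcases Nat.eq_zero_or_pos s with rfl | hs0
    · have hf : forwardPlace n 0 (2 * n + 1) = 0 := by unfold forwardPlace; split_ifs <;> omega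
      rw [hf] at off ⊢
      exact StepTo.leftEnd Q (by omega) (hl _) site_hole_turn_left fun j hj => off j (by omega) hj
    · obtain ⟨k, rfl⟩ : ∃ k, s = k + 1 := ⟨s - 1, by omega⟩
      refine bond k (by omega) (by unfold forwardPlace; split_ifs <;> omega) ?_
      rw [hl, site_hole_turn_left, site_blank' (by omega) (by omega),
        site_blank' (by omega) (by omega)]
      rfl
  · -- the left-moving flag passes a qubit
    obtain ⟨i, hi⟩ : ∃ i, o + (i + 1) = 2 * n + 1 := ⟨2 * n - o, by omega⟩
    refine bond (s + i) (by omega) (by unfold forwardPlace; split_ifs <;> omega) ?_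
    rw [site_qubit_left (by omega) (by omega), add_assoc, site_hole_left hi (by omega),
      site_hole_left (by omega) (by omega), ← add_assoc,
      site_qubit_right (by omega) (by omega) (by omega)]
    rfl

/-- The turn at the left end of the data starts a new phase. -/
theorem stepTo_config_last (Q : RoundCircuit n) (hn : 1 ≤ n) {s : ℕ} (hs : s + n < Q.size)
    (x : Fin n → Bool) :
    StepTo Q (forwardPlace n s (2 * n + 2)) (config Q s (2 * n + 2) x) (config Q (s + 1) 0 x) := by
  have hf : forwardPlace n s (2 * n + 2) = s + 1 := by unfold forwardPlace; split_ifs <;> omega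
  rw [hf]
  refine StepTo.bond Q (by omega) ?_ fun j h1 h2 => site_last_of_ne h1 h2 hn
  simp only [config]
  have h0 : site n (s + 1) 0 (bits x) s = .blank := site_blank hn (by omega)
  have h1 : site n s (2 * n + 2) (bits x) (s + 1) = .qubit (bits x 0) :=
    site_qubit_right (i := 0) (by omega) (by omega) (by omega)
  have h2 := site_active (s := s + 1) (d := bits x) hn
  rw [add_zero] at h2
  rw [site_hole_turn_left, h0, h1, h2]
  by_cases hd : n ∣ s + 1
  · rw [if_pos hd, decide_eq_true (Nat.mod_eq_zero_of_dvd hd)]; rfl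
  · rw [if_neg hd, decide_eq_false (mt Nat.dvd_of_mod_eq_zero hd)]; rfl

theorem placeOp_config_eq_zero (Q : RoundCircuit n) {s o : ℕ} (ho : o ≤ 2 * n + 2)
    (x : Fin n → Bool) {j : ℕ} (hj : j ≠ forwardPlace n s o) :
    toEuclideanLin (placeOp Q j) (ket (config Q s o x)) = 0 := by
  ext v
  rw [toEuclideanLin_ket]
  by_contra h
  rcases (placeOp_ne_zero Q h).1 with ⟨k, h1, h2⟩ | ⟨k, h1, h2⟩
  · exact hj (site_forward ho (Or.inl ⟨h1, h2⟩))
  · exact hj (site_forward ho (Or.inr ⟨h1, h2⟩))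

theorem placeOp_conjTranspose_config_eq_zero (Q : RoundCircuit n) {s o : ℕ} (ho : o ≤ 2 * n + 2)
    (x : Fin n → Bool) {j : ℕ} (hj : j ≠ backwardPlace n s o) :
    toEuclideanLin (placeOp Q j)ᴴ (ket (config Q s o x)) = 0 := by
  ext v
  rw [toEuclideanLin_ket, conjTranspose_apply]
  by_contra h
  have h : placeOp Q j (config Q s o x) v ≠ 0 := fun h' => h (by rw [h', star_zero]; rfl)
  rcases (placeOp_ne_zero Q h).2 with ⟨k, h1, h2⟩ | ⟨k, h1, h2⟩
  · exact hj (site_backward ho (Or.inl ⟨h1, h2⟩))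
  · exact hj (site_backward ho (Or.inr ⟨h1, h2⟩))

/-- Each configuration determines its data. -/
theorem config_injective (Q : RoundCircuit n) {s o : ℕ} (ho : o < n) (hs : s + n ≤ Q.size) :
    Function.Injective (config Q s o) := by
  intro x y h
  funext i
  have h1 : site n s o (bits x) (s + i) = site n s o (bits y) (s + i) :=
    congrFun h ⟨s + i, by omega⟩
  rw [← bits_val x, ← bits_val y]
  by_cases hi : i.val = o
  · rw [hi, site_active ho, site_active ho] at h1
    rw [hi]
    split_ifs at h1
    · exact Site.gate.inj h1
    · exact Site.right.inj h1
  · rw [site_qubit ho i.isLt hi, site_qubit ho i.isLt hi] at h1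
    exact Site.qubit.inj h1

/-- The gate of round `r` on the qubits `i` and `i + 1`. -/
def roundGate (Q : RoundCircuit n) (r i : ℕ) (hi : i + 1 < n) : CircuitGate n where
  fst := ⟨i, by omega⟩
  snd := ⟨i + 1, hi⟩
  ne := by simp
  unitary := Q.gate r i

theorem placeOp_gate (Q : RoundCircuit n) {r o : ℕ} (ho : o + 1 < n) (hr : n * r + n ≤ Q.size) :
    placeOp Q (n * r + o + 1) = onPair ⟨n * r + o, by omega⟩ ⟨n * r + o + 1, by omega⟩
      (pairTransition false (Q.gate r o)) := by
  rw [placeOp_bond Q (by omega)]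
  have h1 : (n * r + o + 1) % n ≠ 0 := by
    rw [add_assoc, Nat.mul_add_mod, Nat.mod_eq_of_lt ho]; omega
  have h2 : (n * r + o) / n = r := by
    rw [Nat.mul_add_div (by omega), Nat.div_eq_of_lt (by omega), add_zero]
  have h3 : (n * r + o) % n = o := by rw [Nat.mul_add_mod, Nat.mod_eq_of_lt (by omega)]
  rw [decide_eq_false h1, h2, h3]

/-- While the marker passes through an aligned block, the data undergo the gates of the round. -/
theorem placeOp_gate_config (Q : RoundCircuit n) {r o : ℕ} (ho : o + 1 < n)
    (hr : n * r + n ≤ Q.size) (x : Fin n → Bool) :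
    toEuclideanLin (placeOp Q (n * r + o + 1)) (ket (config Q (n * r) o x)) =
      ∑ y, (roundGate Q r o ho).matrix y x • ket (config Q (n * r) (o + 1) y) := by
  have hd : n ∣ n * r := dvd_mul_right n r
  ext v
  rw [toEuclideanLin_ket, placeOp_gate Q ho hr, onPair, of_apply, WithLp.ofLp_sum, Finset.sum_apply]
  simp only [WithLp.ofLp_smul, Pi.smul_apply, ket_apply, smul_eq_mul, mul_ite, mul_one, mul_zero]
  have e1 : ∀ i (hi : i < n) z, config Q (n * r) o z ⟨n * r + i, by omega⟩ =
      if i = o then .gate (z ⟨i, hi⟩) else .qubit (z ⟨i, hi⟩) := by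
    intro i hi z
    have hb : bits z i = z ⟨i, hi⟩ := bits_val z ⟨i, hi⟩
    rw [← hb]
    split_ifs with h
    · subst h; exact (site_active hi).trans (if_pos hd)
    · exact site_qubit (by omega) hi h
  have e2 : ∀ i (hi : i < n) z, config Q (n * r) (o + 1) z ⟨n * r + i, by omega⟩ =
      if i = o + 1 then .gate (z ⟨i, hi⟩) else .qubit (z ⟨i, hi⟩) := by
    intro i hi z
    have hb : bits z i = z ⟨i, hi⟩ := bits_val z ⟨i, hi⟩
    rw [← hb]
    split_ifs with h
    · subst h; exact (site_active hi).trans (if_pos hd)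
    · exact site_qubit (by omega) hi h
  have e3 : ∀ z (k : Fin Q.size), (k.val < n * r ∨ n * r + n ≤ k.val) →
      config Q (n * r) o x k = config Q (n * r) (o + 1) z k := fun z k hk =>
    (site_blank (by omega) hk).trans (site_blank ho hk).symm
  have f1 : config Q (n * r) o x ⟨n * r + o, by omega⟩ = .gate (x ⟨o, by omega⟩) :=
    (e1 o (by omega) x).trans (if_pos rfl)
  have f2 : config Q (n * r) o x ⟨n * r + o + 1, by omega⟩ = .qubit (x ⟨o + 1, ho⟩) :=
    (e1 (o + 1) ho x).trans (if_neg (by omega))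
  have g1 : ∀ z, config Q (n * r) (o + 1) z ⟨n * r + o, by omega⟩ = .qubit (z ⟨o, by omega⟩) :=
    fun z => (e2 o (by omega) z).trans (if_neg (by omega))
  have g2 : ∀ z, config Q (n * r) (o + 1) z ⟨n * r + o + 1, by omega⟩ = .gate (z ⟨o + 1, ho⟩) :=
    fun z => (e2 (o + 1) ho z).trans (if_pos rfl)
  rw [f1, f2, pairTransition_gate]
  -- agreement outside the pair, for the chain and for the data
  have agree : ∀ z, (∀ j : Fin Q.size, j ≠ ⟨n * r + o, by omega⟩ → j ≠ ⟨n * r + o + 1, by omega⟩ →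
      config Q (n * r) (o + 1) z j = config Q (n * r) o x j) ↔
      ∀ k, k ≠ (roundGate Q r o ho).fst → k ≠ (roundGate Q r o ho).snd → z k = x k := by
    intro z
    constructor
    · intro h k h1 h2
      have h1' : k.val ≠ o := fun h => h1 (Fin.ext h)
      have h2' : k.val ≠ o + 1 := fun h => h2 (Fin.ext h)
      have := h ⟨n * r + k, by omega⟩ (by simpa [Fin.ext_iff] using h1')
        (by simp [Fin.ext_iff]; omega)
      rw [e1 k k.isLt, e2 k k.isLt, if_neg h1', if_neg h2'] at this
      exact Site.qubit.inj this
    · intro h j h1 h2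
      by_cases hj : j.val < n * r ∨ n * r + n ≤ j.val
      · exact (e3 z j hj).symm
      obtain ⟨i, hi⟩ : ∃ i, j.val = n * r + i := ⟨j.val - n * r, by omega⟩
      have hin : i < n := by omega
      have hj' : j = ⟨n * r + i, by omega⟩ := Fin.ext hi
      have h1' : i ≠ o := fun h => h1 (hj'.trans (by simp [h]))
      have h2' : i ≠ o + 1 := fun h => h2 (hj'.trans (by simp [h, add_assoc]))
      rw [hj', e1 i hin, e2 i hin, if_neg h1', if_neg h2', h]
      · exact fun h3 => h1' (congrArg Fin.val h3)
      · exact fun h3 => h2' (congrArg Fin.val h3)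
  by_cases hv : ∃ z, v = config Q (n * r) (o + 1) z
  · obtain ⟨z, rfl⟩ := hv
    rw [Finset.sum_eq_single z]
    · rw [if_pos rfl, g1, g2, CircuitGate.matrix, of_apply]
      simp only [agree z]
      rfl
    · intro y _ hy
      rw [if_neg]
      exact fun h => hy (config_injective Q ho hr h).symm
    · exact fun h => absurd (Finset.mem_univ _) h
  · rw [Finset.sum_eq_zero fun y _ => if_neg fun h => hv ⟨y, h⟩]
    split_ifs with h
    · by_contra h0
      obtain ⟨⟨a, b, hab⟩, -⟩ := gateAmplitude_ne_zero h0
      obtain ⟨ha, hb⟩ := Prod.ext_iff.1 hab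
      simp only at ha hb
      refine hv ⟨fun k => if k.val = o then a else if k.val = o + 1 then b else x k, ?_⟩
      funext j
      by_cases h1 : j = ⟨n * r + o, by omega⟩
      · rw [h1, g1, ha]; simp
      by_cases h2 : j = ⟨n * r + o + 1, by omega⟩
      · rw [h2, g2, hb]; simp
      rw [h j h1 h2]
      refine ((agree _).2 (fun k h3 h4 => ?_) j h1 h2).symm
      exact (if_neg fun h => h3 (Fin.ext h)).trans (if_neg fun h => h4 (Fin.ext h))
    · rfl

theorem placeOp_gate_source (Q : RoundCircuit n) {r o : ℕ} (ho : o + 1 < n)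
    (hr : n * r + n ≤ Q.size) (x : Fin n → Bool) :
    toEuclideanLin ((placeOp Q (n * r + o + 1))ᴴ * placeOp Q (n * r + o + 1))
      (ket (config Q (n * r) o x)) = ket (config Q (n * r) o x) := by
  classical
  have hd : n ∣ n * r := dvd_mul_right n r
  rw [placeOp_gate Q ho hr, onPair_conjTranspose, ← onPair_mul (by simp [Fin.ext_iff]),
    pairTransition_conjTranspose_mul]
  refine onPair_diagonal_ket _ _ (if_pos (Or.inr ⟨rfl, bits x o, bits x (o + 1), ?_⟩))
  exact Prod.ext ((site_active (by omega)).trans (if_pos hd)) (site_qubit (by omega) ho (by omega))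

end ConfigSteps

/-! ### Circuits and their prefixes -/

section Prefixes

variable {n : ℕ}

theorem circuitMatrix_append (A B : Circuit n) :
    circuitMatrix (A ++ B) = circuitMatrix B * circuitMatrix A := by
  induction A with
  | nil => simp [circuitMatrix]
  | cons g A ih => rw [List.cons_append, circuitMatrix, circuitMatrix, ih, Matrix.mul_assoc]

theorem circuitMatrix_singleton (g : CircuitGate n) : circuitMatrix [g] = g.matrix := by
  simp [circuitMatrix]

theorem outputAmplitude_concat (A : Circuit n) (g : CircuitGate n) (y : Fin n → Bool) :
    outputAmplitude (A ++ [g]) y = ∑ x, g.matrix y x * outputAmplitude A x := by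
  rw [outputAmplitude, circuitMatrix_append, circuitMatrix_singleton, Matrix.mul_apply]
  rfl

theorem outputAmplitude_nil (x : Fin n → Bool) :
    outputAmplitude ([] : Circuit n) x = if x = fun _ => false then 1 else 0 := by
  simp [outputAmplitude, circuitMatrix, Matrix.one_apply]

/-- The gates applied before the configuration of phase `s` and offset `o`: the phases in which
gates are applied are the multiples of `n`. -/
def prefixCircuit (Q : RoundCircuit n) (s o : ℕ) : Circuit n :=
  (List.range (s / n)).flatMap Q.round ++
    (Q.round (s / n)).take (if n ∣ s ∧ o < n then o else n)

variable (Q : RoundCircuit n)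

theorem length_round (r : ℕ) : (Q.round r).length = n - 1 := by simp [RoundCircuit.round]

theorem take_round {r k : ℕ} (h : n ≤ k + 1) : (Q.round r).take k = Q.round r :=
  List.take_of_length_le (by rw [length_round]; omega)

theorem prefixCircuit_of_not (s o : ℕ) (h : ¬ (n ∣ s ∧ o + 1 < n)) :
    prefixCircuit Q s o = (List.range (s / n + 1)).flatMap Q.round := by
  rw [List.range_succ, List.flatMap_append, List.flatMap_singleton, prefixCircuit, take_round]
  split_ifs with h1
  · by_contra h2; exact h ⟨h1.1, by omega⟩
  · omega

theorem prefixCircuit_start (hn : 1 ≤ n) (r : ℕ) :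
    prefixCircuit Q (n * r) 0 = (List.range r).flatMap Q.round := by
  rw [prefixCircuit, if_pos ⟨dvd_mul_right _ _, hn⟩, List.take_zero, List.append_nil,
    Nat.mul_div_cancel_left _ hn]

theorem prefixCircuit_succ_of_not (s o : ℕ) (h : ¬ (n ∣ s ∧ o + 1 < n)) :
    prefixCircuit Q s (o + 1) = prefixCircuit Q s o := by
  rw [prefixCircuit_of_not Q s o h, prefixCircuit_of_not Q s (o + 1) fun h' => h ⟨h'.1, by omega⟩]

theorem prefixCircuit_phase (hn : 1 ≤ n) (s : ℕ) {o : ℕ} (ho : n ≤ o) :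
    prefixCircuit Q (s + 1) 0 = prefixCircuit Q s o := by
  rw [prefixCircuit_of_not Q s o (by omega)]
  by_cases h : n ∣ s + 1
  · obtain ⟨r, hr⟩ := h
    have hr1 : s / n + 1 = r := by
      have : (s + 1) / n = s / n + 1 := Nat.succ_div_of_dvd ⟨r, hr⟩
      rw [← this, hr, Nat.mul_div_cancel_left _ hn]
    rw [hr, prefixCircuit_start Q hn, hr1]
  · rw [prefixCircuit_of_not Q _ _ fun h' => h h'.1, Nat.succ_div_of_not_dvd h]

theorem prefixCircuit_gate {r o : ℕ} (ho : o + 1 < n) :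
    prefixCircuit Q (n * r) (o + 1) = prefixCircuit Q (n * r) o ++ [roundGate Q r o ho] := by
  have hd : n ∣ n * r := dvd_mul_right n r
  rw [prefixCircuit, prefixCircuit, if_pos ⟨hd, ho⟩, if_pos ⟨hd, by omega⟩, List.append_assoc,
    Nat.mul_div_cancel_left _ (by omega)]
  congr 1
  rw [List.take_add_one, List.getElem?_eq_getElem (by rw [length_round]; omega)]
  simp [RoundCircuit.round, roundGate]

end Prefixes

/-! ### The states passed by the chain -/

section PhaseStates

variable {n : ℕ} (Q : RoundCircuit n)

/-- The state of the chain after `(2 * n + 3) * s + o` steps. -/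
noncomputable def phaseState (s o : ℕ) : Chain Q.size :=
  ∑ x, outputAmplitude (prefixCircuit Q s o) x • ket (config Q s o x)

theorem toEuclideanLin_phaseState (A : Op Q.size) (s o : ℕ) :
    toEuclideanLin A (phaseState Q s o) = ∑ x, outputAmplitude (prefixCircuit Q s o) x •
      toEuclideanLin A (ket (config Q s o x)) := by
  simp only [phaseState, map_sum, map_smul]

theorem placeOp_phaseState_eq_zero {s o : ℕ} (ho : o ≤ 2 * n + 2) {j : ℕ}
    (hj : j ≠ forwardPlace n s o) : toEuclideanLin (placeOp Q j) (phaseState Q s o) = 0 := by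
  rw [toEuclideanLin_phaseState]
  exact Finset.sum_eq_zero fun x _ => by rw [placeOp_config_eq_zero Q ho x hj, smul_zero]

theorem placeOp_conjTranspose_phaseState_eq_zero {s o : ℕ} (ho : o ≤ 2 * n + 2) {j : ℕ}
    (hj : j ≠ backwardPlace n s o) : toEuclideanLin (placeOp Q j)ᴴ (phaseState Q s o) = 0 := by
  rw [toEuclideanLin_phaseState]
  exact Finset.sum_eq_zero fun x _ => by
    rw [placeOp_conjTranspose_config_eq_zero Q ho x hj, smul_zero]

/-- The rules at place `j` map `ψ` to `ψ'` isometrically. -/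
structure StateStep (j : ℕ) (ψ ψ' : Chain Q.size) : Prop where
  apply : toEuclideanLin (placeOp Q j) ψ = ψ'
  source : toEuclideanLin ((placeOp Q j)ᴴ * placeOp Q j) ψ = ψ

theorem stateStep_of_stepTo {s o s' o' j : ℕ}
    (h : ∀ x, StepTo Q j (config Q s o x) (config Q s' o' x))
    (hp : prefixCircuit Q s' o' = prefixCircuit Q s o) :
    StateStep Q j (phaseState Q s o) (phaseState Q s' o') := by
  refine ⟨?_, ?_⟩ <;> rw [toEuclideanLin_phaseState, phaseState]
  · simp only [(h _).apply, hp]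
  · simp only [(h _).source]

theorem stateStep_succ (hn : 1 ≤ n) {s o : ℕ} (ho : o ≤ 2 * n + 1)
    (h : s + n < Q.size ∨ n ∣ s ∧ o + 1 < n ∧ s + n ≤ Q.size) :
    StateStep Q (forwardPlace n s o) (phaseState Q s o) (phaseState Q s (o + 1)) := by
  by_cases hg : o + 1 < n ∧ n ∣ s
  · obtain ⟨ho, r, rfl⟩ := hg
    have hr : n * r + n ≤ Q.size := h.elim le_of_lt fun h => h.2.2
    have hf : forwardPlace n (n * r) o = n * r + o + 1 := if_pos (by omega)
    rw [hf]
    refine ⟨?_, ?_⟩ <;> rw [toEuclideanLin_phaseState, phaseState]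
    · simp only [placeOp_gate_config Q ho hr, prefixCircuit_gate Q ho, outputAmplitude_concat,
        Finset.smul_sum, Finset.sum_smul, smul_smul]
      rw [Finset.sum_comm]
      simp only [mul_comm]
    · simp only [placeOp_gate_source Q ho hr]
  · refine stateStep_of_stepTo Q (fun x => stepTo_config_succ Q hn ?_ ho hg x)
      (prefixCircuit_succ_of_not Q s o fun h => hg h.symm)
    exact h.elim id fun h => absurd ⟨h.2.1, h.1⟩ hg

theorem stateStep_last (hn : 1 ≤ n) {s : ℕ} (h : s + n < Q.size) :
    StateStep Q (forwardPlace n s (2 * n + 2)) (phaseState Q s (2 * n + 2))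
      (phaseState Q (s + 1) 0) :=
  stateStep_of_stepTo Q (fun x => stepTo_config_last Q hn h x)
    (prefixCircuit_phase Q hn s (by omega))

end PhaseStates

/-! ### Paths of hopping steps -/

section HopPaths

theorem toEuclideanLin_mul_apply {N : ℕ} (A B : Op N) (ψ : Chain N) :
    toEuclideanLin (A * B) ψ = toEuclideanLin A (toEuclideanLin B ψ) := by
  ext v; simp [toEuclideanLin, toLpLin_apply]

theorem toEuclideanLin_sum_apply {N : ℕ} {ι : Type*} (S : Finset ι) (V : ι → Op N) (ψ : Chain N) :
    toEuclideanLin (∑ j ∈ S, V j) ψ = ∑ j ∈ S, toEuclideanLin (V j) ψ := by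
  rw [map_sum, LinearMap.sum_apply]

theorem inner_toEuclideanLin {N : ℕ} (A : Op N) (φ ψ : Chain N) :
    inner ℂ φ (toEuclideanLin A ψ) = inner ℂ (toEuclideanLin Aᴴ φ) ψ := by
  rw [toEuclideanLin_conjTranspose_eq_adjoint, LinearMap.adjoint_inner_left]

/-- The states `γ 0, …, γ K` form a path under the operators `V j`: of these, only `V (f t)` does
not annihilate `γ t`, and only the adjoint of `V (b t)` does not; the former maps `γ t` to
`γ (t + 1)` isometrically. -/
structure IsHopPath {N : ℕ} (S : Finset ℕ) (V : ℕ → Op N) (γ : ℕ → Chain N) (K : ℕ)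
    (f b : ℕ → ℕ) : Prop where
  mem : ∀ t < K, f t ∈ S
  forward_zero : ∀ t ≤ K, ∀ j, j ≠ f t → toEuclideanLin (V j) (γ t) = 0
  backward_zero : ∀ t ≤ K, ∀ j, j ≠ b t → toEuclideanLin (V j)ᴴ (γ t) = 0
  step : ∀ t < K, toEuclideanLin (V (f t)) (γ t) = γ (t + 1)
  source : ∀ t < K, toEuclideanLin ((V (f t))ᴴ * V (f t)) (γ t) = γ t
  link : ∀ t < K, b (t + 1) = f t
  last : toEuclideanLin (V (f K)) (γ K) = 0
  first : toEuclideanLin (V (b 0))ᴴ (γ 0) = 0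

namespace IsHopPath

variable {N : ℕ} {S : Finset ℕ} {V : ℕ → Op N} {γ : ℕ → Chain N} {K : ℕ} {f b : ℕ → ℕ}

theorem back (h : IsHopPath S V γ K f b) {t : ℕ} (ht : t < K) :
    toEuclideanLin (V (f t))ᴴ (γ (t + 1)) = γ t := by
  rw [← h.step t ht, ← toEuclideanLin_mul_apply, h.source t ht]

theorem forward_last (h : IsHopPath S V γ K f b) (j : ℕ) : toEuclideanLin (V j) (γ K) = 0 := by
  by_cases hj : j = f K
  · rw [hj, h.last]
  · exact h.forward_zero K le_rfl j hj

theorem backward_first (h : IsHopPath S V γ K f b) (j : ℕ) :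
    toEuclideanLin (V j)ᴴ (γ 0) = 0 := by
  by_cases hj : j = b 0
  · rw [hj, h.first]
  · exact h.backward_zero 0 (Nat.zero_le _) j hj

theorem sum_step (h : IsHopPath S V γ K f b) {t : ℕ} (ht : t < K) :
    toEuclideanLin (∑ j ∈ S, V j) (γ t) = γ (t + 1) := by
  rw [toEuclideanLin_sum_apply, Finset.sum_eq_single (f t)]
  · exact h.step t ht
  · exact fun j _ hj => h.forward_zero t ht.le j hj
  · exact fun h' => absurd (h.mem t ht) h'

theorem sum_last (h : IsHopPath S V γ K f b) : toEuclideanLin (∑ j ∈ S, V j) (γ K) = 0 := by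
  rw [toEuclideanLin_sum_apply]
  exact Finset.sum_eq_zero fun j _ => h.forward_last j

theorem sum_back (h : IsHopPath S V γ K f b) {t : ℕ} (ht : t < K) :
    toEuclideanLin (∑ j ∈ S, V j)ᴴ (γ (t + 1)) = γ t := by
  rw [conjTranspose_sum, toEuclideanLin_sum_apply, Finset.sum_eq_single (f t)]
  · exact h.back ht
  · exact fun j _ hj => h.backward_zero _ ht j (by rwa [h.link t ht])
  · exact fun h' => absurd (h.mem t ht) h'

theorem sum_first (h : IsHopPath S V γ K f b) : toEuclideanLin (∑ j ∈ S, V j)ᴴ (γ 0) = 0 := by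
  rw [conjTranspose_sum, toEuclideanLin_sum_apply]
  exact Finset.sum_eq_zero fun j _ => h.backward_first j

/-- The states of a path are orthogonal: pulling two of them back to the start by the adjoint of
the step operator annihilates the earlier one first. -/
theorem inner_of_lt (h : IsHopPath S V γ K f b) :
    ∀ {s t : ℕ}, s < t → t ≤ K → inner ℂ (γ s) (γ t) = 0 := by
  intro s
  induction s with
  | zero =>
    intro t hst htK
    obtain ⟨t, rfl⟩ : ∃ t', t = t' + 1 := ⟨t - 1, by omega⟩
    rw [← h.sum_step htK, inner_toEuclideanLin, h.sum_first, inner_zero_left]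
  | succ s ih =>
    intro t hst htK
    obtain ⟨t, rfl⟩ : ∃ t', t = t' + 1 := ⟨t - 1, by omega⟩
    rw [← h.sum_step htK, inner_toEuclideanLin, h.sum_back (by omega)]
    exact ih (by omega) (by omega)

theorem inner_self (h : IsHopPath S V γ K f b) :
    ∀ t ≤ K, inner ℂ (γ t) (γ t) = inner ℂ (γ 0) (γ 0) := by
  intro t
  induction t with
  | zero => intro _; rfl
  | succ t ih =>
    intro ht
    rw [← ih (by omega)]
    nth_rw 2 [← h.sum_step ht]
    rw [inner_toEuclideanLin, h.sum_back ht]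

theorem orthonormal (h : IsHopPath S V γ K f b) (h0 : ‖γ 0‖ = 1) :
    Orthonormal ℂ fun t : Fin (K + 1) => γ t := by
  rw [orthonormal_iff_ite]
  intro s t
  rcases lt_trichotomy s t with hst | rfl | hst
  · rw [if_neg hst.ne, h.inner_of_lt hst (Nat.lt_succ_iff.1 t.isLt)]
  · rw [if_pos rfl, h.inner_self _ (Nat.lt_succ_iff.1 s.isLt), inner_self_eq_norm_sq_to_K, h0]
    simp
  · rw [if_neg hst.ne', ← inner_conj_symm, h.inner_of_lt hst (Nat.lt_succ_iff.1 s.isLt), map_zero]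

/-- On a path, the sum of the penalties acts as half the Laplacian. -/
theorem penalty_apply (h : IsHopPath S V γ K f b) {t : ℕ} (ht : t ≤ K) :
    toEuclideanLin (∑ j ∈ S, penalty (V j)) (γ t) =
      (1 / 2 : ℂ) • ((if t < K then γ t - γ (t + 1) else 0) +
        (if 0 < t then γ t - γ (t - 1) else 0)) := by
  have e : ∀ j, toEuclideanLin (penalty (V j)) (γ t) = (1 / 2 : ℂ) •
      ((toEuclideanLin ((V j)ᴴ * V j) (γ t) - toEuclideanLin (V j) (γ t)) +
       (toEuclideanLin (V j * (V j)ᴴ) (γ t) - toEuclideanLin (V j)ᴴ (γ t))) := by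
    intro j
    rw [penalty, map_smul, LinearMap.smul_apply]
    congr 1
    simp only [map_add, map_sub, LinearMap.add_apply, LinearMap.sub_apply]
    abel
  rw [toEuclideanLin_sum_apply]
  simp only [e]
  rw [← Finset.smul_sum, Finset.sum_add_distrib]
  congr 2
  · split_ifs with h1
    · rw [Finset.sum_eq_single (f t)]
      · rw [h.source t h1, h.step t h1]
      · intro j _ hj
        rw [toEuclideanLin_mul_apply, h.forward_zero t ht j hj, map_zero, sub_zero]
      · exact fun h' => absurd (h.mem t h1) h'
    · obtain rfl : t = K := by omega
      exact Finset.sum_eq_zero fun j _ => by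
        rw [toEuclideanLin_mul_apply, h.forward_last, map_zero, sub_zero]
  · split_ifs with h1
    · obtain ⟨t, rfl⟩ : ∃ t', t = t' + 1 := ⟨t - 1, by omega⟩
      rw [Finset.sum_eq_single (f t)]
      · rw [toEuclideanLin_mul_apply, h.back ht, h.step t ht, Nat.add_sub_cancel]
      · intro j _ hj
        rw [toEuclideanLin_mul_apply, h.backward_zero _ ht j (by rwa [h.link t ht]), map_zero,
          sub_zero]
      · exact fun h' => absurd (h.mem t ht) h'
    · obtain rfl : t = 0 := by omega
      exact Finset.sum_eq_zero fun j _ => by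
        rw [toEuclideanLin_mul_apply, h.backward_first, map_zero, sub_zero]

end IsHopPath

end HopPaths

/-! ### The path of a circuit in round form -/

section CircuitPath

variable {n : ℕ}

theorem config_initial (Q : RoundCircuit n) : config Q 0 0 (fun _ => false) = initialConfig Q := by
  funext k
  have hb : ∀ i, bits (fun _ : Fin n => false) i = false := fun i => by simp [bits]
  have hn : 0 < n := Nat.pos_of_ne_zero fun h => by
    have := k.isLt
    simp [RoundCircuit.size, h] at this
  rw [config, initialConfig, site, if_pos hn]
  simp only [hb, Nat.not_lt_zero, false_or, zero_add, dvd_zero, if_true]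
  split_ifs <;> first | rfl | omega

theorem size_eq (Q : RoundCircuit n) (hR : 1 ≤ Q.rounds) :
    n * (Q.rounds - 1) + n = Q.size := by
  rw [← Nat.mul_succ, Nat.succ_eq_add_one, Nat.sub_add_cancel hR]

theorem config_final (Q : RoundCircuit n) (hn : 1 ≤ n) (hR : 1 ≤ Q.rounds) (x : Fin n → Bool) :
    config Q (n * (Q.rounds - 1)) (n - 1) x = finalConfig Q x := by
  have hN := size_eq Q hR
  have hd : n ∣ n * (Q.rounds - 1) := dvd_mul_right _ _
  funext k
  have hk := k.isLt
  rw [config, finalConfig]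
  generalize n * (Q.rounds - 1) = a at *
  by_cases h1 : k.val < a
  · rw [if_pos h1, site_blank (by omega) (Or.inl h1)]
  obtain ⟨i, hi⟩ : ∃ i, k.val = a + i := ⟨k.val - a, by omega⟩
  have hin : i < n := by omega
  have hi' : k.val - a = i := by omega
  have hb : bits x i = x ⟨i, hin⟩ := bits_val x ⟨i, hin⟩
  rw [if_neg h1, dif_pos (by omega)]
  simp only [hi']
  rw [← hb, hi]
  split_ifs with h2
  · obtain rfl : i = n - 1 := by omega
    rw [site_active (by omega), if_pos hd]
  · rw [site_qubit (by omega) hin (by omega)]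

variable (Q : RoundCircuit n)

theorem steps_eq (hn : 1 ≤ n) :
    Q.steps = (2 * n + 3) * (n * (Q.rounds - 1)) + (n - 1) := by
  rw [RoundCircuit.steps, Nat.add_sub_assoc hn]
  congr 1
  ring

/-- The state of the chain after `t` steps. -/
noncomputable def timeState (t : ℕ) : Chain Q.size :=
  phaseState Q (t / (2 * n + 3)) (t % (2 * n + 3))

theorem timeState_eq {s o : ℕ} (ho : o ≤ 2 * n + 2) :
    timeState Q ((2 * n + 3) * s + o) = phaseState Q s o := by
  rw [timeState, Nat.mul_add_div (by omega), Nat.div_eq_of_lt (by omega), add_zero,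
    Nat.mul_add_mod, Nat.mod_eq_of_lt (by omega)]

theorem exists_phase (t : ℕ) : ∃ s o, o ≤ 2 * n + 2 ∧ t = (2 * n + 3) * s + o :=
  ⟨t / (2 * n + 3), t % (2 * n + 3), Nat.lt_succ_iff.1 (Nat.mod_lt _ (by omega)),
    (Nat.div_add_mod _ _).symm⟩

theorem phase_of_le {m a b s o : ℕ} (h : m * s + o ≤ m * a + b) (hb : b < m) :
    s < a ∨ s = a ∧ o ≤ b := by
  rcases lt_trichotomy s a with h1 | rfl | h1
  · exact Or.inl h1
  · exact Or.inr ⟨rfl, by omega⟩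
  · have : m * (a + 1) ≤ m * s := Nat.mul_le_mul_left m h1
    rw [Nat.mul_add] at this
    omega

theorem phase_of_le_steps (hn : 1 ≤ n) {s o : ℕ}
    (h : (2 * n + 3) * s + o ≤ Q.steps) :
    s < n * (Q.rounds - 1) ∨ s = n * (Q.rounds - 1) ∧ o ≤ n - 1 := by
  rw [steps_eq Q hn] at h
  exact phase_of_le h (by omega)

theorem stateStep_time (hn : 1 ≤ n) (hR : 1 ≤ Q.rounds) {s o : ℕ} (ho : o ≤ 2 * n + 2)
    (h : (2 * n + 3) * s + o < Q.steps) :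
    StateStep Q (forwardPlace n s o) (phaseState Q s o) (timeState Q ((2 * n + 3) * s + o + 1)) ∧
      (o ≤ 2 * n + 1 ∧ (2 * n + 3) * s + o + 1 = (2 * n + 3) * s + (o + 1) ∨
       o = 2 * n + 2 ∧ (2 * n + 3) * s + o + 1 = (2 * n + 3) * (s + 1) + 0) := by
  have hN := size_eq Q hR
  rcases Nat.lt_or_ge o (2 * n + 2) with h1 | h1
  · refine ⟨?_, Or.inl ⟨by omega, rfl⟩⟩
    rw [add_assoc, timeState_eq Q (by omega)]
    refine stateStep_succ Q hn (by omega) ?_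
    rw [Nat.lt_iff_add_one_le, add_assoc] at h
    rcases phase_of_le_steps Q hn h with h2 | ⟨h2, h3⟩
    · left; omega
    · right
      exact ⟨h2 ▸ dvd_mul_right _ _, by omega, by omega⟩
  · obtain rfl : o = 2 * n + 2 := by omega
    have e : (2 * n + 3) * s + (2 * n + 2) + 1 = (2 * n + 3) * (s + 1) + 0 := by ring
    refine ⟨?_, Or.inr ⟨rfl, e⟩⟩
    rw [e, timeState_eq Q (by omega)]
    refine stateStep_last Q hn ?_
    rcases phase_of_le_steps Q hn h.le with h2 | ⟨h2, h3⟩ <;> omega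

theorem forwardPlace_le {N s o : ℕ} (h : s + n < N ∨ o + 1 < n ∧ s + n ≤ N) :
    forwardPlace n s o ≤ N := by
  unfold forwardPlace; split_ifs <;> omega

theorem isHopPath_timeState (hn : 1 ≤ n) (hR : 1 ≤ Q.rounds) :
    IsHopPath (Finset.range (Q.size + 1)) (placeOp Q) (timeState Q) Q.steps
      (fun t => forwardPlace n (t / (2 * n + 3)) (t % (2 * n + 3)))
      (fun t => backwardPlace n (t / (2 * n + 3)) (t % (2 * n + 3))) := by
  have hN := size_eq Q hR
  have hlt : ∀ t, t % (2 * n + 3) ≤ 2 * n + 2 := fun t =>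
    Nat.lt_succ_iff.1 (Nat.mod_lt _ (by omega))
  have hdm : ∀ t, (2 * n + 3) * (t / (2 * n + 3)) + t % (2 * n + 3) = t := fun t =>
    Nat.div_add_mod _ _
  have key : ∀ t < Q.steps, _ := fun t ht =>
    stateStep_time Q hn hR (hlt t) ((hdm t).symm ▸ ht)
  refine ⟨fun t ht => ?_, fun t _ j hj => ?_, fun t _ j hj => ?_, fun t ht => ?_, fun t ht => ?_,
    fun t ht => ?_, ?_, ?_⟩
  · rw [Finset.mem_range, Nat.lt_succ_iff]
    refine forwardPlace_le ?_
    have h := hlt t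
    have h' := ht
    rw [← hdm t, Nat.lt_iff_add_one_le, add_assoc, steps_eq Q hn] at h'
    generalize t / (2 * n + 3) = s at *
    generalize t % (2 * n + 3) = o at *
    rcases Nat.lt_or_ge o (2 * n + 2) with h1 | h1
    · rcases phase_of_le h' (by omega) with
        h2 | ⟨h2, h3⟩ <;> omega
    · rcases phase_of_le (m := 2 * n + 3) (s := s) (o := o) (le_trans (by omega) h') (by omega) with
        h2 | ⟨h2, h3⟩ <;> omega
  · exact placeOp_phaseState_eq_zero Q (hlt t) hj
  · exact placeOp_conjTranspose_phaseState_eq_zero Q (hlt t) hj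
  · have := (key t ht).1.apply
    rwa [hdm] at this
  · exact (key t ht).1.source
  · have h2 := (key t ht).2
    rw [hdm] at h2
    have e : ∀ s o, o ≤ 2 * n + 2 → t + 1 = (2 * n + 3) * s + o →
        (t + 1) / (2 * n + 3) = s ∧ (t + 1) % (2 * n + 3) = o := by
      intro s o ho h
      rw [h, Nat.mul_add_div (by omega), Nat.div_eq_of_lt (by omega), Nat.mul_add_mod,
        Nat.mod_eq_of_lt (by omega)]
      exact ⟨rfl, rfl⟩
    rcases h2 with ⟨h3, h4⟩ | ⟨h3, h4⟩
    · obtain ⟨e1, e2⟩ := e _ _ (by omega) h4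
      simp only [e1, e2, backwardPlace_succ h3]
    · obtain ⟨e1, e2⟩ := e _ _ (by omega) h4
      simp only [e1, e2, h3, backwardPlace_zero]
  · -- the last configuration would move at the right end, where there is no turning flag
    rw [steps_eq Q hn, timeState_eq Q (by omega), Nat.mul_add_div (by omega),
      Nat.div_eq_of_lt (by omega), add_zero, Nat.mul_add_mod, Nat.mod_eq_of_lt (by omega)]
    have hf : forwardPlace n (n * (Q.rounds - 1)) (n - 1) = (Q.size - 1) + 1 := by
      rw [forwardPlace, if_pos (by omega)]; omega
    rw [hf, toEuclideanLin_phaseState]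
    refine Finset.sum_eq_zero fun x _ => ?_
    rw [show toEuclideanLin _ (ket _) = 0 from ?_, smul_zero]
    ext v
    rw [toEuclideanLin_ket, placeOp_rightEnd Q (by omega), onSite, of_apply]
    have hc : config Q (n * (Q.rounds - 1)) (n - 1) x ⟨Q.size - 1, by omega⟩ =
        .gate (bits x (n - 1)) := by
      have h := site_active (d := bits x) (s := n * (Q.rounds - 1)) (o := n - 1) (n := n) (by omega)
      rw [if_pos (dvd_mul_right _ _), show n * (Q.rounds - 1) + (n - 1) = Q.size - 1 by omega] at h
      exact h
    rw [hc]
    split_ifs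
    · exact single_apply_of_col_ne _ _ (by simp) _
    · rfl
  · have hb : ∀ j, backwardPlace n (0 / (2 * n + 3)) (0 % (2 * n + 3)) = j → j = 0 := by
      intro j hj
      rw [← hj]
      simp [backwardPlace]
    rw [hb _ rfl, show timeState Q 0 = phaseState Q 0 0 from by simp [timeState],
      toEuclideanLin_phaseState]
    refine Finset.sum_eq_zero fun x _ => ?_
    rw [show toEuclideanLin _ (ket _) = 0 from ?_, smul_zero]
    ext v
    rw [toEuclideanLin_ket, placeOp_leftEnd Q (by omega), onSite_conjTranspose,
      conjTranspose_single, onSite, of_apply]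
    have hc : config Q 0 0 x ⟨0, by omega⟩ = .gate (bits x 0) :=
      (site_active (s := 0) hn).trans (if_pos (dvd_zero n))
    rw [hc]
    split_ifs
    · exact single_apply_of_col_ne _ _ (by simp) _
    · rfl

theorem timeState_zero (hn : 1 ≤ n) : timeState Q 0 = ket (initialConfig Q) := by
  have h0 : prefixCircuit Q 0 0 = [] := by
    have := prefixCircuit_start Q hn 0
    simpa using this
  rw [show timeState Q 0 = phaseState Q 0 0 from by simp [timeState], phaseState, h0]
  simp only [outputAmplitude_nil, ite_smul, one_smul, zero_smul, Finset.sum_ite_eq',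
    Finset.mem_univ, if_true, config_initial]

theorem timeState_steps (hn : 1 ≤ n) (hR : 1 ≤ Q.rounds) : timeState Q Q.steps =
    ∑ x, outputAmplitude Q.toCircuit x • ket (finalConfig Q x) := by
  have h : prefixCircuit Q (n * (Q.rounds - 1)) (n - 1) = Q.toCircuit := by
    rw [prefixCircuit_of_not _ _ _ (by omega), Nat.mul_div_cancel_left _ hn,
      Nat.sub_add_cancel hR, RoundCircuit.toCircuit]
  rw [steps_eq Q hn, timeState_eq Q (by omega), phaseState, h]
  simp only [config_final Q hn hR]

theorem size_pos (hn : 1 ≤ n) (hR : 1 ≤ Q.rounds) : 0 < Q.size := Nat.mul_pos hn hR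

theorem gammaState_eq (hn : 1 ≤ n) (hR : 1 ≤ Q.rounds) :
    ∀ t ≤ Q.steps, gammaState Q t = timeState Q t := by
  intro t
  induction t with
  | zero => intro _; rw [timeState_zero Q hn]; rfl
  | succ t ih =>
    intro ht
    rw [gammaState, ih (by omega), forward_eq Q (size_pos Q hn hR)]
    exact (isHopPath_timeState Q hn hR).sum_step ht

theorem gammaState_steps_succ (hn : 1 ≤ n) (hR : 1 ≤ Q.rounds) :
    gammaState Q (Q.steps + 1) = 0 := by
  rw [gammaState, gammaState_eq Q hn hR _ le_rfl, forward_eq Q (size_pos Q hn hR)]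
  exact (isHopPath_timeState Q hn hR).sum_last

theorem orthonormal_gammaState (hn : 1 ≤ n) (hR : 1 ≤ Q.rounds) :
    Orthonormal ℂ fun t : Fin (Q.steps + 1) => gammaState Q t := by
  have h := (isHopPath_timeState Q hn hR).orthonormal
    (by rw [timeState_zero Q hn, ket, PiLp.norm_single, norm_one])
  have e : (fun t : Fin (Q.steps + 1) => gammaState Q t) =
      fun t : Fin (Q.steps + 1) => timeState Q t :=
    funext fun t => gammaState_eq Q hn hR t (Nat.lt_succ_iff.1 t.isLt)
  rw [e]; exact h

theorem Hprop_gammaState (hn : 1 ≤ n) (hR : 1 ≤ Q.rounds) {t : ℕ} (ht : t ≤ Q.steps) :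
    toEuclideanLin (Hprop Q) (gammaState Q t) =
      (1 / 2 : ℂ) • ((if t < Q.steps then gammaState Q t - gammaState Q (t + 1) else 0) +
        (if 0 < t then gammaState Q t - gammaState Q (t - 1) else 0)) := by
  have h := (isHopPath_timeState Q hn hR).penalty_apply ht
  rw [← Hprop_eq Q (size_pos Q hn hR)] at h
  rw [gammaState_eq Q hn hR t ht, h]
  congr 2
  · split_ifs with h1
    · rw [gammaState_eq Q hn hR _ h1]
    · rfl
  · split_ifs with h1
    · rw [gammaState_eq Q hn hR _ (by omega)]
    · rfl

theorem site_zero_ne_gate {s o : ℕ} (h : ¬ (s = 0 ∧ o = 0)) (d : ℕ → Bool) (b : Bool) :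
    site n s o d 0 ≠ .gate b := by
  unfold site
  split_ifs <;> first | omega | simp

theorem Hinit_ket (c : Config Q.size) : toEuclideanLin (Hinit Q) (ket c) =
    (if ∃ k, k.val = 0 ∧ c k = Site.gate false then (0 : ℂ) else 1) • ket c := by
  classical
  ext v
  rw [toEuclideanLin_ket, Hinit, diagonal_apply, WithLp.ofLp_smul, Pi.smul_apply, ket_apply,
    smul_eq_mul]
  by_cases hv : v = c
  · subst hv; simp
  · simp [hv]

theorem Hinit_gammaState_zero (hn : 1 ≤ n) (hR : 1 ≤ Q.rounds) :
    toEuclideanLin (Hinit Q) (gammaState Q 0) = 0 := by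
  have h : ∃ k : Fin Q.size, k.val = 0 ∧ initialConfig Q k = Site.gate false :=
    ⟨⟨0, size_pos Q hn hR⟩, rfl, if_pos rfl⟩
  have := Hinit_ket Q (initialConfig Q)
  rw [if_pos h, zero_smul] at this
  exact this

theorem Hinit_gammaState (hn : 1 ≤ n) (hR : 1 ≤ Q.rounds) {t : ℕ} (h0 : 0 < t)
    (ht : t ≤ Q.steps) : toEuclideanLin (Hinit Q) (gammaState Q t) = gammaState Q t := by
  obtain ⟨s, o, ho, rfl⟩ := exists_phase (n := n) t
  rw [gammaState_eq Q hn hR _ ht, timeState_eq Q ho, toEuclideanLin_phaseState, phaseState]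
  refine Finset.sum_congr rfl fun x _ => ?_
  rw [Hinit_ket, if_neg, one_smul]
  rintro ⟨k, hk, h⟩
  rw [config, hk] at h
  refine site_zero_ne_gate (fun h' => ?_) _ _ h
  rw [h'.1, h'.2] at h0
  simp at h0

end CircuitPath

/-! ### The history space as a clock -/

section History

/-- The isometric embedding of the clock that maps its states to an orthonormal family. -/
noncomputable def clockEmbedding {N K : ℕ} {γ : Fin (K + 1) → Chain N} (h : Orthonormal ℂ γ) :
    Clock K →ₗᵢ[ℂ] Chain N :=
  LinearMap.isometryOfOrthonormal (v := (EuclideanSpace.basisFun (Fin (K + 1)) ℂ).toBasis)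
    ((EuclideanSpace.basisFun (Fin (K + 1)) ℂ).toBasis.constr ℂ γ)
    (by
      rw [OrthonormalBasis.coe_toBasis]
      exact (EuclideanSpace.basisFun (Fin (K + 1)) ℂ).orthonormal)
    (by
      have : ((EuclideanSpace.basisFun (Fin (K + 1)) ℂ).toBasis.constr ℂ γ) ∘
          (EuclideanSpace.basisFun (Fin (K + 1)) ℂ).toBasis = γ :=
        funext fun t => Module.Basis.constr_basis _ _ _ _
      rw [this]; exact h)

variable {N K : ℕ} {γ : Fin (K + 1) → Chain N} (h : Orthonormal ℂ γ)

theorem clockEmbedding_tick (t : Fin (K + 1)) : clockEmbedding h (tick t) = γ t := by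
  have e : (tick t : Clock K) = (EuclideanSpace.basisFun (Fin (K + 1)) ℂ).toBasis t := by
    rw [OrthonormalBasis.coe_toBasis, EuclideanSpace.basisFun_apply, tick]
  rw [e]
  exact (EuclideanSpace.basisFun (Fin (K + 1)) ℂ).toBasis.constr_basis ℂ γ t

theorem clock_eq_sum (v : Clock K) : v = ∑ t, v t • tick t := by
  ext s
  simp [tick, Finset.sum_apply, Pi.single_apply]

theorem clockEmbedding_apply (v : Clock K) : clockEmbedding h v = ∑ t, v t • γ t := by
  conv_lhs => rw [clock_eq_sum v]
  simp only [map_sum, map_smul, clockEmbedding_tick]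

theorem mem_span_iff (ψ : Chain N) :
    ψ ∈ Submodule.span ℂ (Set.range γ) ↔ ∃ v, clockEmbedding h v = ψ := by
  rw [Submodule.mem_span_range_iff_exists_fun]
  constructor
  · rintro ⟨c, rfl⟩
    exact ⟨WithLp.toLp 2 c, clockEmbedding_apply h _⟩
  · rintro ⟨v, rfl⟩
    exact ⟨v, (clockEmbedding_apply h v).symm⟩

/-- On the path of the states `γ` the clock Hamiltonian is half of the graph Laplacian; the two
conditions leave out the missing neighbours of the end points. -/
theorem clockProp_tick (t : Fin (K + 1)) :
    clockEmbedding h (clockProp K (tick t)) =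
      (1 / 2 : ℂ) • ((if ht : t.val < K then γ t - γ ⟨t + 1, by omega⟩ else 0) +
        (if 0 < t.val then γ t - γ ⟨t - 1, by omega⟩ else 0)) := by
  have e : ∀ i : Fin K, clockEmbedding h
      (((tick t : Clock K) i.castSucc - (tick t : Clock K) i.succ) • edge i) =
      (if i.val = t.val then γ t - γ i.succ else 0) +
        (if i.val + 1 = t.val then γ t - γ i.castSucc else 0) := by
    intro i
    have h1 : (tick t : Clock K) i.castSucc = if i.val = t.val then 1 else 0 := by
      simp [tick, Fin.ext_iff]
    have h2 : (tick t : Clock K) i.succ = if i.val + 1 = t.val then 1 else 0 := by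
      simp [tick, Fin.ext_iff]
    rw [map_smul, edge, map_sub, clockEmbedding_tick, clockEmbedding_tick, h1, h2]
    by_cases h3 : i.val = t.val
    · have : i.castSucc = t := Fin.ext h3
      rw [if_pos h3, if_neg (by omega), if_pos h3, if_neg (by omega), this]
      simp
    · by_cases h4 : i.val + 1 = t.val
      · have : i.succ = t := Fin.ext h4
        rw [if_neg h3, if_pos h4, if_neg h3, if_pos h4, this]
        simp
      · simp [h3, h4]
  rw [clockProp_apply, map_smul, map_sum]
  simp only [e]
  rw [Finset.sum_add_distrib]
  congr 2
  · split_ifs with ht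
    · rw [Finset.sum_eq_single ⟨t.val, ht⟩]
      · rw [if_pos rfl]; rfl
      · exact fun i _ hi => if_neg fun h' => hi (Fin.ext h')
      · exact fun h' => absurd (Finset.mem_univ _) h'
    · exact Finset.sum_eq_zero fun i _ => if_neg (by have := i.isLt; omega)
  · split_ifs with ht
    · have := t.isLt
      rw [Finset.sum_eq_single ⟨t.val - 1, by omega⟩]
      · rw [if_pos (Nat.sub_add_cancel ht)]; rfl
      · exact fun i _ hi => if_neg fun h' => hi (Fin.ext (by simp only; omega))
      · exact fun h' => absurd (Finset.mem_univ _) h'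
    · exact Finset.sum_eq_zero fun i _ => if_neg (by omega)

theorem clockEmbedding_uniformClock : clockEmbedding h (uniformClock K) =
    ((1 / Real.sqrt ((K : ℝ) + 1) : ℝ) : ℂ) • ∑ t, γ t := by
  rw [uniformClock, map_smul, map_sum]
  simp only [clockEmbedding_tick]

end History

section CircuitHistory

variable {n : ℕ} (Q : RoundCircuit n) (hn : 1 ≤ n) (hR : 1 ≤ Q.rounds)

/-- The isometry from the clock onto the history space. -/
noncomputable def historyEmbedding : Clock Q.steps →ₗᵢ[ℂ] Chain Q.size :=
  clockEmbedding (orthonormal_gammaState Q hn hR)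

theorem historyEmbedding_tick (t : Fin (Q.steps + 1)) :
    historyEmbedding Q hn hR (tick t) = gammaState Q t := clockEmbedding_tick _ t

theorem mem_historySpace_iff (ψ : Chain Q.size) :
    ψ ∈ historySpace Q ↔ ∃ v, historyEmbedding Q hn hR v = ψ := mem_span_iff _ ψ

theorem historyEmbedding_uniformClock :
    historyEmbedding Q hn hR (uniformClock Q.steps) = historyState Q :=
  clockEmbedding_uniformClock _

theorem historyEmbedding_clockInit_tick (t : Fin (Q.steps + 1)) :
    historyEmbedding Q hn hR (clockInit Q.steps (tick t)) =
      toEuclideanLin (Hinit Q) (gammaState Q t) := by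
  rw [clockInit_apply]
  by_cases ht : t = 0
  · subst ht
    rw [Fin.val_zero, Hinit_gammaState_zero Q hn hR]
    simp [tick]
  · have h1 : (tick t : Clock Q.steps) 0 = 0 := by simp [tick, Ne.symm ht]
    rw [h1, zero_smul, sub_zero, historyEmbedding_tick,
      Hinit_gammaState Q hn hR (Nat.pos_of_ne_zero fun h => ht (Fin.ext h))
        (Nat.lt_succ_iff.1 t.isLt)]

theorem historyEmbedding_clockProp_tick (t : Fin (Q.steps + 1)) :
    historyEmbedding Q hn hR (clockProp Q.steps (tick t)) =
      toEuclideanLin (Hprop Q) (gammaState Q t) := by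
  rw [Hprop_gammaState Q hn hR (Nat.lt_succ_iff.1 t.isLt)]
  exact clockProp_tick _ t

theorem clockH_apply (K : ℕ) (s : ℝ) (v : Clock K) :
    clockH K s v = ((1 - s : ℝ) : ℂ) • clockInit K v + (s : ℂ) • clockProp K v := by
  simp only [clockH, _root_.add_apply, _root_.smul_apply, _root_.sub_apply, smul_sub,
    Complex.coe_smul, sub_smul, one_smul]
  abel

/-- On the history space, the Hamiltonian of the chain is that of the clock. -/
theorem historyEmbedding_clockH (s : ℝ) (v : Clock Q.steps) :
    historyEmbedding Q hn hR (clockH Q.steps s v) =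
      toEuclideanLin (Hadiabatic Q s) (historyEmbedding Q hn hR v) := by
  rw [clock_eq_sum v]
  simp only [map_sum, map_smul]
  refine Finset.sum_congr rfl fun t _ => ?_
  rw [clockH_apply, map_add, map_smul, map_smul, historyEmbedding_clockInit_tick,
    historyEmbedding_clockProp_tick, historyEmbedding_tick, Hadiabatic, map_add, map_smul, map_smul,
    LinearMap.add_apply, LinearMap.smul_apply, LinearMap.smul_apply]

end CircuitHistory

section Consequences

variable {n : ℕ} (Q : RoundCircuit n)

theorem historySpace_invariant (hn : 1 ≤ n) (hR : 1 ≤ Q.rounds) (s : ℝ)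
    {v : Chain Q.size} (hv : v ∈ historySpace Q) :
    toEuclideanLin (Hadiabatic Q s) v ∈ historySpace Q := by
  rw [mem_historySpace_iff Q hn hR] at hv ⊢
  obtain ⟨w, rfl⟩ := hv
  exact ⟨_, historyEmbedding_clockH Q hn hR s w⟩

/-- A state of energy zero of a positive semidefinite operator is a ground state. -/
theorem isGroundState_of_posSemidef {N : ℕ} {H : Op N} (hH : H.PosSemidef) {ψ : Chain N}
    (h0 : ψ ≠ 0) (h : toEuclideanLin H ψ = 0) : IsGroundState H ψ := by
  refine ⟨h0, 0, by simp [h], fun E' ⟨v, _, hv0, hv⟩ => ?_⟩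
  have h1 := (Matrix.isPositive_toEuclideanLin_iff.2 hH).re_inner_nonneg_right v
  rw [hv, inner_smul_right, inner_self_eq_norm_sq_to_K] at h1
  have h2 : 0 < ‖v‖ := norm_pos_iff.2 hv0
  have h3 : 0 ≤ E' * ‖v‖ ^ 2 := by
    have e : (E' : ℂ) * ((‖v‖ : ℝ) : ℂ) ^ 2 = ((E' * ‖v‖ ^ 2 : ℝ) : ℂ) := by push_cast; rfl
    refine h1.trans (le_of_eq ?_)
    exact (congrArg Complex.re e).trans (Complex.ofReal_re _)
  exact nonneg_of_mul_nonneg_left h3 (by positivity)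

theorem isGroundState_Hinit (hn : 1 ≤ n) (hR : 1 ≤ Q.rounds) :
    IsGroundState (Hinit Q) (gammaState Q 0) :=
  isGroundState_of_posSemidef (posSemidef_Hinit Q)
    ((orthonormal_gammaState Q hn hR).ne_zero 0) (Hinit_gammaState_zero Q hn hR)

theorem posSemidef_Hprop : (Hprop Q).PosSemidef :=
  posSemidef_sum _ fun k _ => ((posSemidef_penalty (isHop_bondTransition Q k)).add
    (posSemidef_penalty (isHop_leftEndTransition Q k))).add
      (posSemidef_penalty (isHop_rightEndTransition Q k))

theorem isGroundState_Hprop (hn : 1 ≤ n) (hR : 1 ≤ Q.rounds) :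
    IsGroundState (Hprop Q) (historyState Q) := by
  rw [← historyEmbedding_uniformClock Q hn hR]
  refine isGroundState_of_posSemidef (posSemidef_Hprop Q) ?_ ?_
  · rw [← norm_pos_iff, LinearIsometry.norm_map, norm_uniformClock]; exact one_pos
  · have h := historyEmbedding_clockH Q hn hR 1 (uniformClock Q.steps)
    have h1 : Hadiabatic Q 1 = Hprop Q := by simp [Hadiabatic]
    have h2 : clockProp Q.steps (uniformClock Q.steps) = 0 := by
      rw [clockProp_apply]; simp [uniformClock_apply]
    rw [h1, clockH_one, h2, map_zero] at h
    exact h.symm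

theorem hasGapOn_historySpace (hn : 1 ≤ n) (hR : 1 ≤ Q.rounds) {s : ℝ}
    (hs : s ∈ Set.Icc (0 : ℝ) 1) :
    HasGapOn (Hadiabatic Q s) (historySpace Q) (1 / (2 * ((Q.steps : ℝ) + 1) ^ 2)) := by
  obtain ⟨φ, e, h⟩ := clock_gapped Q.steps hs
  have hδ : 0 < 1 / (2 * ((Q.steps : ℝ) + 1) ^ 2) := by positivity
  have eig : ∀ {E : ℝ} {w : Clock Q.steps}, toEuclideanLin (Hadiabatic Q s)
      (historyEmbedding Q hn hR w) = (E : ℂ) • historyEmbedding Q hn hR w →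
      clockH Q.steps s w = (E : ℂ) • w := by
    intro E w hw
    rw [← historyEmbedding_clockH, ← map_smul] at hw
    exact (historyEmbedding Q hn hR).injective hw
  refine ⟨e, ?_, fun E ⟨v, hvS, hv0, hv⟩ => ?_⟩
  · have hsp : Module.End.eigenspace (toEuclideanLin (Hadiabatic Q s)) (e : ℂ) ⊓ historySpace Q =
        Submodule.span ℂ {historyEmbedding Q hn hR φ} := by
      ext v
      rw [Submodule.mem_inf, Module.End.mem_eigenspace_iff, mem_historySpace_iff Q hn hR,
        Submodule.mem_span_singleton]
      constructor
      · rintro ⟨hv, w, rfl⟩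
        exact ⟨inner ℂ φ w, by rw [← map_smul, ← h.eq_smul_of_eigen hδ (eig hv)]⟩
      · rintro ⟨a, rfl⟩
        refine ⟨?_, a • φ, map_smul _ _ _⟩
        rw [map_smul, ← historyEmbedding_clockH, h.eigen, map_smul, smul_comm]
    rw [hsp]
    refine finrank_span_singleton ?_
    rw [← norm_pos_iff, LinearIsometry.norm_map, h.norm_eq]; exact one_pos
  · obtain ⟨w, rfl⟩ := (mem_historySpace_iff Q hn hR v).1 hvS
    by_cases hE : E = e
    · exact Or.inl hE
    · exact Or.inr (h.gap_of_eigen (isSymmetric_clockH s) (fun h0 => hv0 (by rw [h0, map_zero]))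
        (eig hv) hE)

/-! ### The adiabatic evolution of the chain -/

/-- The generator of Schrödinger's equation for an affine path of Hamiltonians. -/
theorem continuous_generator {E : Type*} [NormedAddCommGroup E] [NormedSpace ℂ E]
    (A B : E →L[ℂ] E) (T : ℝ) : Continuous fun t : ℝ => ((-Complex.I) •
      (((1 - t / T : ℝ) : ℂ) • A + ((t / T : ℝ) : ℂ) • B)).restrictScalars ℝ := by
  have h : Continuous fun t : ℝ =>
      (-Complex.I) • (((1 - t / T : ℝ) : ℂ) • A + ((t / T : ℝ) : ℂ) • B) := by fun_prop
  exact (ContinuousLinearMap.restrictScalarsL ℂ E E ℝ ℂ).continuous.comp h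

theorem evolution_unique {T : ℝ} {ψ₀ : Chain Q.size} {ψ ψ' : ℝ → Chain Q.size}
    (h : IsEvolution (Hadiabatic Q) T ψ₀ ψ) (h' : IsEvolution (Hadiabatic Q) T ψ₀ ψ') :
    Set.EqOn ψ ψ' (Set.Icc 0 T) := by
  refine linear_ode_unique (continuous_generator (toEuclideanCLM (𝕜 := ℂ) (Hinit Q))
    (toEuclideanCLM (𝕜 := ℂ) (Hprop Q)) T) (fun t ht => ?_) (fun t ht => ?_) (h.1.trans h'.1.symm)
  · have := h.2 t ht
    rw [Hadiabatic, map_add, map_smul, map_smul] at this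
    exact this
  · have := h'.2 t ht
    rw [Hadiabatic, map_add, map_smul, map_smul] at this
    exact this

/-- The evolution of the chain is the image of the evolution of the clock. -/
theorem exists_clock_evolution (hn : 1 ≤ n) (hR : 1 ≤ Q.rounds) {T : ℝ} (hT : 0 ≤ T) :
    ∃ χ : ℝ → Clock Q.steps, χ 0 = tick 0 ∧
      (∀ t ∈ Set.Icc 0 T, HasDerivWithinAt χ (-Complex.I • clockH Q.steps (t / T) (χ t))
        (Set.Icc 0 T) t) ∧
      IsEvolution (Hadiabatic Q) T (gammaState Q 0) fun t => historyEmbedding Q hn hR (χ t) := by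
  obtain ⟨χ, h0, hχ⟩ := exists_linear_ode
    (continuous_generator (clockInit Q.steps) (clockProp Q.steps) T) hT (tick 0)
  have hχ' : ∀ t ∈ Set.Icc 0 T, HasDerivWithinAt χ (-Complex.I • clockH Q.steps (t / T) (χ t))
      (Set.Icc 0 T) t := by
    intro t ht
    rw [clockH_apply]
    exact hχ t ht
  refine ⟨χ, h0, hχ', by simp only [h0, historyEmbedding_tick]; rfl, fun t ht => ?_⟩
  have h1 := ((historyEmbedding Q hn hR).toContinuousLinearMap.restrictScalars
    ℝ).hasFDerivAt.comp_hasDerivWithinAt t (hχ' t ht)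
  rw [← historyEmbedding_clockH, ← map_smul]
  exact h1

/-- In polynomial time the evolution leads to the history state. -/
theorem adiabatic_evolution (hn : 1 ≤ n) (hR : 1 ≤ Q.rounds) {ε T : ℝ} (hε : 0 < ε) (hε1 : ε ≤ 1)
    (hT : 480 * (((Q.steps : ℝ) + 1) / ε) ^ 8 ≤ T) :
    (∃ ψ, IsEvolution (Hadiabatic Q) T (gammaState Q 0) ψ) ∧
      ∀ ψ, IsEvolution (Hadiabatic Q) T (gammaState Q 0) ψ →
        (∀ t ∈ Set.Icc 0 T, ψ t ∈ historySpace Q) ∧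
        ∃ z : ℂ, ‖z‖ = 1 ∧ ‖ψ T - z • historyState Q‖ ≤ ε := by
  have hT0 : 0 ≤ T := le_trans (by positivity) hT
  obtain ⟨χ, h0, hχ, hψ⟩ := exists_clock_evolution Q hn hR hT0
  refine ⟨⟨_, hψ⟩, fun ψ h => ?_⟩
  have he := evolution_unique Q h hψ
  obtain ⟨z, hz, hzε⟩ := clock_adiabatic hε hε1 hT h0 hχ
  have hTT := he (Set.right_mem_Icc.2 hT0)
  simp only at hTT
  refine ⟨fun t ht => ?_, z, hz, ?_⟩
  · rw [he ht, mem_historySpace_iff Q hn hR]; exact ⟨_, rfl⟩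
  · rw [hTT, ← historyEmbedding_uniformClock Q hn hR, ← map_smul, ← map_sub,
      LinearIsometry.norm_map]
    exact hzε

end Consequences

/-! ### Permutations of qubits -/

section Relabel

variable {n : ℕ}

/-- The operator permuting the qubits: qubit `i` is moved to position `σ i`. -/
def relabel (σ : Equiv.Perm (Fin n)) : Matrix (Fin n → Bool) (Fin n → Bool) ℂ :=
  Matrix.of fun y x => if y ∘ σ = x then 1 else 0

theorem relabel_mul_apply (σ : Equiv.Perm (Fin n)) (A : Matrix (Fin n → Bool) (Fin n → Bool) ℂ)
    (y x : Fin n → Bool) : (relabel σ * A) y x = A (y ∘ σ) x := by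
  simp [relabel, Matrix.mul_apply]

theorem relabel_mul (σ τ : Equiv.Perm (Fin n)) : relabel σ * relabel τ = relabel (σ * τ) := by
  ext y x
  rw [relabel_mul_apply]
  rfl

theorem relabel_one : relabel (1 : Equiv.Perm (Fin n)) = 1 := by
  ext y x
  simp [relabel, Matrix.one_apply]

theorem mul_relabel_inv_apply (σ : Equiv.Perm (Fin n))
    (A : Matrix (Fin n → Bool) (Fin n → Bool) ℂ) (y x : Fin n → Bool) :
    (A * relabel σ⁻¹) y x = A y (x ∘ σ) := by
  have h : ∀ z : Fin n → Bool, z ∘ ⇑(Equiv.symm σ) = x ↔ z = x ∘ σ := by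
    intro z
    constructor
    · rintro rfl; funext i; simp
    · rintro rfl; funext i; simp
  simp [relabel, Matrix.mul_apply, h]

/-- The operator on `n` qubits acting by `U` on the qubits `i` and `j`. -/
def gateOp (i j : Fin n) (U : TwoQubitUnitary) : Matrix (Fin n → Bool) (Fin n → Bool) ℂ :=
  Matrix.of fun y x =>
    if ∀ k, k ≠ i → k ≠ j → y k = x k then U.val (y i, y j) (x i, x j) else 0

theorem gateOp_relabel (σ : Equiv.Perm (Fin n)) (i j : Fin n) (U : TwoQubitUnitary) :
    relabel σ * gateOp i j U * relabel σ⁻¹ = gateOp (σ i) (σ j) U := by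
  ext y x
  rw [mul_relabel_inv_apply, relabel_mul_apply, gateOp, gateOp, of_apply, of_apply]
  refine if_congr ⟨fun h k h1 h2 => ?_, fun h k h1 h2 => ?_⟩ rfl rfl
  · have := h (σ.symm k) (fun h' => h1 (by rw [← h', Equiv.apply_symm_apply]))
      (fun h' => h2 (by rw [← h', Equiv.apply_symm_apply]))
    simpa using this
  · exact h (σ k) (fun h' => h1 (σ.injective h')) fun h' => h2 (σ.injective h')

theorem gateOp_one {i j : Fin n} : gateOp i j 1 = 1 := by
  ext y x
  rw [gateOp, of_apply, Matrix.one_apply]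
  by_cases h : y = x
  · subst h; simp
  · rw [if_neg h]
    split_ifs with h1
    · refine Matrix.one_apply_ne fun h2 => h (funext fun k => ?_)
      by_cases hi : k = i
      · rw [hi]; exact congrArg Prod.fst h2
      by_cases hj : k = j
      · rw [hj]; exact congrArg Prod.snd h2
      exact h1 k hi hj
    · rfl

theorem swapGate_apply (a b : Bool × Bool) :
    swapGate.val a b = if (a.2, a.1) = b then 1 else 0 := by
  rw [swapGate]
  simp only [Equiv.Perm.permMatrix, PEquiv.toMatrix_apply]
  refine if_congr ?_ rfl rfl
  rw [Equiv.toPEquiv_apply, Option.mem_some_iff]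
  rfl

theorem gateOp_swapGate (i j : Fin n) :
    gateOp i j swapGate = relabel (Equiv.swap i j) := by
  ext y x
  rw [gateOp, of_apply, relabel, of_apply, swapGate_apply]
  by_cases h : y ∘ Equiv.swap i j = x
  · subst h
    rw [if_pos, if_pos (by simp), if_pos rfl]
    intro k hi hj
    simp [Equiv.swap_apply_of_ne_of_ne hi hj]
  · rw [if_neg h]
    split_ifs with h1 h2
    · refine absurd (funext fun k => ?_) h
      rw [Function.comp_apply]
      by_cases hi : k = i
      · rw [hi, Equiv.swap_apply_left]; exact congrArg Prod.fst h2
      by_cases hj : k = j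
      · rw [hj, Equiv.swap_apply_right]; exact congrArg Prod.snd h2
      rw [Equiv.swap_apply_of_ne_of_ne hi hj, h1 k hi hj]
    · rfl
    · rfl

theorem swapGate_conj_apply (U : TwoQubitUnitary) (a b : Bool × Bool) :
    (swapGate * U * swapGate).val a b = U.val (a.2, a.1) (b.2, b.1) := by
  have h : ∀ c : Bool × Bool, (c.2, c.1) = b ↔ c = (b.2, b.1) := by
    rintro ⟨c, d⟩
    obtain ⟨b1, b2⟩ := b
    simp [and_comm]
  change (swapGate.val * U.val * swapGate.val) a b = _
  simp [Matrix.mul_apply, swapGate_apply, h]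

theorem gateOp_swapGate_conj (i j : Fin n) (U : TwoQubitUnitary) :
    gateOp i j (swapGate * U * swapGate) = gateOp j i U := by
  ext y x
  rw [gateOp, gateOp, of_apply, of_apply, swapGate_conj_apply]
  exact if_congr ⟨fun h k h1 h2 => h k h2 h1, fun h k h1 h2 => h k h2 h1⟩ rfl rfl

theorem CircuitGate.matrix_eq (g : CircuitGate n) : g.matrix = gateOp g.fst g.snd g.unitary := rfl

end Relabel

/-! ### Routing a gate through a line -/

section Routing

variable {n : ℕ}

/-- The gate `U` on the qubits `i` and `i + 1`, if there are such. -/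
noncomputable def bondOp (n i : ℕ) (U : TwoQubitUnitary) :
    Matrix (Fin n → Bool) (Fin n → Bool) ℂ :=
  if h : i + 1 < n then gateOp ⟨i, by omega⟩ ⟨i + 1, h⟩ U else 1

/-- The exchange of the positions `i` and `i + 1`, if there are such. -/
def bondSwap (n i : ℕ) : Equiv.Perm (Fin n) :=
  if h : i + 1 < n then Equiv.swap ⟨i, by omega⟩ ⟨i + 1, h⟩ else 1

theorem bondSwap_mul_self (i : ℕ) : bondSwap n i * bondSwap n i = 1 := by
  unfold bondSwap; split_ifs
  · exact Equiv.swap_mul_self _ _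
  · rfl

theorem bondOp_one (i : ℕ) : bondOp n i 1 = 1 := by
  unfold bondOp; split_ifs
  · exact gateOp_one
  · rfl

theorem bondOp_swapGate (i : ℕ) : bondOp n i swapGate = relabel (bondSwap n i) := by
  unfold bondOp bondSwap; split_ifs
  · exact gateOp_swapGate _ _
  · exact relabel_one.symm

/-- The operator of the gates of a round on the first `m` bonds. -/
noncomputable def roundOp (n : ℕ) (U : ℕ → TwoQubitUnitary) :
    ℕ → Matrix (Fin n → Bool) (Fin n → Bool) ℂ
  | 0 => 1
  | m + 1 => bondOp n m (U m) * roundOp n U m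

theorem circuitMatrix_take_round (Q : RoundCircuit n) (r : ℕ) :
    ∀ m ≤ n - 1, circuitMatrix ((Q.round r).take m) = roundOp n (Q.gate r) m := by
  intro m
  induction m with
  | zero => intro _; rfl
  | succ m ih =>
    intro hm
    rw [List.take_add_one, List.getElem?_eq_getElem (by rw [length_round]; omega),
      Option.toList_some, circuitMatrix_append, ih (by omega), circuitMatrix_singleton, roundOp,
      bondOp, dif_pos (by omega), CircuitGate.matrix_eq]
    simp [RoundCircuit.round]

theorem circuitMatrix_round (Q : RoundCircuit n) (r : ℕ) :
    circuitMatrix (Q.round r) = roundOp n (Q.gate r) (n - 1) := by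
  rw [← circuitMatrix_take_round Q r _ le_rfl, take_round Q (by omega)]

theorem roundOp_of_one {U : ℕ → TwoQubitUnitary} {a b : ℕ} (hab : a ≤ b)
    (h : ∀ i, a ≤ i → i < b → U i = 1) : roundOp n U b = roundOp n U a := by
  induction b, hab using Nat.le_induction with
  | base => rfl
  | succ b hb ih =>
    rw [roundOp, h b hb (by omega), bondOp_one, Matrix.one_mul,
      ih fun i h1 h2 => h i h1 (by omega)]

theorem roundOp_one {U : ℕ → TwoQubitUnitary} (m : ℕ) (h : ∀ i, U i = 1) : roundOp n U m = 1 :=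
  roundOp_of_one (Nat.zero_le m) fun i _ _ => h i

theorem roundOp_single {U : ℕ → TwoQubitUnitary} {a m : ℕ} (ha : a < m)
    (h : ∀ i, i ≠ a → U i = 1) : roundOp n U m = bondOp n a (U a) := by
  rw [roundOp_of_one (a := a + 1) ha fun i h1 _ => h i (by omega), roundOp,
    roundOp_of_one (Nat.zero_le a) fun i _ h2 => h i (by omega), roundOp, Matrix.mul_one]

/-- The permutation moving position `p` to `p + k` by exchanging neighbours. -/
def shift (n p : ℕ) : ℕ → Equiv.Perm (Fin n)
  | 0 => 1
  | k + 1 => bondSwap n (p + k) * shift n p k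

theorem shift_apply_self {p : ℕ} : ∀ {k : ℕ} (h : p + k < n),
    shift n p k ⟨p, by omega⟩ = ⟨p + k, h⟩ := by
  intro k
  induction k with
  | zero => intro h; rfl
  | succ k ih =>
    intro h
    rw [shift, Equiv.Perm.mul_apply, ih (by omega), bondSwap, dif_pos (by omega),
      Equiv.swap_apply_left]
    rfl

theorem shift_apply_of_lt {p k : ℕ} {j : Fin n} (h : p + k < j.val) : shift n p k j = j := by
  induction k with
  | zero => rfl
  | succ k ih =>
    rw [shift, Equiv.Perm.mul_apply, ih (by omega), bondSwap]
    split_ifs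
    · exact Equiv.swap_apply_of_ne_of_ne (fun h' => by rw [h'] at h; simp only at h; omega)
        (fun h' => by rw [h'] at h; simp only at h; omega)
    · rfl

theorem roundOp_shift {U : ℕ → TwoQubitUnitary} {p L : ℕ} (h0 : ∀ i < p, U i = 1)
    (h1 : ∀ i, p ≤ i → i < p + L → U i = swapGate) :
    ∀ k ≤ L, roundOp n U (p + k) = relabel (shift n p k) := by
  intro k
  induction k with
  | zero =>
    intro _
    rw [add_zero, roundOp_of_one (Nat.zero_le p) fun i _ hi => h0 i hi, shift, relabel_one]
    rfl
  | succ k ih =>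
    intro hk
    rw [← add_assoc, roundOp, h1 _ (by omega) (by omega), bondOp_swapGate, ih (by omega),
      relabel_mul, shift]

/-- The operator of the first `t` rounds of a routed gate. -/
noncomputable def routeOp (g : CircuitGate n) : ℕ → Matrix (Fin n → Bool) (Fin n → Bool) ℂ
  | 0 => 1
  | t + 1 => roundOp n (routeGate g t) (n - 1) * routeOp g t

/-- The gate applied to the two qubits once they are neighbours. -/
def orderedUnitary (g : CircuitGate n) : TwoQubitUnitary :=
  if g.fst < g.snd then g.unitary else swapGate * g.unitary * swapGate

/-- After round `t` of a routed gate, the qubit that was moved for it is `t` positions on its way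
back. -/
theorem routeOp_succ (g : CircuitGate n) {p L : ℕ} (hp : p = min g.fst.val g.snd.val)
    (hL : p + L + 1 = max g.fst.val g.snd.val) (t : ℕ) :
    routeOp g (t + 1) = relabel (shift n p (L - t) * (shift n p L)⁻¹) *
      (bondOp n (p + L) (orderedUnitary g) * relabel (shift n p L)) := by
  have hn : p + L + 1 < n := hL ▸ max_lt g.fst.isLt g.snd.isLt
  induction t with
  | zero =>
    rw [Nat.sub_zero, mul_inv_cancel, relabel_one, Matrix.one_mul, routeOp, routeOp, Matrix.mul_one]
    have h0 : ∀ i < p, routeGate g 0 i = 1 := by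
      intro i hi
      simp only [routeGate, ← hp, ← hL, if_true]
      rw [if_neg (by omega), if_neg (by omega)]
    have h1 : ∀ i, p ≤ i → i < p + L → routeGate g 0 i = swapGate := by
      intro i hi hi'
      simp only [routeGate, ← hp, ← hL, if_true]
      rw [if_pos (by omega)]
    have h2 : routeGate g 0 (p + L) = orderedUnitary g := by
      simp only [routeGate, ← hp, ← hL, if_true]
      rw [if_neg (by omega)]
      rfl
    have h3 : ∀ i, p + L + 1 ≤ i → i < n - 1 → routeGate g 0 i = 1 := by
      intro i hi _
      simp only [routeGate, ← hp, ← hL, if_true]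
      rw [if_neg (by omega), if_neg (by omega)]
    rw [roundOp_of_one (by omega) h3, roundOp, h2, roundOp_shift h0 h1 L le_rfl]
  | succ t ih =>
    have key : roundOp n (routeGate g (t + 1)) (n - 1) * relabel (shift n p (L - t)) =
        relabel (shift n p (L - (t + 1))) := by
      have e : ∀ i, routeGate g (t + 1) i =
          if p ≤ i ∧ i + 1 + (t + 1) = p + L + 1 then swapGate else 1 := by
        intro i
        simp only [routeGate, ← hp, ← hL]
        rw [if_neg (by omega)]
      rcases Nat.lt_or_ge t L with ht | ht
      · obtain ⟨k, hk⟩ : ∃ k, L - t = k + 1 := ⟨L - t - 1, by omega⟩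
        have hk' : L - (t + 1) = k := by omega
        rw [roundOp_single (a := p + k) (by omega), e, if_pos (by omega), bondOp_swapGate,
          relabel_mul, hk, hk', shift, ← mul_assoc, bondSwap_mul_self, one_mul]
        intro i hi
        rw [e, if_neg (by omega)]
      · rw [roundOp_one, Matrix.one_mul, Nat.sub_eq_zero_of_le ht,
          Nat.sub_eq_zero_of_le (by omega)]
        intro i
        rw [e, if_neg (by omega)]
    rw [routeOp, ih, ← relabel_mul, ← relabel_mul, ← key]
    simp only [Matrix.mul_assoc]

theorem routeOp_all (g : CircuitGate n) : routeOp g n = g.matrix := by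
  have hne : g.fst.val ≠ g.snd.val := fun h => g.ne (Fin.ext h)
  obtain ⟨L, hL⟩ : ∃ L, min g.fst.val g.snd.val + L + 1 = max g.fst.val g.snd.val :=
    ⟨max g.fst.val g.snd.val - min g.fst.val g.snd.val - 1, by omega⟩
  obtain ⟨t, ht⟩ : ∃ t, n = t + 1 := ⟨n - 1, by have := g.fst.isLt; omega⟩
  have hn : min g.fst.val g.snd.val + L + 1 < n := hL ▸ max_lt g.fst.isLt g.snd.isLt
  have h := routeOp_succ g rfl hL t
  rw [← ht, Nat.sub_eq_zero_of_le (by omega), shift, one_mul, bondOp, dif_pos hn] at h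
  have h2 := gateOp_relabel (shift n (min g.fst.val g.snd.val) L)⁻¹
    ⟨min g.fst.val g.snd.val + L, by omega⟩ ⟨min g.fst.val g.snd.val + L + 1, hn⟩
    (orderedUnitary g)
  rw [inv_inv, Matrix.mul_assoc] at h2
  have e1 : (shift n (min g.fst.val g.snd.val) L)⁻¹ ⟨min g.fst.val g.snd.val + L, by omega⟩ =
      ⟨min g.fst.val g.snd.val, by omega⟩ := by
    rw [Equiv.Perm.inv_eq_iff_eq, shift_apply_self]
  have e2 : (shift n (min g.fst.val g.snd.val) L)⁻¹ ⟨min g.fst.val g.snd.val + L + 1, hn⟩ =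
      ⟨min g.fst.val g.snd.val + L + 1, hn⟩ := by
    rw [Equiv.Perm.inv_eq_iff_eq, shift_apply_of_lt]
    exact Nat.lt_succ_self _
  rw [h, h2, e1, e2, CircuitGate.matrix_eq, orderedUnitary]
  by_cases hlt : g.fst < g.snd
  · have hlt' : g.fst.val < g.snd.val := hlt
    rw [if_pos hlt]
    congr 1 <;> apply Fin.ext <;> simp only <;> omega
  · have hlt' : ¬ g.fst.val < g.snd.val := hlt
    rw [if_neg hlt, gateOp_swapGate_conj]
    congr 1 <;> apply Fin.ext <;> simp only <;> omega

end Routing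

section Compile

variable {n : ℕ}

theorem circuitMatrix_rounds_succ (Q : RoundCircuit n) (r : ℕ) :
    circuitMatrix ((List.range (r + 1)).flatMap Q.round) =
      roundOp n (Q.gate r) (n - 1) * circuitMatrix ((List.range r).flatMap Q.round) := by
  rw [List.range_succ, List.flatMap_append, List.flatMap_singleton, circuitMatrix_append,
    circuitMatrix_round]

theorem circuitMatrix_compile_take (hn : 1 ≤ n) (C : Circuit n) (M : ℕ) : ∀ l ≤ C.length,
    circuitMatrix ((List.range (n * l + 1)).flatMap (compile C M).round) =
      circuitMatrix (C.take l) := by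
  intro l
  induction l with
  | zero =>
    intro _
    have h : ∀ i, (compile C M).gate 0 i = 1 := fun i => by simp [compile]
    rw [Nat.mul_zero, circuitMatrix_rounds_succ, roundOp_one _ h, Matrix.one_mul]
    rfl
  | succ l ih =>
    intro hl
    have hl' : l < C.length := hl
    have step : ∀ t ≤ n, circuitMatrix ((List.range (n * l + 1 + t)).flatMap (compile C M).round) =
        routeOp C[l] t * circuitMatrix (C.take l) := by
      intro t
      induction t with
      | zero => intro _; rw [add_zero, ih (by omega), routeOp, Matrix.one_mul]
      | succ t iht =>
        intro ht
        rw [← add_assoc, circuitMatrix_rounds_succ, iht (by omega), routeOp, Matrix.mul_assoc]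
        congr 2
        funext i
        have e1 : (n * l + 1 + t - 1) / n = l := by
          rw [show n * l + 1 + t - 1 = n * l + t by omega, Nat.mul_add_div hn,
            Nat.div_eq_of_lt ht, add_zero]
        have e2 : (n * l + 1 + t - 1) % n = t := by
          rw [show n * l + 1 + t - 1 = n * l + t by omega, Nat.mul_add_mod, Nat.mod_eq_of_lt ht]
        simp only [compile, e1, e2, List.getElem?_eq_getElem hl']
        rw [if_neg (by omega)]
    rw [show n * (l + 1) + 1 = n * l + 1 + n by ring, step n le_rfl, routeOp_all,
      List.take_add_one, List.getElem?_eq_getElem hl', Option.toList_some, circuitMatrix_append,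
      circuitMatrix_singleton]

theorem compile_gate_of_le (hn : 1 ≤ n) (C : Circuit n) (M : ℕ) {r : ℕ}
    (hr : n * C.length + 1 ≤ r) (i : ℕ) : (compile C M).gate r i = 1 := by
  have e : C[(r - 1) / n]? = none := by
    rw [List.getElem?_eq_none_iff, Nat.le_div_iff_mul_le hn, Nat.mul_comm]
    omega
  simp only [compile, e]
  rw [if_neg (by omega)]

/-- The identity rounds at the end of the compiled circuit do not change the result. -/
theorem circuitMatrix_compile_rounds (hn : 1 ≤ n) (C : Circuit n) (M : ℕ) (j : ℕ) :
    circuitMatrix ((List.range (n * C.length + 1 + j)).flatMap (compile C M).round) =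
      circuitMatrix C := by
  induction j with
  | zero => rw [add_zero, circuitMatrix_compile_take hn C M _ le_rfl, List.take_length]
  | succ j ih =>
    rw [← add_assoc, circuitMatrix_rounds_succ, ih,
      roundOp_one _ (compile_gate_of_le hn C M (by omega)), Matrix.one_mul]

theorem circuitMatrix_compile (hn : 1 ≤ n) (C : Circuit n) (M : ℕ) :
    circuitMatrix (compile C M).toCircuit = circuitMatrix C := by
  have h := circuitMatrix_compile_rounds hn C M (M + 1)
  rw [show n * C.length + 1 + (M + 1) = (compile C M).rounds by simp only [compile]; omega] at h
  exact h

theorem compile_gate (C : Circuit n) (M r i : ℕ) : (compile C M).gate r i = 1 ∨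
    (compile C M).gate r i = swapGate ∨
    ∃ g ∈ C, (compile C M).gate r i = g.unitary ∨
      (compile C M).gate r i = swapGate * g.unitary * swapGate := by
  simp only [compile]
  split_ifs
  · exact Or.inl rfl
  · split
    · next g hg =>
      simp only [routeGate]
      split_ifs
      · exact Or.inr (Or.inl rfl)
      · exact Or.inr (Or.inr ⟨g, List.mem_of_getElem? hg, Or.inl rfl⟩)
      · exact Or.inr (Or.inr ⟨g, List.mem_of_getElem? hg, Or.inr rfl⟩)
      · exact Or.inl rfl
      · exact Or.inr (Or.inl rfl)
      · exact Or.inl rfl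
    · exact Or.inl rfl

end Compile

/-! ### Reading the data of a configuration -/

section Reading

theorem filterMap_range_none {f : ℕ → Option Bool} {a m : ℕ} (h : ∀ i < m, f (a + i) = none) :
    ((List.range m).map (a + ·)).filterMap f = [] := by
  rw [List.filterMap_eq_nil_iff]
  intro k hk
  obtain ⟨i, hi, rfl⟩ := List.mem_map.1 hk
  exact h i (List.mem_range.1 hi)

theorem filterMap_range_some {f : ℕ → Option Bool} {g : ℕ → Bool} {a m : ℕ}
    (h : ∀ i < m, f (a + i) = some (g i)) :
    ((List.range m).map (a + ·)).filterMap f = (List.range m).map g := by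
  rw [List.filterMap_map, ← List.filterMap_eq_map]
  exact List.filterMap_congr fun i hi => h i (List.mem_range.1 hi)

variable {n : ℕ}

theorem filterMap_site {N s o : ℕ} (d : ℕ → Bool) (h : s + n < N ∨ o < n ∧ s + n ≤ N) :
    (List.range N).filterMap (fun k => (site n s o d k).bit) = (List.range n).map d := by
  rcases Nat.lt_or_ge o n with ho | ho
  · obtain ⟨r, rfl⟩ : ∃ r, N = s + (n + r) := ⟨N - s - n, by omega⟩
    rw [List.range_add, List.range_add, List.filterMap_append, List.map_append,
      List.filterMap_append, List.map_map,
      show List.range s = (List.range s).map (0 + ·) by simp, filterMap_range_none,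
      filterMap_range_some (g := d),
      show ((fun x => s + x) ∘ fun x => n + x) = ((s + n) + ·) by funext i; simp [add_assoc],
      filterMap_range_none, List.nil_append, List.append_nil]
    · intro i _
      rw [site_blank ho (by omega)]; rfl
    · intro i hi
      by_cases hio : i = o
      · rw [hio, site_active ho]; split_ifs <;> rfl
      · rw [site_qubit ho hi hio]; rfl
    · intro i hi
      rw [site_blank ho (by omega)]; rfl
  · obtain ⟨a, ha⟩ : ∃ a, min n (2 * n + 1 - o) = a := ⟨_, rfl⟩
    obtain ⟨b, rfl⟩ : ∃ b, n = a + b := ⟨n - a, by omega⟩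
    obtain ⟨r, rfl⟩ : ∃ r, N = s + (a + (1 + (b + r))) := ⟨N - s - a - 1 - b, by omega⟩
    rw [List.range_add, List.range_add, List.range_add, List.range_add]
    simp only [List.filterMap_append, List.map_append, List.map_map]
    rw [show List.range s = (List.range s).map (0 + ·) by simp, filterMap_range_none,
      filterMap_range_some (g := d),
      show ((fun x => s + x) ∘ fun x => a + x) = ((s + a) + ·) by funext i; simp [add_assoc],
      filterMap_range_none,
      show ((fun x => s + x) ∘ (fun x => a + x) ∘ fun x => 1 + x) = ((s + a + 1) + ·) by
        funext i; simp [add_assoc],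
      filterMap_range_some (g := fun i => d (a + i)),
      show ((fun x => s + x) ∘ (fun x => a + x) ∘ (fun x => 1 + x) ∘ fun x => b + x) =
        ((s + a + 1 + b) + ·) by funext i; simp [add_assoc],
      filterMap_range_none, List.nil_append, List.append_nil, List.nil_append, List.range_add,
      List.map_append, List.map_map]
    · rfl
    · intro i _
      rw [site_blank' ho (by omega)]; rfl
    · intro i hi
      have := site_qubit_right (s := s) (d := d) ho (i := a + i) (by omega) (by omega)
      rw [show s + a + 1 + i = s + (a + i) + 1 by ring, this]; rfl
    · intro i hi
      obtain rfl : i = 0 := by omega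
      rw [add_zero, site, if_neg (by omega), if_neg (by omega), ha, if_pos rfl]
      split_ifs <;> rfl
    · intro i hi
      rw [site_qubit_left ho (by omega)]; rfl
    · intro i hi
      rw [site_blank' ho (by omega)]; rfl

theorem map_bits (x : Fin n → Bool) : (List.range n).map (bits x) = List.ofFn x := by
  refine List.ext_getElem (by simp) fun i h1 h2 => ?_
  simp only [List.length_map, List.length_range] at h1
  simp [bits, h1]

/-- The data of a configuration are read correctly at all times. -/
theorem readBits_config (Q : RoundCircuit n) {s o : ℕ}
    (h : s + n < Q.size ∨ o < n ∧ s + n ≤ Q.size) (x : Fin n → Bool) :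
    readBits (config Q s o x) = List.ofFn x := by
  have e : List.ofFn (config Q s o x) = (List.range Q.size).map (site n s o (bits x)) :=
    List.ext_getElem (by simp) fun i h1 h2 => by simp [config]
  rw [readBits, e, List.filterMap_map, ← map_bits x, ← filterMap_site (bits x) h]
  rfl

theorem site_start_ne_blank {s o : ℕ} (hn : 1 ≤ n) (d : ℕ → Bool) : site n s o d s ≠ .blank := by
  unfold site; split_ifs <;> first | omega | simp

theorem site_before_start {s o k : ℕ} (h : k < s) (d : ℕ → Bool) : site n s o d k = .blank := by
  unfold site; split_ifs <;> first | rfl | omega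

/-- Configurations of the same phase with different offsets differ at the active particle. -/
theorem site_ne_of_offset_ne {s o o' : ℕ} (hn : 1 ≤ n) (ho : o ≤ 2 * n + 2) (ho' : o' ≤ 2 * n + 2)
    (hne : o ≠ o') (d d' : ℕ → Bool) :
    site n s o d (if o < n then s + o else s + min n (2 * n + 1 - o)) ≠
      site n s o' d' (if o < n then s + o else s + min n (2 * n + 1 - o)) := by
  unfold site
  split_ifs <;> first | omega | simp

theorem config_phase_injective (Q : RoundCircuit n) (hn : 1 ≤ n) {s o s' o' : ℕ}
    (h : s + n < Q.size ∨ o < n ∧ s + n ≤ Q.size) (h' : s' + n < Q.size ∨ o' < n ∧ s' + n ≤ Q.size)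
    (ho : o ≤ 2 * n + 2) (ho' : o' ≤ 2 * n + 2) {x x' : Fin n → Bool}
    (hc : config Q s o x = config Q s' o' x') : s = s' ∧ o = o' := by
  have hsite : ∀ k, k < Q.size → site n s o (bits x) k = site n s' o' (bits x') k :=
    fun k hk => congrFun hc ⟨k, hk⟩
  have hs : s = s' := by
    rcases lt_trichotomy s s' with h1 | h1 | h1
    · have := hsite s (by omega)
      rw [site_before_start h1] at this
      exact absurd this (site_start_ne_blank hn _)
    · exact h1
    · have := hsite s' (by omega)
      rw [site_before_start h1] at this
      exact absurd this.symm (site_start_ne_blank hn _)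
  subst hs
  refine ⟨rfl, ?_⟩
  by_contra hne
  refine site_ne_of_offset_ne hn ho ho' hne _ _ (hsite _ ?_)
  split_ifs <;> omega

end Reading

/-! ### The measured distribution of the history state -/

section Distribution

variable {n : ℕ}

theorem sum_norm_sq_of_injective {N : ℕ} {ι : Type*} [Fintype ι] (c : ι → Config N)
    (hc : Function.Injective c) (a : ι → ℂ) (p : Config N → Prop) [DecidablePred p] :
    ∑ v, (if p v then ‖(∑ i, a i • ket (c i) : Chain N) v‖ ^ 2 else 0) =
      ∑ i, if p (c i) then ‖a i‖ ^ 2 else 0 := by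
  have e : ∀ v, (∑ i, a i • ket (c i) : Chain N) v = ∑ i, if v = c i then a i else 0 := by
    intro v
    rw [WithLp.ofLp_sum, Finset.sum_apply]
    simp [ket_apply]
  symm
  refine Fintype.sum_of_injective c hc _ _ (fun v hv => ?_) fun i => ?_
  · rw [e, Finset.sum_eq_zero fun i _ => if_neg fun h => hv ⟨i, h.symm⟩]
    simp
  · rw [e, Finset.sum_eq_single i (fun j _ hj => if_neg fun h => hj (hc h).symm)
      fun h => absurd (Finset.mem_univ _) h, if_pos rfl]

/-- The circuit applied in the first `t` steps of the chain. -/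
def timeCircuit (Q : RoundCircuit n) (t : ℕ) : Circuit n :=
  prefixCircuit Q (t / (2 * n + 3)) (t % (2 * n + 3))

/-- The configuration with data `x` after `t` steps. -/
def timeConfig (Q : RoundCircuit n) (t : ℕ) (x : Fin n → Bool) : Config Q.size :=
  config Q (t / (2 * n + 3)) (t % (2 * n + 3)) x

theorem timeState_eq_sum (Q : RoundCircuit n) (t : ℕ) :
    timeState Q t = ∑ x, outputAmplitude (timeCircuit Q t) x • ket (timeConfig Q t x) := rfl

variable (Q : RoundCircuit n)

theorem fits_of_le_steps {t : ℕ} (ht : t ≤ Q.steps) (hn : 1 ≤ n) (hR : 1 ≤ Q.rounds) :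
    t / (2 * n + 3) + n < Q.size ∨ t % (2 * n + 3) < n ∧ t / (2 * n + 3) + n ≤ Q.size := by
  have hN := size_eq Q hR
  rw [← Nat.div_add_mod t (2 * n + 3)] at ht
  rcases phase_of_le_steps Q hn ht with h | ⟨h1, h2⟩ <;> omega

theorem readBits_timeConfig {t : ℕ} (ht : t ≤ Q.steps) (hn : 1 ≤ n) (hR : 1 ≤ Q.rounds)
    (x : Fin n → Bool) : readBits (timeConfig Q t x) = List.ofFn x :=
  readBits_config Q (fits_of_le_steps Q ht hn hR) x

theorem timeConfig_injective (hn : 1 ≤ n) (hR : 1 ≤ Q.rounds) :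
    Function.Injective fun p : Fin (Q.steps + 1) × (Fin n → Bool) => timeConfig Q p.1 p.2 := by
  rintro ⟨t, x⟩ ⟨t', x'⟩ h
  simp only at h
  have ht := Nat.lt_succ_iff.1 t.isLt
  have ht' := Nat.lt_succ_iff.1 t'.isLt
  have hx : x = x' := by
    have := readBits_timeConfig Q ht hn hR x
    rw [h, readBits_timeConfig Q ht' hn hR x'] at this
    exact (List.ofFn_injective this).symm
  have hm : ∀ k : ℕ, k % (2 * n + 3) ≤ 2 * n + 2 := fun k =>
    Nat.lt_succ_iff.1 (Nat.mod_lt _ (by omega))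
  obtain ⟨h1, h2⟩ := config_phase_injective Q hn (fits_of_le_steps Q ht hn hR)
    (fits_of_le_steps Q ht' hn hR) (hm _) (hm _) h
  have h3 : t.val = t'.val := by
    rw [← Nat.div_add_mod t.val (2 * n + 3), ← Nat.div_add_mod t'.val (2 * n + 3), h1, h2]
  exact Prod.ext (Fin.ext h3) hx

theorem sum_circuitDistribution {t : ℕ} (ht : t ≤ Q.steps) (hn : 1 ≤ n) (hR : 1 ≤ Q.rounds) :
    ∑ x, circuitDistribution (timeCircuit Q t) x = 1 := by
  have h1 : ‖timeState Q t‖ = 1 := by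
    rw [← gammaState_eq Q hn hR t ht]
    exact (orthonormal_gammaState Q hn hR).norm_eq_one ⟨t, Nat.lt_succ_iff.2 ht⟩
  have hinj : Function.Injective (timeConfig Q t) := fun x x' h =>
    congrArg Prod.snd (timeConfig_injective Q hn hR
      (a₁ := (⟨t, Nat.lt_succ_iff.2 ht⟩, x)) (a₂ := (⟨t, Nat.lt_succ_iff.2 ht⟩, x')) h)
  have h2 := sum_norm_sq_of_injective (timeConfig Q t) hinj (outputAmplitude (timeCircuit Q t))
    fun _ => True
  simp only [if_true] at h2
  rw [← timeState_eq_sum, ← EuclideanSpace.norm_sq_eq, h1, one_pow] at h2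
  exact h2.symm

theorem measuredDistribution_historyState (hn : 1 ≤ n) (hR : 1 ≤ Q.rounds) (y : Fin n → Bool) :
    measuredDistribution (historyState Q) y =
      (1 / ((Q.steps : ℝ) + 1)) *
        ∑ t : Fin (Q.steps + 1), circuitDistribution (timeCircuit Q t) y := by
  set r : ℝ := 1 / Real.sqrt ((Q.steps : ℝ) + 1) with hr
  have hr2 : r ^ 2 = 1 / ((Q.steps : ℝ) + 1) := by
    rw [hr, div_pow, one_pow, Real.sq_sqrt (by positivity)]
  have e : historyState Q = ∑ p : Fin (Q.steps + 1) × (Fin n → Bool),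
      ((r : ℂ) * outputAmplitude (timeCircuit Q p.1) p.2) • ket (timeConfig Q p.1 p.2) := by
    rw [historyState, Fintype.sum_prod_type, Finset.smul_sum]
    refine Finset.sum_congr rfl fun t _ => ?_
    rw [gammaState_eq Q hn hR t (Nat.lt_succ_iff.1 t.isLt), timeState_eq_sum, Finset.smul_sum]
    simp only [smul_smul]
    rfl
  rw [measuredDistribution, e,
    sum_norm_sq_of_injective _ (timeConfig_injective Q hn hR) _ fun v => readBits v = List.ofFn y,
    Fintype.sum_prod_type, Finset.mul_sum]
  refine Finset.sum_congr rfl fun t _ => ?_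
  rw [Finset.sum_eq_single y]
  · rw [if_pos (readBits_timeConfig Q (Nat.lt_succ_iff.1 t.isLt) hn hR y), norm_mul, mul_pow,
      Complex.norm_real, Real.norm_eq_abs, sq_abs, hr2]
    rfl
  · intro x _ hx
    refine if_neg fun h => hx ?_
    rw [readBits_timeConfig Q (Nat.lt_succ_iff.1 t.isLt) hn hR x] at h
    exact List.ofFn_injective h
  · exact fun h => absurd (Finset.mem_univ _) h

end Distribution

/-! ### Total variation -/

section TotalVariation

theorem totalVariation_triangle {α : Type} [Fintype α] (P P' P'' : α → ℝ) :
    totalVariation P P'' ≤ totalVariation P P' + totalVariation P' P'' := by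
  rw [totalVariation, totalVariation, totalVariation, ← mul_add, ← Finset.sum_add_distrib]
  exact mul_le_mul_of_nonneg_left (Finset.sum_le_sum fun x _ => abs_sub_le _ _ _) (by norm_num)

theorem totalVariation_le_one {α : Type} [Fintype α] {P P' : α → ℝ} (h : ∀ x, 0 ≤ P x)
    (h' : ∀ x, 0 ≤ P' x) (hP : ∑ x, P x = 1) (hP' : ∑ x, P' x = 1) : totalVariation P P' ≤ 1 := by
  have : ∑ x, |P x - P' x| ≤ ∑ x, (P x + P' x) := Finset.sum_le_sum fun x _ => by
    rw [abs_le]; constructor <;> linarith [h x, h' x]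
  rw [Finset.sum_add_distrib, hP, hP'] at this
  rw [totalVariation]
  linarith

/-- Total variation is convex: the distance of an average from `P'` is at most the average
distance. -/
theorem totalVariation_average {α : Type} [Fintype α] {K : ℕ} (P : Fin (K + 1) → α → ℝ)
    (P' : α → ℝ) :
    totalVariation (fun x => (1 / ((K : ℝ) + 1)) * ∑ t, P t x) P' ≤
      (1 / ((K : ℝ) + 1)) * ∑ t, totalVariation (P t) P' := by
  have hK : (0 : ℝ) < (K : ℝ) + 1 := by positivity
  have h1 : ∀ x, |(1 / ((K : ℝ) + 1)) * ∑ t, P t x - P' x| ≤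
      (1 / ((K : ℝ) + 1)) * ∑ t, |P t x - P' x| := by
    intro x
    have : (1 / ((K : ℝ) + 1)) * ∑ t, P t x - P' x =
        (1 / ((K : ℝ) + 1)) * ∑ t, (P t x - P' x) := by
      rw [Finset.sum_sub_distrib, Finset.sum_const, Finset.card_univ, Fintype.card_fin,
        nsmul_eq_mul]
      push_cast
      field_simp
    rw [this, abs_mul, abs_of_pos (by positivity)]
    exact mul_le_mul_of_nonneg_left (Finset.abs_sum_le_sum_abs _ _) (by positivity)
  calc totalVariation (fun x => (1 / ((K : ℝ) + 1)) * ∑ t, P t x) P'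
      ≤ (1 / 2) * ∑ x, (1 / ((K : ℝ) + 1)) * ∑ t, |P t x - P' x| :=
        mul_le_mul_of_nonneg_left (Finset.sum_le_sum fun x _ => h1 x) (by norm_num)
    _ = (1 / ((K : ℝ) + 1)) * ∑ t, totalVariation (P t) P' := by
        simp only [totalVariation]
        rw [← Finset.mul_sum, ← Finset.mul_sum, Finset.sum_comm]
        ring

theorem sum_norm_mul_norm_le {N : ℕ} (φ ψ : Chain N) : ∑ v, ‖φ v‖ * ‖ψ v‖ ≤ ‖φ‖ * ‖ψ‖ := by
  rw [EuclideanSpace.norm_eq, EuclideanSpace.norm_eq]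
  exact Real.sum_mul_le_sqrt_mul_sqrt _ _ _

theorem totalVariation_measuredDistribution_le {N n : ℕ} (φ ψ : Chain N) :
    totalVariation (measuredDistribution (n := n) φ) (measuredDistribution ψ) ≤
      1 / 2 * (‖φ - ψ‖ * (‖φ‖ + ‖ψ‖)) := by
  have h1 : ∀ x : Fin n → Bool, |measuredDistribution φ x - measuredDistribution ψ x| ≤
      ∑ v, if readBits v = List.ofFn x then |‖φ v‖ ^ 2 - ‖ψ v‖ ^ 2| else 0 := by
    intro x
    rw [measuredDistribution, measuredDistribution, ← Finset.sum_sub_distrib]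
    refine (Finset.abs_sum_le_sum_abs _ _).trans (Finset.sum_le_sum fun v _ => ?_)
    split_ifs <;> simp
  have h2 : ∀ v : Config N, ∑ x : Fin n → Bool,
      (if readBits v = List.ofFn x then |‖φ v‖ ^ 2 - ‖ψ v‖ ^ 2| else 0) ≤
        |‖φ v‖ ^ 2 - ‖ψ v‖ ^ 2| := by
    intro v
    by_cases hv : ∃ x : Fin n → Bool, readBits v = List.ofFn x
    · obtain ⟨x, hx⟩ := hv
      rw [Finset.sum_eq_single x]
      · rw [if_pos hx]
      · exact fun y _ hy => if_neg fun h => hy (List.ofFn_injective (h.symm.trans hx))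
      · exact fun h => absurd (Finset.mem_univ _) h
    · rw [Finset.sum_eq_zero fun x _ => if_neg fun h => hv ⟨x, h⟩]
      exact abs_nonneg _
  have h3 : ∀ v : Config N, |‖φ v‖ ^ 2 - ‖ψ v‖ ^ 2| ≤
      ‖(φ - ψ) v‖ * ‖φ v‖ + ‖(φ - ψ) v‖ * ‖ψ v‖ := by
    intro v
    rw [← mul_add, sq_sub_sq, abs_mul, abs_of_nonneg (by positivity), mul_comm]
    exact mul_le_mul_of_nonneg_right (abs_norm_sub_norm_le _ _) (by positivity)
  rw [totalVariation]
  refine mul_le_mul_of_nonneg_left ?_ (by norm_num)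
  calc ∑ x : Fin n → Bool, |measuredDistribution φ x - measuredDistribution ψ x|
      ≤ ∑ x : Fin n → Bool, ∑ v,
          if readBits v = List.ofFn x then |‖φ v‖ ^ 2 - ‖ψ v‖ ^ 2| else 0 :=
        Finset.sum_le_sum fun x _ => h1 x
    _ = ∑ v, ∑ x : Fin n → Bool,
          if readBits v = List.ofFn x then |‖φ v‖ ^ 2 - ‖ψ v‖ ^ 2| else 0 := Finset.sum_comm
    _ ≤ ∑ v, (‖(φ - ψ) v‖ * ‖φ v‖ + ‖(φ - ψ) v‖ * ‖ψ v‖) :=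
        Finset.sum_le_sum fun v _ => (h2 v).trans (h3 v)
    _ ≤ ‖φ - ψ‖ * (‖φ‖ + ‖ψ‖) := by
        rw [Finset.sum_add_distrib, mul_add]
        exact add_le_add (sum_norm_mul_norm_le _ _) (sum_norm_mul_norm_le _ _)

theorem measuredDistribution_smul {N n : ℕ} {z : ℂ} (hz : ‖z‖ = 1) (ψ : Chain N)
    (x : Fin n → Bool) : measuredDistribution (z • ψ) x = measuredDistribution ψ x := by
  simp [measuredDistribution, hz]

end TotalVariation

/-! ### The output of a compiled circuit -/

section Output

variable {n : ℕ}

theorem rounds_compile (C : Circuit n) (M : ℕ) :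
    (compile C M).rounds = n * C.length + M + 2 := rfl

/-- From phase `n * (n * L + 1)` on, the data are the output of the circuit. -/
theorem circuitMatrix_timeCircuit_compile (hn : 1 ≤ n) (C : Circuit n) (M : ℕ) {t : ℕ}
    (ht : (2 * n + 3) * (n * (n * C.length + 1)) ≤ t) :
    circuitMatrix (timeCircuit (compile C M) t) = circuitMatrix C := by
  have h1 : n * C.length + 1 ≤ t / (2 * n + 3) / n := by
    rw [Nat.le_div_iff_mul_le hn, Nat.le_div_iff_mul_le (by omega)]
    refine le_trans (le_of_eq ?_) ht
    ring
  obtain ⟨j, hj⟩ := Nat.exists_eq_add_of_le h1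
  rw [timeCircuit, prefixCircuit, circuitMatrix_append, hj, circuitMatrix_compile_rounds hn, ← hj]
  have h2 : ∀ m, circuitMatrix (((compile C M).round (t / (2 * n + 3) / n)).take m) = 1 := by
    intro m
    rcases Nat.le_total m (n - 1) with hm | hm
    · rw [circuitMatrix_take_round _ _ _ hm, roundOp_one _ (compile_gate_of_le hn C M h1)]
    · rw [take_round _ (by omega), circuitMatrix_round,
        roundOp_one _ (compile_gate_of_le hn C M h1)]
  rw [h2, Matrix.one_mul]

/-- The history state of a compiled circuit is measured before the end of the computation with
probability at most `(n * L + 1) / (n * L + M + 1)`. -/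
theorem totalVariation_historyState (hn : 1 ≤ n) (C : Circuit n) (M : ℕ) :
    totalVariation (measuredDistribution (n := n) (historyState (compile C M)))
      (circuitDistribution C) ≤
        ((n * C.length + 1 : ℕ) : ℝ) / ((n * C.length + 1 + M : ℕ) : ℝ) := by
  set Q := compile C M with hQ
  have hR : 1 ≤ Q.rounds := by rw [hQ, rounds_compile]; omega
  set a := n * C.length + 1 with ha
  set t₀ := (2 * n + 3) * (n * a) with ht₀
  have hst : Q.steps = (2 * n + 3) * (n * (a + M)) + (n - 1) := by
    rw [steps_eq Q hn, hQ, rounds_compile]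
    congr 3
    omega
  have hout : ∀ t, t₀ ≤ t → circuitDistribution (timeCircuit Q t) = circuitDistribution C := by
    intro t ht
    funext x
    rw [circuitDistribution, circuitDistribution, outputAmplitude, outputAmplitude,
      circuitMatrix_timeCircuit_compile hn C M ht]
  have hle : t₀ ≤ Q.steps := by
    rw [hst, ht₀]
    exact le_trans (Nat.mul_le_mul_left _ (Nat.mul_le_mul_left _ (Nat.le_add_right _ _)))
      (Nat.le_add_right _ _)
  have hC : ∑ x, circuitDistribution C x = 1 := by
    rw [← hout _ hle]; exact sum_circuitDistribution Q le_rfl hn hR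
  have htv : ∀ t : Fin (Q.steps + 1),
      totalVariation (circuitDistribution (timeCircuit Q t)) (circuitDistribution C) ≤
        if t.val < t₀ then 1 else 0 := by
    intro t
    split_ifs with h
    · exact totalVariation_le_one (fun x => sq_nonneg _) (fun x => sq_nonneg _)
        (sum_circuitDistribution Q (Nat.lt_succ_iff.1 t.isLt) hn hR) hC
    · rw [hout t (by omega)]
      simp [totalVariation]
  have hcount : ∑ t : Fin (Q.steps + 1), (if t.val < t₀ then (1 : ℝ) else 0) = t₀ := by
    rw [Fin.sum_univ_eq_sum_range (fun t => if t < t₀ then (1 : ℝ) else 0), Finset.sum_boole]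
    congr 1
    rw [show (Finset.range (Q.steps + 1)).filter (· < t₀) = Finset.range t₀ by
      ext k; simp only [Finset.mem_filter, Finset.mem_range]; omega, Finset.card_range]
  have h1 : totalVariation (measuredDistribution (n := n) (historyState Q))
      (circuitDistribution C) ≤ (1 / ((Q.steps : ℝ) + 1)) * t₀ := by
    rw [← hcount]
    have := totalVariation_average
      (fun t : Fin (Q.steps + 1) => circuitDistribution (timeCircuit Q t)) (circuitDistribution C)
    simp only [← measuredDistribution_historyState Q hn hR] at this
    exact this.trans (mul_le_mul_of_nonneg_left (Finset.sum_le_sum fun t _ => htv t)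
      (by positivity))
  refine h1.trans ?_
  have ha0 : (0 : ℝ) < ((a + M : ℕ) : ℝ) := by exact_mod_cast (by omega : 0 < a + M)
  rw [one_div_mul_eq_div, div_le_div_iff₀ (by positivity) ha0]
  have h2 : t₀ * (a + M) ≤ a * (Q.steps + 1) := by
    rw [hst, ht₀]
    calc (2 * n + 3) * (n * a) * (a + M) = a * ((2 * n + 3) * (n * (a + M))) := by ring
      _ ≤ _ := Nat.mul_le_mul_left _ (by omega)
  exact_mod_cast h2

theorem norm_historyState (Q : RoundCircuit n) (hn : 1 ≤ n) (hR : 1 ≤ Q.rounds) :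
    ‖historyState Q‖ = 1 := by
  rw [← historyEmbedding_uniformClock Q hn hR, LinearIsometry.norm_map, norm_uniformClock]

/-- A final state close to the history state yields the output of the circuit. -/
theorem totalVariation_le_of_near (hn : 1 ≤ n) (C : Circuit n) {ε : ℝ} (hε : 0 < ε) (hε1 : ε ≤ 1)
    {M : ℕ} (hM : 2 * ((n : ℝ) * C.length + 1) / ε ≤ M) {ψ : Chain (compile C M).size} {z : ℂ}
    (hz : ‖z‖ = 1) (h : ‖ψ - z • historyState (compile C M)‖ ≤ ε / 4) :
    totalVariation (measuredDistribution (n := n) ψ) (circuitDistribution C) ≤ ε := by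
  have hR : 1 ≤ (compile C M).rounds := by rw [rounds_compile]; omega
  have hη : ‖z • historyState (compile C M)‖ = 1 := by
    rw [norm_smul, hz, norm_historyState _ hn hR, one_mul]
  have h1 : ‖ψ‖ ≤ 1 + ε / 4 := by
    have := norm_le_norm_add_norm_sub' ψ (z • historyState (compile C M))
    linarith
  have h2 := totalVariation_measuredDistribution_le (n := n) ψ (z • historyState (compile C M))
  rw [show measuredDistribution (n := n) (z • historyState (compile C M)) =
    measuredDistribution (historyState (compile C M)) from
      funext fun x => measuredDistribution_smul hz _ x, hη] at h2
  have h3 := totalVariation_historyState hn C M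
  have h4 : ((n * C.length + 1 : ℕ) : ℝ) / ((n * C.length + 1 + M : ℕ) : ℝ) ≤ ε / 2 := by
    rw [div_le_iff₀ hε] at hM
    rw [div_le_div_iff₀ (by positivity) (by norm_num)]
    push_cast
    have : 0 ≤ ε * ((n : ℝ) * C.length + 1) := by positivity
    nlinarith
  have h5 : ‖ψ - z • historyState (compile C M)‖ * (‖ψ‖ + 1) ≤ ε / 4 * (2 + ε / 4) :=
    mul_le_mul h (by linarith) (by positivity) (by linarith)
  have h6 := totalVariation_triangle (measuredDistribution (n := n) ψ)
    (measuredDistribution (historyState (compile C M))) (circuitDistribution C)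
  nlinarith

/-! ### Polynomial bounds -/

/-- The number of particles and the number `K + 1` of times of the compiled circuit are polynomial
in `(n + L) / ε`. -/
theorem polynomial_bounds {L : ℕ} (hn : 1 ≤ n) {ε : ℝ} (hε : 0 < ε) (hε1 : ε ≤ 1) {M : ℕ}
    (hM : (M : ℝ) ≤ 2 * ((n : ℝ) * L + 1) / ε + 1) :
    1 ≤ ((n : ℝ) + L) / ε ∧
    ((n * (n * L + M + 2) : ℕ) : ℝ) ≤ 8 * (((n : ℝ) + L) / ε) ^ 4 ∧
    ((n * (2 * n + 3) * (n * L + M + 1) + n : ℕ) : ℝ) ≤ 40 * (((n : ℝ) + L) / ε) ^ 5 := by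
  set y : ℝ := ((n : ℝ) + L) / ε with hy
  have hn1 : (1 : ℝ) ≤ n := by exact_mod_cast hn
  have hL0 : (0 : ℝ) ≤ L := Nat.cast_nonneg L
  have hsum : (n : ℝ) + L ≤ y := by
    rw [hy, le_div_iff₀ hε]
    nlinarith
  have hinv : 1 / ε ≤ y := div_le_div_of_nonneg_right (by linarith) hε.le
  have hy1 : 1 ≤ y := by linarith
  have hy0 : 0 ≤ y := by linarith
  have hny : (n : ℝ) ≤ y := by linarith
  have hLy : (L : ℝ) ≤ y := by linarith
  have hnL : (n : ℝ) * L ≤ y ^ 2 := by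
    rw [pow_two]; exact mul_le_mul hny hLy hL0 hy0
  have hy2 : 1 ≤ y ^ 2 := one_le_pow₀ hy1
  have hy23 : y ^ 2 ≤ y ^ 3 := pow_le_pow_right₀ hy1 (by norm_num)
  have hM' : (M : ℝ) ≤ 4 * y ^ 3 + 1 := by
    have h1 : 2 * ((n : ℝ) * L + 1) / ε = 2 * ((n : ℝ) * L + 1) * (1 / ε) := by ring
    have h2 : 2 * ((n : ℝ) * L + 1) * (1 / ε) ≤ (4 * y ^ 2) * y :=
      mul_le_mul (by linarith) hinv (by positivity) (by positivity)
    calc (M : ℝ) ≤ _ := hM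
      _ ≤ (4 * y ^ 2) * y + 1 := by linarith
      _ = 4 * y ^ 3 + 1 := by ring
  have hR : (n : ℝ) * L + M + 2 ≤ 8 * y ^ 3 := by linarith
  refine ⟨hy1, ?_, ?_⟩
  · push_cast
    calc (n : ℝ) * (n * L + M + 2) ≤ y * (8 * y ^ 3) :=
          mul_le_mul hny hR (by positivity) hy0
      _ = 8 * y ^ 4 := by ring
  · push_cast
    have h1 : (n : ℝ) * (2 * n + 3) ≤ y * (5 * y) :=
      mul_le_mul hny (by linarith) (by positivity) hy0
    have h2 : (n : ℝ) ≤ n * (2 * n + 3) := by nlinarith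
    calc (n : ℝ) * (2 * n + 3) * (n * L + M + 1) + n
        ≤ (n : ℝ) * (2 * n + 3) * (n * L + M + 2) := by linarith
      _ ≤ (y * (5 * y)) * (8 * y ^ 3) := mul_le_mul h1 hR (by positivity) (by positivity)
      _ = 40 * y ^ 5 := by ring

theorem steps_add_one (Q : RoundCircuit n) (hn : 1 ≤ n) :
    Q.steps + 1 = n * (2 * n + 3) * (Q.rounds - 1) + n := by
  rw [RoundCircuit.steps]; omega

/-- The adiabatic evolution of the chain of the compiled circuit simulates the circuit in polynomial
time. -/
theorem simulation (hn : 1 ≤ n) (C : Circuit n) {ε : ℝ} (hε : 0 < ε) (hε1 : ε ≤ 1)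
    {Q : RoundCircuit n} (hQ : Q = compile C ⌈2 * ((n : ℝ) * C.length + 1) / ε⌉₊) :
    (Q.size : ℝ) ≤ 8 * (((n : ℝ) + C.length) / ε) ^ 4 ∧
    ∀ T : ℝ, 480 * (160 * (((n : ℝ) + C.length) / ε) ^ 6) ^ 8 ≤ T →
      (∃ ψ, IsEvolution (Hadiabatic Q) T (gammaState Q 0) ψ) ∧
      ∀ ψ, IsEvolution (Hadiabatic Q) T (gammaState Q 0) ψ →
        totalVariation (measuredDistribution (n := n) (ψ T)) (circuitDistribution C) ≤ ε := by
  subst hQ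
  have h0 : 0 ≤ 2 * ((n : ℝ) * C.length + 1) / ε := by positivity
  have hM1 := Nat.le_ceil (2 * ((n : ℝ) * C.length + 1) / ε)
  have hM2 := (Nat.ceil_lt_add_one h0).le
  generalize ⌈2 * ((n : ℝ) * C.length + 1) / ε⌉₊ = M at hM1 hM2
  have hR : 1 ≤ (compile C M).rounds := by rw [rounds_compile]; omega
  obtain ⟨hy1, hsize, hsteps⟩ := polynomial_bounds hn hε hε1 hM2
  refine ⟨hsize, fun T hT => ?_⟩
  set y : ℝ := ((n : ℝ) + C.length) / ε with hy
  have hK : (((compile C M).steps : ℝ) + 1) ≤ 40 * y ^ 5 := by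
    have h1 := steps_add_one (compile C M) hn
    rw [rounds_compile, show n * C.length + M + 2 - 1 = n * C.length + M + 1 from rfl] at h1
    rw [← h1] at hsteps
    exact_mod_cast hsteps
  have hinv : 1 / ε ≤ y := by
    refine div_le_div_of_nonneg_right ?_ hε.le
    have : (1 : ℝ) ≤ n := by exact_mod_cast hn
    linarith [(Nat.cast_nonneg C.length : (0 : ℝ) ≤ C.length)]
  -- Precision `ε / 4` of the state costs at most `ε / 4 * (2 + ε / 4) / 2 ≤ ε / 2` in total
  -- variation, and the deviation of the history state from the output costs another `ε / 2`.
  have hT' : 480 * ((((compile C M).steps : ℝ) + 1) / (ε / 4)) ^ 8 ≤ T := by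
    refine le_trans (mul_le_mul_of_nonneg_left (pow_le_pow_left₀ (by positivity) ?_ 8)
      (by norm_num)) hT
    calc (((compile C M).steps : ℝ) + 1) / (ε / 4)
        = 4 * ((((compile C M).steps : ℝ) + 1) * (1 / ε)) := by field_simp
      _ ≤ 4 * ((40 * y ^ 5) * y) := by
          refine mul_le_mul_of_nonneg_left ?_ (by norm_num)
          exact mul_le_mul hK hinv (by positivity) (by positivity)
      _ = 160 * y ^ 6 := by ring
  obtain ⟨hex, hall⟩ := adiabatic_evolution (compile C M) hn hR (ε := ε / 4) (by linarith)
    (by linarith) hT'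
  refine ⟨hex, fun ψ hψ => ?_⟩
  obtain ⟨-, z, hz, hzε⟩ := hall ψ hψ
  exact totalVariation_le_of_near hn C hε hε1 hM1 hz hzε

end Output

theorem adiabatic_duration_bound {y : ℝ} (hy : 1 ≤ y) :
    480 * (160 * y ^ 6) ^ 8 = ((480 * 160 ^ 8 : ℕ) : ℝ) * y ^ 48 ∧
    480 * y ^ 8 ≤ ((480 * 160 ^ 8 : ℕ) : ℝ) * y ^ 48 ∧
    8 * y ^ 4 ≤ ((480 * 160 ^ 8 : ℕ) : ℝ) * y ^ 48 := by
  have h1 : y ^ 8 ≤ y ^ 48 := pow_le_pow_right₀ hy (by norm_num)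
  have h2 : y ^ 4 ≤ y ^ 48 := pow_le_pow_right₀ hy (by norm_num)
  have h3 : 0 ≤ y ^ 48 := by positivity
  push_cast
  refine ⟨by ring, ?_, ?_⟩ <;> nlinarith

end AdiabaticLine

theorem theorem1 :
    Fintype.card AdiabaticLine.Site = 9 ∧
    ∃ c d : ℕ, ∀ n : ℕ, 1 ≤ n →
      -- the adiabatic evolution attached to a circuit in round form
      (∀ Q : AdiabaticLine.RoundCircuit n, 1 ≤ Q.rounds →
        -- every Hamiltonian is a nearest-neighbour Hamiltonian
        (∀ s ∈ Set.Icc (0 : ℝ) 1,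
          AdiabaticLine.IsNearestNeighbour (3 * Q.size + 1) (AdiabaticLine.Hadiabatic Q s)) ∧
        -- the transition rules pass through orthonormal states, the last one holding the output
        (Orthonormal ℂ fun t : Fin (Q.steps + 1) => AdiabaticLine.gammaState Q t) ∧
        AdiabaticLine.gammaState Q Q.steps =
          ∑ x : Fin n → Bool, AdiabaticLine.outputAmplitude Q.toCircuit x •
            EuclideanSpace.single (AdiabaticLine.finalConfig Q x) (1 : ℂ) ∧
        AdiabaticLine.gammaState Q (Q.steps + 1) = 0 ∧
        -- initial and final ground states
        AdiabaticLine.IsGroundState (AdiabaticLine.Hinit Q) (AdiabaticLine.gammaState Q 0) ∧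
        AdiabaticLine.IsGroundState (AdiabaticLine.Hprop Q) (AdiabaticLine.historyState Q) ∧
        -- invariance of the history subspace, and the spectral gap on it
        (∀ s ∈ Set.Icc (0 : ℝ) 1,
          (∀ v ∈ AdiabaticLine.historySpace Q,
            Matrix.toEuclideanLin (AdiabaticLine.Hadiabatic Q s) v ∈
              AdiabaticLine.historySpace Q) ∧
          AdiabaticLine.HasGapOn (AdiabaticLine.Hadiabatic Q s) (AdiabaticLine.historySpace Q)
            (1 / (2 * ((Q.steps : ℝ) + 1) ^ 2))) ∧
        -- in polynomial time the evolution leads to the history state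
        (∀ ε : ℝ, 0 < ε → ε ≤ 1 → ∀ T : ℝ, c * (((Q.steps : ℝ) + 1) / ε) ^ d ≤ T →
          (∃ ψ, AdiabaticLine.IsEvolution (AdiabaticLine.Hadiabatic Q) T
            (AdiabaticLine.gammaState Q 0) ψ) ∧
          ∀ ψ, AdiabaticLine.IsEvolution (AdiabaticLine.Hadiabatic Q) T
              (AdiabaticLine.gammaState Q 0) ψ →
            (∀ t ∈ Set.Icc 0 T, ψ t ∈ AdiabaticLine.historySpace Q) ∧
            ∃ z : ℂ, ‖z‖ = 1 ∧ ‖ψ T - z • AdiabaticLine.historyState Q‖ ≤ ε)) ∧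
      -- simulation of an arbitrary circuit with polynomial overhead
      (∀ (C : AdiabaticLine.Circuit n) (M : ℕ),
        AdiabaticLine.circuitMatrix (AdiabaticLine.compile C M).toCircuit =
          AdiabaticLine.circuitMatrix C ∧
        (∀ r i : ℕ, (AdiabaticLine.compile C M).gate r i = 1 ∨
          (AdiabaticLine.compile C M).gate r i = AdiabaticLine.swapGate ∨
          ∃ g ∈ C, (AdiabaticLine.compile C M).gate r i = g.unitary ∨
            (AdiabaticLine.compile C M).gate r i =
              AdiabaticLine.swapGate * g.unitary * AdiabaticLine.swapGate)) ∧
      (∀ (C : AdiabaticLine.Circuit n) (ε : ℝ), 0 < ε → ε ≤ 1 →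
        ∀ Q : AdiabaticLine.RoundCircuit n,
        Q = AdiabaticLine.compile C ⌈2 * ((n : ℝ) * C.length + 1) / ε⌉₊ →
        (Q.size : ℝ) ≤ c * (((n : ℝ) + C.length) / ε) ^ d ∧
        ∀ T : ℝ, c * (((n : ℝ) + C.length) / ε) ^ d ≤ T →
          (∃ ψ, AdiabaticLine.IsEvolution (AdiabaticLine.Hadiabatic Q) T
            (AdiabaticLine.gammaState Q 0) ψ) ∧
          ∀ ψ, AdiabaticLine.IsEvolution (AdiabaticLine.Hadiabatic Q) T
              (AdiabaticLine.gammaState Q 0) ψ →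
            AdiabaticLine.totalVariation (AdiabaticLine.measuredDistribution (n := n) (ψ T))
              (AdiabaticLine.circuitDistribution C) ≤ ε) := by
  -- The state precision `ε / 4` needs the duration `480 * ((K + 1) / (ε / 4)) ^ 8`; for the
  -- compiled circuit `(K + 1) / (ε / 4) ≤ 160 * y ^ 6` with `y = (n + L) / ε`.
  refine ⟨by decide, 480 * 160 ^ 8, 48, fun n hn => ⟨fun Q hR => ?_, fun C M => ?_, ?_⟩⟩
  · refine ⟨fun s hs => AdiabaticLine.isNearestNeighbour_Hadiabatic Q hs,
      AdiabaticLine.orthonormal_gammaState Q hn hR, ?_,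
      AdiabaticLine.gammaState_steps_succ Q hn hR, AdiabaticLine.isGroundState_Hinit Q hn hR,
      AdiabaticLine.isGroundState_Hprop Q hn hR,
      fun s hs => ⟨fun v hv => AdiabaticLine.historySpace_invariant Q hn hR s hv,
        AdiabaticLine.hasGapOn_historySpace Q hn hR hs⟩, fun ε hε hε1 T hT => ?_⟩
    · rw [AdiabaticLine.gammaState_eq Q hn hR _ le_rfl, AdiabaticLine.timeState_steps Q hn hR]
      rfl
    · have hy : 1 ≤ ((Q.steps : ℝ) + 1) / ε := by
        rw [le_div_iff₀ hε]
        linarith [(Nat.cast_nonneg Q.steps : (0 : ℝ) ≤ Q.steps)]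
      exact AdiabaticLine.adiabatic_evolution Q hn hR hε hε1
        ((AdiabaticLine.adiabatic_duration_bound hy).2.1.trans hT)
  · exact ⟨AdiabaticLine.circuitMatrix_compile hn C M, AdiabaticLine.compile_gate C M⟩
  · intro C ε hε hε1 Q hQ
    have hy : 1 ≤ ((n : ℝ) + C.length) / ε := by
      have h1 : (1 : ℝ) ≤ n := by exact_mod_cast hn
      rw [le_div_iff₀ hε]
      linarith [(Nat.cast_nonneg C.length : (0 : ℝ) ≤ C.length)]
    obtain ⟨e, -, h2⟩ := AdiabaticLine.adiabatic_duration_bound hy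
    obtain ⟨h3, h4⟩ := AdiabaticLine.simulation hn C hε hε1 hQ
    exact ⟨h3.trans h2, fun T hT => h4 T (e.le.trans hT)⟩
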